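/- A \emph{subshift} is a compact set $X\subset\mathbb N^{\mathbb Z}$ (product topology, $\mathbb N$ discrete) with $\sigma(X)=X$, where $\sigma(x)_i=x_{i+1}$. Its language is the set of finite words over $\mathbb N$ occurring in points of $X$, and $X$ is $\Pi^0_1$ if the complement of its language is recursively enumerable. A \emph{subsystem} of $X$ is a subshift $Y\subset X$ (including $\emptyset$ and $X$). For a finite set $C$ of words let $[C]$ be the set of all $x\in\mathbb N^{\mathbb Z}$ such that some $u\in C$ satisfies $x_0x_1\cdots x_{|u|-1}=u$. The \emph{starfree languages} over $\{0,\dots,m-1\}$ are those denoted by expressions built from finite languages over $\{0,\dots,m-1\}$ by union, concatenation and complementation with respect to $\{0,\dots,m-1\}^*$. \textbf{Theorem.} Let $X$ be a countable $\Pi^0_1$ subshift with at most $5$ subsystems (counting $\emptyset$ and $X$). Then the model-checking problem of $X$ for starfree languages is decidable. That is, the following set is recursive: the pairs consisting of a starfree expression and a list $C_0,\dots,C_{m-1}$ (any $m$) of finite sets of words such that $X$ is the disjoint union of the clopen sets $X\cap[C_0],\dots,X\cap[C_{m-1}]$ (some possibly empty) and such that, for the language $L\subset\{0,\dots,m-1\}^*$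 denoted by the expression, there exist a word $w\in L$ and a point $x\in X$ with $\sigma^i(x)\in[C_{w_i}]$ for all $0\le i<|w|$. -/

import Mathlib

/-! ### Subshifts of `ℕ^ℤ` -/

/-- The shift map on bi-infinite sequences of natural numbers: `σ(x)_i = x_{i+1}`. -/
def shiftMap (x : ℤ → ℕ) : ℤ → ℕ := fun i => x (i + 1)

/-- A subshift: a compact subset `X` of `ℕ^ℤ` (the product topology of the discrete topology on
`ℕ`) with `σ(X) = X`. Compactness forces the alphabet of `X` to be finite. -/
def IsSubshift (X : Set (ℤ → ℕ)) : Prop :=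
  IsCompact X ∧ shiftMap '' X = X

/-- The set of all subsystems of `X`; the empty subshift and, if `X` is a subshift, `X` itself
are among them. -/
def subsystems (X : Set (ℤ → ℕ)) : Set (Set (ℤ → ℕ)) :=
  {Y | Y ⊆ X ∧ IsSubshift Y}

/-- The word `u` occurs in `x` at coordinate `i`: `x_{[i, i + |u| - 1]} = u`. -/
def OccursAt (x : ℤ → ℕ) (i : ℤ) (u : List ℕ) : Prop :=
  ∀ (k : ℕ) (hk : k < u.length), x (i + k) = u[k]

/-- The language `B(X)` of `X`: the words that occur in some point of `X`. -/
def wordsOf (X : Set (ℤ → ℕ)) : Set (List ℕ) :=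
  {u | ∃ x ∈ X, ∃ i : ℤ, OccursAt x i u}

/-- `X` is `Π⁰₁`: the complement of its language is recursively enumerable. -/
def IsPiOne (X : Set (ℤ → ℕ)) : Prop :=
  REPred fun u : List ℕ => u ∉ wordsOf X

/-! ### Starfree languages -/

/-- Starfree expressions: built from finite languages (given by a list of words) by union,
concatenation and complementation. The letters of a word are natural numbers. -/
inductive StarfreeExpr : Type where
  | finite (F : List (List ℕ)) : StarfreeExpr
  | union (a b : StarfreeExpr) : StarfreeExpr
  | concat (a b : StarfreeExpr) : StarfreeExpr
  | compl (a : StarfreeExpr) : StarfreeExpr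

namespace StarfreeExpr

/-- The words over the `m`-letter alphabet `{0, …, m - 1}`. -/
def wordsOver (m : ℕ) : Set (List ℕ) := {w | ∀ a ∈ w, a < m}

/-- The language over the `m`-letter alphabet `{0, …, m - 1}` denoted by a starfree expression.
Complements are taken with respect to the set of all words over this alphabet, and words in
finite languages that use other letters are discarded. -/
def lang (m : ℕ) : StarfreeExpr → Set (List ℕ)
  | finite F => {w | w ∈ F ∧ w ∈ wordsOver m}
  | union a b => lang m a ∪ lang m b
  | concat a b => {w | ∃ u ∈ lang m a, ∃ v ∈ lang m b, w = u ++ v}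
  | compl a => wordsOver m \ lang m a

/-- The Gödel number of a starfree expression. -/
def toNat : StarfreeExpr → ℕ
  | finite F => 4 * Encodable.encode F
  | union a b => 4 * Nat.pair (toNat a) (toNat b) + 1
  | concat a b => 4 * Nat.pair (toNat a) (toNat b) + 2
  | compl a => 4 * toNat a + 3

/-- The starfree expression with a given Gödel number. -/
def ofNat (n : ℕ) : StarfreeExpr :=
  if n % 4 = 0 then finite (Denumerable.ofNat (List (List ℕ)) (n / 4))
  else if h1 : n % 4 = 1 then union (ofNat (n / 4).unpair.1) (ofNat (n / 4).unpair.2)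
  else if h2 : n % 4 = 2 then concat (ofNat (n / 4).unpair.1) (ofNat (n / 4).unpair.2)
  else compl (ofNat (n / 4))
termination_by n
decreasing_by
  all_goals
    have := Nat.unpair_left_le (n / 4)
    have := Nat.unpair_right_le (n / 4)
    omega

theorem ofNat_toNat (e : StarfreeExpr) : ofNat (toNat e) = e := by
  induction e with
  | finite F =>
    rw [ofNat, toNat, if_pos (by omega), Nat.mul_div_cancel_left _ (by norm_num),
      Denumerable.ofNat_encode]
  | union a b iha ihb =>
    have h : (4 * Nat.pair (toNat a) (toNat b) + 1) / 4 = Nat.pair (toNat a) (toNat b) := by omega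
    rw [ofNat, toNat, if_neg (by omega), dif_pos (by omega), h, Nat.unpair_pair]
    simp only [iha, ihb]
  | concat a b iha ihb =>
    have h : (4 * Nat.pair (toNat a) (toNat b) + 2) / 4 = Nat.pair (toNat a) (toNat b) := by omega
    rw [ofNat, toNat, if_neg (by omega), dif_neg (by omega), dif_pos (by omega), h,
      Nat.unpair_pair]
    simp only [iha, ihb]
  | compl a iha =>
    have h : (4 * toNat a + 3) / 4 = toNat a := by omega
    rw [ofNat, toNat, if_neg (by omega), dif_neg (by omega), dif_neg (by omega), h, iha]

theorem toNat_ofNat (n : ℕ) : toNat (ofNat n) = n := by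
  induction n using Nat.strong_induction_on with
  | _ n ih =>
    have hl := Nat.unpair_left_le (n / 4)
    have hr := Nat.unpair_right_le (n / 4)
    rw [ofNat]
    split_ifs with h0 h1 h2
    · rw [toNat, Denumerable.encode_ofNat]; omega
    · rw [toNat, ih _ (by omega), ih _ (by omega), Nat.pair_unpair]; omega
    · rw [toNat, ih _ (by omega), ih _ (by omega), Nat.pair_unpair]; omega
    · rw [toNat, ih _ (by omega)]; omega

/-- Starfree expressions are identified with natural numbers through their Gödel numbers; this is
how they are given to an algorithm (`Primcodable` is inferred from it). -/
instance instDenumerable : Denumerable StarfreeExpr :=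
  Denumerable.mk' ⟨toNat, ofNat, ofNat_toNat, toNat_ofNat⟩

end StarfreeExpr

/-! ### The model-checking problem -/

/-- The clopen set `[C] = {x | some word of C is a prefix of x_0 x_1 x_2 …}` given by a finite list
`C` of words. -/
def clopenOf (C : List (List ℕ)) : Set (ℤ → ℕ) :=
  {x | ∃ u ∈ C, OccursAt x 0 u}

/-- `P = [C_0, …, C_{m-1}]` describes a clopen partition of `X`: each point of `X` is in `[C_j]` for
exactly one index `j < m`. (Parts may be empty.) -/
def IsClopenPartition (X : Set (ℤ → ℕ)) (P : List (List (List ℕ))) : Prop :=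
  ∀ x ∈ X, ∃! j : Fin P.length, x ∈ clopenOf (P.get j)

/-- The question asked about an instance: there are a word `w` in `L` and a point `x ∈ X` with
`σ^i(x) ∈ [C_{w_i}]` for all `i < |w|`. -/
def HasTrace (X : Set (ℤ → ℕ)) (P : List (List (List ℕ))) (L : Set (List ℕ)) : Prop :=
  ∃ w ∈ L, ∃ x ∈ X, ∀ (i : ℕ) (hi : i < w.length),
    ∃ hj : w[i] < P.length, shiftMap^[i] x ∈ clopenOf P[w[i]]

/-- The model-checking problem of `X` for starfree languages is decidable: the set of pairs of a
starfree expression and a list `P` of `m` finite sets of words, such that `P` is a clopen partition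
of `X` and the starfree language over `m` letters given by the expression has a trace in `X`, is
recursive. -/
def DecidableStarfreeModelChecking (X : Set (ℤ → ℕ)) : Prop :=
  ComputablePred fun I : StarfreeExpr × List (List (List ℕ)) =>
    IsClopenPartition X I.2 ∧ HasTrace X I.2 (I.1.lang I.2.length)

/-! Starfree languages are aperiodic. The relation `WordSim t t` is a congruence on words. Over a
fixed alphabet, similar words lie in the same languages of expressions whose concatenation depth and
word lengths are at most `t` (`WordSim.mem_lang_of_mem`), and all sufficiently high powers of a
nonempty word are similar (`WordSim.pow_pow`). It is therefore enough to find a computable `M` such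
that each word read off a point of `X` by a code of radius `t` is similar to one of length at most
`M t` (`exists_computable_bound_of_encard_le`). A trace can always be found by search. Given the
bound, its absence amounts to finitely many semidecidable checks
(`decidableStarfreeModelChecking_of_bound`).

The bound comes from dynamics. Suppose that in one direction `x` accumulates exactly on the orbit
closure of `r`, and that the words coded between consecutive occurrences of a central word of `r`,
in sequences close enough to that orbit closure, are all similar to one word `C`
(`HasUniformReturns`). After enough returns the coded word contains a saturated power of `C`, and
longer pieces of `x` bring nothing new. Only the required closeness has to be computable in `t`; the
word `C` may depend on the code in any way.

By countability and Baire's theorem each point is isolated in its orbit closure, so a central word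
identifies it. Returns to a periodic point are constant. A return to a nonperiodic `r` leaves along
the right half of `r`, passes many returns to a simpler point, and comes back along the left half of
`r`; uniformity is inherited (`HasUniformReturns.of_tendsTo_both`,
`HasUniformReturns.of_tendsTo_right`, `HasUniformReturns.of_tendsTo_left`). Counting subsystems
shows that the limit set of a nonperiodic point is a single orbit closure (`exists_limitSet_eq`),
and that the two limit sets of a nonperiodic `r` strictly below some `x` are comparable
(`subset_or_subset`). This leaves only the cases just listed.

For effectivity, a subsystem is cut out of `X` by finitely many forbidden words, since there are
finitely many subsystems (`exists_forbiddenWords`). Hence its language is co-r.e., isolated points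
are computable, and all rates of approach and recurrence are found by search. -/

section RecursivelyEnumerable

/-! ### Closure properties of recursively enumerable predicates -/

variable {α β γ : Type*} [Primcodable α] [Primcodable β] [Primcodable γ]

/-- The stages are step-bounded evaluations of a code. Their monotonicity lets finitely many
conditions be met at one common stage, the maximum of the individual ones. -/
theorem REPred.exists_primrec_stage {p : α → Prop} (hp : REPred p) :
    ∃ q : α → ℕ → Bool, Primrec₂ q ∧ (∀ a, p a ↔ ∃ n, q a n = true) ∧
      ∀ a m n, m ≤ n → q a m = true → q a n = true := by
  obtain ⟨c, hc⟩ := Nat.Partrec.Code.exists_code.1 hp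
  refine ⟨fun a n => (Nat.Partrec.Code.evaln n c (Encodable.encode a)).isSome, ?_, ?_, ?_⟩
  · exact Primrec.option_isSome.comp (Nat.Partrec.Code.primrec_evaln.comp
      (Primrec.pair (Primrec.pair Primrec.snd (Primrec.const c))
        (Primrec.encode.comp Primrec.fst)))
  · intro a
    have h1 : p a ↔ ∃ x, x ∈ c.eval (Encodable.encode a) := by
      rw [hc]
      simp
    rw [h1]
    constructor
    · rintro ⟨x, hx⟩
      obtain ⟨k, hk⟩ := Nat.Partrec.Code.evaln_complete.1 hx
      exact ⟨k, Option.isSome_iff_exists.2 ⟨x, hk⟩⟩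
    · rintro ⟨n, hn⟩
      obtain ⟨x, hx⟩ := Option.isSome_iff_exists.1 hn
      exact ⟨x, Nat.Partrec.Code.evaln_sound hx⟩
  · intro a m n hmn h
    obtain ⟨x, hx⟩ := Option.isSome_iff_exists.1 h
    exact Option.isSome_iff_exists.2 ⟨x, Nat.Partrec.Code.evaln_mono hmn hx⟩

theorem REPred.of_computable_stage {q : α → ℕ → Bool} (hq : Computable₂ q) :
    REPred fun a => ∃ n, q a n = true := by
  have h : Partrec fun a => Nat.rfind fun n => (Part.some (q a n) : Part Bool) :=
    Partrec.rfind hq.partrec₂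
  refine h.dom_re.of_eq fun a => Nat.rfind_dom.trans ⟨?_, ?_⟩
  · rintro ⟨n, hn, -⟩
    exact ⟨n, (Part.mem_some_iff.1 hn).symm⟩
  · rintro ⟨n, hn⟩
    exact ⟨n, Part.mem_some_iff.2 hn.symm, fun _ => trivial⟩

theorem REPred.comp {p : β → Prop} (hp : REPred p) {f : α → β} (hf : Computable f) :
    REPred fun a => p (f a) :=
  Partrec.comp (f := fun b => Part.assert (p b) fun _ => Part.some ()) hp hf

theorem REPred.const (p : Prop) : REPred fun _ : α => p := by
  by_cases h : p
  · exact (REPred.of_computable_stage (q := fun (_ : α) _ => true)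
      (Computable.const true)).of_eq fun a => by simp [h]
  · exact (REPred.of_computable_stage (q := fun (_ : α) _ => false)
      (Computable.const false)).of_eq fun a => by simp [h]

theorem PrimrecPred.to_re {p : α → Prop} (hp : PrimrecPred p) : REPred p :=
  hp.computablePred.to_re

theorem REPred.and {p q : α → Prop} (hp : REPred p) (hq : REPred q) :
    REPred fun a => p a ∧ q a := by
  obtain ⟨f, hf, hpf, hmf⟩ := hp.exists_primrec_stage
  obtain ⟨g, hg, hqg, hmg⟩ := hq.exists_primrec_stage
  refine (REPred.of_computable_stage (q := fun a n => f a n && g a n)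
    (Primrec.and.comp hf hg).to_comp).of_eq fun a => ?_
  rw [hpf, hqg]
  constructor
  · rintro ⟨n, hn⟩
    rw [Bool.and_eq_true] at hn
    exact ⟨⟨n, hn.1⟩, n, hn.2⟩
  · rintro ⟨⟨m, hm⟩, n, hn⟩
    exact ⟨max m n, by
      rw [Bool.and_eq_true]
      exact ⟨hmf a _ _ (le_max_left _ _) hm, hmg a _ _ (le_max_right _ _) hn⟩⟩

theorem REPred.or {p q : α → Prop} (hp : REPred p) (hq : REPred q) :
    REPred fun a => p a ∨ q a := by
  obtain ⟨f, hf, hpf, hmf⟩ := hp.exists_primrec_stage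
  obtain ⟨g, hg, hqg, hmg⟩ := hq.exists_primrec_stage
  refine (REPred.of_computable_stage (q := fun a n => f a n || g a n)
    (Primrec.or.comp hf hg).to_comp).of_eq fun a => ?_
  rw [hpf, hqg]
  constructor
  · rintro ⟨n, hn⟩
    rw [Bool.or_eq_true] at hn
    exact hn.imp (fun h => ⟨n, h⟩) fun h => ⟨n, h⟩
  · rintro (⟨n, hn⟩ | ⟨n, hn⟩) <;> exact ⟨n, by simp [hn]⟩

theorem REPred.exists {p : α → β → Prop} (hp : REPred fun x : α × β => p x.1 x.2) :
    REPred fun a => ∃ b, p a b := by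
  obtain ⟨f, hf, hpf, hmf⟩ := hp.exists_primrec_stage
  -- Dovetailing: `n` codes a candidate witness and a stage. A number that decodes to no element of
  -- `β` is rejected by the default `false`.
  have hq : Primrec₂ fun (a : α) (n : ℕ) =>
      ((Encodable.decode (α := β) n.unpair.1).map fun b => f (a, b) n.unpair.2).getD false := by
    refine Primrec.option_getD.comp (Primrec.option_map
      (Primrec.decode.comp (Primrec.fst.comp (Primrec.unpair.comp Primrec.snd))) ?_)
      (Primrec.const false)
    exact hf.comp (Primrec.pair (Primrec.fst.comp Primrec.fst) Primrec.snd)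
      (Primrec.snd.comp (Primrec.unpair.comp (Primrec.snd.comp Primrec.fst)))
  refine (REPred.of_computable_stage hq.to_comp).of_eq fun a => ?_
  constructor
  · rintro ⟨n, hn⟩
    cases hd : Encodable.decode (α := β) n.unpair.1 with
    | none => simp [hd] at hn
    | some b => exact ⟨b, (hpf (a, b)).2 ⟨_, by simpa [hd] using hn⟩⟩
  · rintro ⟨b, hb⟩
    obtain ⟨n, hn⟩ := (hpf (a, b)).1 hb
    exact ⟨Nat.pair (Encodable.encode b) n, by simpa using hn⟩

theorem REPred.forall_mem {p : α → β → Prop} (hp : REPred fun x : α × β => p x.1 x.2)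
    {l : α → List β} (hl : Computable l) : REPred fun a => ∀ b ∈ l a, p a b := by
  obtain ⟨f, hf, hpf, hmf⟩ := hp.exists_primrec_stage
  have hrel : PrimrecRel fun (b : β) (x : α × ℕ) => f (x.1, b) x.2 = true := by
    refine Primrec.eq.comp (hf.comp (Primrec.pair (Primrec.fst.comp Primrec.snd) Primrec.fst)
      (Primrec.snd.comp Primrec.snd)) (Primrec.const true)
  obtain ⟨hdec, hall⟩ := hrel.forall_mem_list
  have hq : Computable₂ fun (a : α) (n : ℕ) => decide (∀ b ∈ l a, f (a, b) n = true) :=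
    (hall.to_comp.comp (Computable.pair (hl.comp Computable.fst) Computable.id)).of_eq
      fun x => by simp
  refine (REPred.of_computable_stage hq).of_eq fun a => ?_
  simp only [decide_eq_true_eq]
  constructor
  · rintro ⟨n, hn⟩ b hb
    exact (hpf (a, b)).2 ⟨n, hn b hb⟩
  · intro h
    generalize l a = L at h
    induction L with
    | nil => exact ⟨0, by simp⟩
    | cons b L ih =>
      obtain ⟨n, hn⟩ := ih fun b hb => h b (List.mem_cons_of_mem _ hb)
      obtain ⟨m, hm⟩ := (hpf (a, b)).1 (h b List.mem_cons_self)
      refine ⟨max m n, fun c hc => ?_⟩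
      rcases List.mem_cons.1 hc with rfl | hc
      · exact hmf _ _ _ (le_max_left _ _) hm
      · exact hmf _ _ _ (le_max_right _ _) (hn c hc)

/-- Unbounded search over pairs of a witness and a stage halts because a witness always exists. -/
theorem REPred.exists_computable_choice {p : α → ℕ → Prop}
    (hp : REPred fun x : α × ℕ => p x.1 x.2) (h : ∀ a, ∃ n, p a n) :
    ∃ g : α → ℕ, Computable g ∧ ∀ a, p a (g a) := by
  obtain ⟨f, hf, hpf, -⟩ := hp.exists_primrec_stage
  have hex : ∀ a, ∃ n : ℕ, f (a, n.unpair.1) n.unpair.2 = true := fun a => by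
    obtain ⟨n, hn⟩ := h a
    obtain ⟨k, hk⟩ := (hpf (a, n)).1 hn
    exact ⟨Nat.pair n k, by simpa using hk⟩
  have hc : ComputablePred fun x : α × ℕ => f (x.1, x.2.unpair.1) x.2.unpair.2 = true := by
    have : PrimrecPred fun x : α × ℕ => f (x.1, x.2.unpair.1) x.2.unpair.2 = true :=
      Primrec.eq.comp (hf.comp (Primrec.pair Primrec.fst
        (Primrec.fst.comp (Primrec.unpair.comp Primrec.snd)))
        (Primrec.snd.comp (Primrec.unpair.comp Primrec.snd))) (Primrec.const true)
    exact this.computablePred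
  refine ⟨fun a => (Nat.find (hex a)).unpair.1, ?_, fun a => ?_⟩
  · exact Computable.fst.comp (Computable.unpair.comp (Computable.find hc hex))
  · exact (hpf (a, _)).2 ⟨_, Nat.find_spec (hex a)⟩

end RecursivelyEnumerable

/-! ### Decidability of membership in starfree languages -/

/-- All words of length `n` over the alphabet `{0, …, K - 1}`. -/
def wordList (K : ℕ) : ℕ → List (List ℕ)
  | 0 => [[]]
  | n + 1 => (wordList K n).flatMap fun w => (List.range K).map fun a => a :: w

theorem mem_wordList {K n : ℕ} {w : List ℕ} :
    w ∈ wordList K n ↔ w.length = n ∧ ∀ a ∈ w, a < K := by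
  induction n generalizing w with
  | zero =>
    simp only [wordList, List.mem_singleton, List.length_eq_zero_iff]
    exact ⟨by rintro rfl; simp, fun h => h.1⟩
  | succ n ih =>
    simp only [wordList, List.mem_flatMap, List.mem_map, List.mem_range, ih]
    constructor
    · rintro ⟨v, ⟨hv, hvK⟩, a, ha, rfl⟩
      simpa [hv, ha] using hvK
    · rintro ⟨hw, hK⟩
      cases w with
      | nil => simp at hw
      | cons a v =>
        simp only [List.length_cons, Nat.add_right_cancel_iff] at hw
        exact ⟨v, ⟨hw, fun b hb => hK b (List.mem_cons_of_mem _ hb)⟩, a,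
          hK a List.mem_cons_self, rfl⟩

theorem primrec_wordList : Primrec₂ wordList := by
  have hstep : Primrec₂ fun (K : ℕ) (x : ℕ × List (List ℕ)) =>
      x.2.flatMap fun w => (List.range K).map fun a => a :: w := by
    refine Primrec.list_flatMap (Primrec.snd.comp Primrec.snd) ?_
    refine Primrec.list_map (Primrec.list_range.comp (Primrec.fst.comp Primrec.fst)) ?_
    exact Primrec.list_cons.comp Primrec.snd (Primrec.snd.comp Primrec.fst)
  refine Primrec₂.of_eq (Primrec.nat_rec (f := fun _ : ℕ => [[]]) (Primrec.const _) hstep)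
    fun K n => ?_
  induction n with
  | zero => rfl
  | succ n ih => simp only [wordList, ← ih]

namespace StarfreeExpr

/-- All words of length at most `n` over the `m`-letter alphabet. -/
def wordsUpTo (m n : ℕ) : List (List ℕ) := (List.range (n + 1)).flatMap (wordList m)

theorem mem_wordsUpTo {m n : ℕ} {w : List ℕ} :
    w ∈ wordsUpTo m n ↔ w.length ≤ n ∧ w ∈ wordsOver m := by
  simp [wordsUpTo, mem_wordList, wordsOver]

theorem primrec_wordsUpTo : Primrec₂ wordsUpTo :=
  Primrec.list_flatMap (Primrec.list_range.comp (Primrec.succ.comp Primrec.snd))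
    (primrec_wordList.comp (Primrec.fst.comp Primrec.fst) Primrec.snd)

/-- The words of length at most `n` in the language over `m` letters denoted by an expression. -/
def langUpTo (m n : ℕ) : StarfreeExpr → List (List ℕ)
  | finite F => (wordsUpTo m n).filter fun w => w ∈ F
  | union a b => langUpTo m n a ++ langUpTo m n b
  | concat a b => (wordsUpTo m n).filter fun w =>
      w ∈ (langUpTo m n a).flatMap fun u => (langUpTo m n b).map fun v => u ++ v
  | compl a => (wordsUpTo m n).filter fun w => ¬ w ∈ langUpTo m n a

theorem lang_subset_wordsOver (m : ℕ) (e : StarfreeExpr) : e.lang m ⊆ wordsOver m := by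
  induction e with
  | finite F => exact fun w hw => hw.2
  | union a b iha ihb => exact Set.union_subset iha ihb
  | concat a b iha ihb =>
    rintro _ ⟨u, hu, v, hv, rfl⟩ x hx
    exact (List.mem_append.1 hx).elim (iha hu x) (ihb hv x)
  | compl a iha => exact Set.sdiff_subset

/-- Truncation at length `n` commutes with all operations: factors of a short word are short, and a
complement can be taken among the short words. -/
theorem mem_langUpTo {m n : ℕ} {e : StarfreeExpr} {w : List ℕ} :
    w ∈ e.langUpTo m n ↔ w.length ≤ n ∧ w ∈ e.lang m := by
  induction e generalizing w with
  | finite F =>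
    simp only [langUpTo, List.mem_filter, mem_wordsUpTo, lang, Set.mem_ofPred_eq,
      decide_eq_true_eq]
    tauto
  | union a b iha ihb =>
    simp only [langUpTo, List.mem_append, iha, ihb, lang, Set.mem_union]
    tauto
  | concat a b iha ihb =>
    simp only [langUpTo, List.mem_filter, mem_wordsUpTo, lang, Set.mem_ofPred_eq,
      decide_eq_true_eq, List.mem_flatMap, List.mem_map, iha, ihb]
    constructor
    · rintro ⟨⟨hn, -⟩, u, ⟨-, hu⟩, v, ⟨-, hv⟩, rfl⟩
      exact ⟨hn, u, hu, v, hv, rfl⟩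
    · rintro ⟨hn, u, hu, v, hv, rfl⟩
      rw [List.length_append] at hn
      refine ⟨⟨by simpa using hn, ?_⟩, u, ⟨by omega, hu⟩, v, ⟨by omega, hv⟩, rfl⟩
      exact lang_subset_wordsOver m (concat a b) ⟨u, hu, v, hv, rfl⟩
  | compl a iha =>
    simp only [langUpTo, List.mem_filter, mem_wordsUpTo, lang, decide_eq_true_eq, iha,
      Set.mem_sdiff]
    tauto

/-- One step of the course-of-values recursion that computes `langUpTo` from Gödel numbers. -/
def langStep (p : ℕ × ℕ) (L : List (List (List ℕ))) : List (List ℕ) :=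
  if L.length % 4 = 0 then (wordsUpTo p.1 p.2).filter
    fun w => w ∈ Denumerable.ofNat (List (List ℕ)) (L.length / 4)
  else if L.length % 4 = 1 then
    L.getD (L.length / 4).unpair.1 [] ++ L.getD (L.length / 4).unpair.2 []
  else if L.length % 4 = 2 then (wordsUpTo p.1 p.2).filter fun w =>
    w ∈ (L.getD (L.length / 4).unpair.1 []).flatMap fun u =>
      (L.getD (L.length / 4).unpair.2 []).map fun v => u ++ v
  else (wordsUpTo p.1 p.2).filter fun w => ¬ w ∈ L.getD (L.length / 4) []

theorem primrecRel_mem {α : Type*} [Primcodable α] :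
    PrimrecRel fun (a : α) (l : List α) => a ∈ l :=
  (Primrec.eq.exists_mem_list (α := α)).swap.of_eq fun a l => by simp

theorem primrec_langStep : Primrec₂ langStep := by
  have hlen : Primrec fun x : (ℕ × ℕ) × List (List (List ℕ)) => x.2.length :=
    Primrec.list_length.comp Primrec.snd
  have hq : Primrec fun x : (ℕ × ℕ) × List (List (List ℕ)) => x.2.length / 4 :=
    Primrec.nat_div.comp hlen (Primrec.const 4)
  have hmod (k : ℕ) :
      PrimrecPred fun x : (ℕ × ℕ) × List (List (List ℕ)) => x.2.length % 4 = k :=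
    Primrec.eq.comp (Primrec.nat_mod.comp hlen (Primrec.const 4)) (Primrec.const k)
  have hW : Primrec fun x : (ℕ × ℕ) × List (List (List ℕ)) => wordsUpTo x.1.1 x.1.2 :=
    primrec_wordsUpTo.comp (Primrec.fst.comp Primrec.fst) (Primrec.snd.comp Primrec.fst)
  have hl : Primrec fun x : (ℕ × ℕ) × List (List (List ℕ)) =>
      x.2.getD (x.2.length / 4).unpair.1 [] :=
    (Primrec.list_getD []).comp Primrec.snd (Primrec.fst.comp (Primrec.unpair.comp hq))
  have hr : Primrec fun x : (ℕ × ℕ) × List (List (List ℕ)) =>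
      x.2.getD (x.2.length / 4).unpair.2 [] :=
    (Primrec.list_getD []).comp Primrec.snd (Primrec.snd.comp (Primrec.unpair.comp hq))
  have hfil : Primrec₂ fun (L M : List (List ℕ)) => L.filter fun w => w ∈ M :=
    (primrecRel_mem (α := List ℕ)).listFilter
  have hfiln : Primrec₂ fun (L M : List (List ℕ)) => L.filter fun w => ¬ w ∈ M :=
    (primrecRel_mem (α := List ℕ)).not.listFilter
  refine Primrec.ite (hmod 0) (hfil.comp hW ((Primrec.ofNat _).comp hq)) ?_
  refine Primrec.ite (hmod 1) (Primrec.list_append.comp hl hr) ?_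
  refine Primrec.ite (hmod 2) (hfil.comp hW (Primrec.list_flatMap hl ?_)) ?_
  · exact Primrec.list_map (hr.comp Primrec.fst)
      (Primrec.list_append.comp (Primrec.snd.comp Primrec.fst) Primrec.snd)
  · exact hfiln.comp hW ((Primrec.list_getD []).comp Primrec.snd hq)

/-- Gödel numbers of subexpressions are smaller than that of the expression, so the values needed
are already in the list and the default of `getD` is never used. -/
theorem langStep_eq (p : ℕ × ℕ) (c : ℕ) :
    langStep p ((List.range c).map fun i => (ofNat i).langUpTo p.1 p.2) =
      (ofNat c).langUpTo p.1 p.2 := by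
  have hget (i : ℕ) (hi : i < c) :
      ((List.range c).map fun i => (ofNat i).langUpTo p.1 p.2).getD i [] =
        (ofNat i).langUpTo p.1 p.2 := by
    simp [List.getD, hi]
  have hl := Nat.unpair_left_le (c / 4)
  have hr := Nat.unpair_right_le (c / 4)
  rw [langStep, ofNat]
  simp only [List.length_map, List.length_range]
  by_cases h0 : c % 4 = 0
  · simp only [h0, if_true, langUpTo]
  by_cases h1 : c % 4 = 1
  · simp only [h1, if_false, if_true, dif_pos, langUpTo, one_ne_zero]
    rw [hget _ (by omega), hget _ (by omega)]
  by_cases h2 : c % 4 = 2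
  · rw [if_neg h0, if_neg h1, if_pos h2, if_neg h0, dif_neg h1, dif_pos h2, langUpTo]
    rw [hget _ (by omega), hget _ (by omega)]
  · rw [if_neg h0, if_neg h1, if_neg h2, if_neg h0, dif_neg h1, dif_neg h2, langUpTo]
    rw [hget _ (by omega)]

theorem primrec_langUpTo : Primrec fun x : (ℕ × ℕ) × StarfreeExpr => x.2.langUpTo x.1.1 x.1.2 := by
  have h : Primrec₂ fun (p : ℕ × ℕ) (c : ℕ) => (ofNat c).langUpTo p.1 p.2 := by
    refine Primrec.nat_strong_rec _ (g := fun p L => some (langStep p L))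
      (Primrec.option_some.comp₂ primrec_langStep) fun p c => ?_
    rw [langStep_eq]
  refine (h.comp Primrec.fst (Primrec.encode.comp Primrec.snd)).of_eq fun x => ?_
  exact congrArg (langUpTo x.1.1 x.1.2) (ofNat_toNat x.2)

theorem computablePred_mem_lang :
    ComputablePred fun x : (List ℕ × ℕ) × StarfreeExpr => x.1.1 ∈ x.2.lang x.1.2 := by
  have h : PrimrecPred fun x : (List ℕ × ℕ) × StarfreeExpr =>
      x.1.1 ∈ x.2.langUpTo x.1.2 x.1.1.length := by
    refine primrecRel_mem.comp (Primrec.fst.comp Primrec.fst) (primrec_langUpTo.comp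
      (Primrec.pair (Primrec.pair (Primrec.snd.comp Primrec.fst)
        (Primrec.list_length.comp (Primrec.fst.comp Primrec.fst))) Primrec.snd))
  exact h.computablePred.of_eq fun x => by simp [mem_langUpTo]

/-- The nesting depth of concatenations in a starfree expression. -/
def depth : StarfreeExpr → ℕ
  | finite _ => 0
  | union a b => max a.depth b.depth
  | concat a b => max a.depth b.depth + 1
  | compl a => a.depth

/-- `e.LengthsLE l`: the words in the finite languages of `e` have length at most `l`. -/
def LengthsLE (l : ℕ) : StarfreeExpr → Prop
  | finite F => ∀ w ∈ F, w.length ≤ l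
  | union a b => a.LengthsLE l ∧ b.LengthsLE l
  | concat a b => a.LengthsLE l ∧ b.LengthsLE l
  | compl a => a.LengthsLE l

/-- Together with `lengthsLE_toNat`, this makes the Gödel number a single computable bound for both
parameters of `WordSim`. -/
theorem depth_le_toNat (e : StarfreeExpr) : e.depth ≤ e.toNat := by
  induction e with
  | finite F => exact Nat.zero_le _
  | union a b iha ihb =>
    have h1 := Nat.left_le_pair a.toNat b.toNat
    have h2 := Nat.right_le_pair a.toNat b.toNat
    simp only [depth, toNat]
    omega
  | concat a b iha ihb =>
    have h1 := Nat.left_le_pair a.toNat b.toNat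
    have h2 := Nat.right_le_pair a.toNat b.toNat
    simp only [depth, toNat]
    omega
  | compl a iha =>
    simp only [depth, toNat]
    omega

theorem _root_.List.encode_le_encode_of_mem {α : Type*} [Encodable α] {l : List α} {a : α}
    (h : a ∈ l) : Encodable.encode a ≤ Encodable.encode l := by
  induction l with
  | nil => simp at h
  | cons b l ih =>
    rw [Encodable.encode_list_cons]
    have h1 := Nat.left_le_pair (Encodable.encode b) (Encodable.encode l)
    have h2 := Nat.right_le_pair (Encodable.encode b) (Encodable.encode l)
    rcases List.mem_cons.1 h with rfl | h
    · omega
    · have := ih h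
      omega

theorem lengthsLE_toNat (e : StarfreeExpr) (l : ℕ) (h : e.toNat ≤ l) : e.LengthsLE l := by
  induction e with
  | finite F =>
    intro w hw
    have h1 := List.encode_le_encode_of_mem hw
    have h2 := Encodable.length_le_encode w
    simp only [toNat] at h
    omega
  | union a b iha ihb =>
    have h1 := Nat.left_le_pair a.toNat b.toNat
    have h2 := Nat.right_le_pair a.toNat b.toNat
    simp only [toNat] at h
    exact ⟨iha (by omega), ihb (by omega)⟩
  | concat a b iha ihb =>
    have h1 := Nat.left_le_pair a.toNat b.toNat
    have h2 := Nat.right_le_pair a.toNat b.toNat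
    simp only [toNat] at h
    exact ⟨iha (by omega), ihb (by omega)⟩
  | compl a iha =>
    simp only [toNat] at h
    exact iha (by omega)

end StarfreeExpr

/-! ### An Ehrenfeucht–Fraïssé equivalence for starfree expressions -/

/-- `WordSim l k u v`: the words `u` and `v` cannot be told apart by starfree expressions with at
most `k` nested concatenations and finite languages of words of length at most `l`. -/
def WordSim (l : ℕ) : ℕ → List ℕ → List ℕ → Prop
  | 0, u, v => u = v ∨ l < u.length ∧ l < v.length
  | k + 1, u, v => WordSim l k u v ∧
      (∀ a b, u = a ++ b → ∃ a' b', v = a' ++ b' ∧ WordSim l k a a' ∧ WordSim l k b b') ∧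
      ∀ a b, v = a ++ b → ∃ a' b', u = a' ++ b' ∧ WordSim l k a' a ∧ WordSim l k b' b

namespace WordSim

variable {l k : ℕ} {u v w u' v' : List ℕ}

theorem refl (u : List ℕ) : WordSim l k u u := by
  induction k generalizing u with
  | zero => exact Or.inl rfl
  | succ k ih =>
    exact ⟨ih u, fun a b h => ⟨a, b, h, ih a, ih b⟩, fun a b h => ⟨a, b, h, ih a, ih b⟩⟩

theorem of_eq (h : u = v) : WordSim l k u v := h ▸ refl u

theorem symm (h : WordSim l k u v) : WordSim l k v u := by
  induction k generalizing u v with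
  | zero => exact h.imp Eq.symm And.symm
  | succ k ih =>
    refine ⟨ih h.1, fun a b hab => ?_, fun a b hab => ?_⟩
    · obtain ⟨a', b', h1, h2, h3⟩ := h.2.2 a b hab
      exact ⟨a', b', h1, ih h2, ih h3⟩
    · obtain ⟨a', b', h1, h2, h3⟩ := h.2.1 a b hab
      exact ⟨a', b', h1, ih h2, ih h3⟩

theorem trans (h : WordSim l k u v) (h' : WordSim l k v w) : WordSim l k u w := by
  induction k generalizing u v w with
  | zero =>
    rcases h with rfl | h
    · exact h'
    · rcases h' with rfl | h'
      · exact Or.inr h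
      · exact Or.inr ⟨h.1, h'.2⟩
  | succ k ih =>
    refine ⟨ih h.1 h'.1, fun a b hab => ?_, fun a b hab => ?_⟩
    · obtain ⟨a', b', h1, h2, h3⟩ := h.2.1 a b hab
      obtain ⟨a'', b'', h1', h2', h3'⟩ := h'.2.1 a' b' h1
      exact ⟨a'', b'', h1', ih h2 h2', ih h3 h3'⟩
    · obtain ⟨a', b', h1, h2, h3⟩ := h'.2.2 a b hab
      obtain ⟨a'', b'', h1', h2', h3'⟩ := h.2.2 a' b' h1
      exact ⟨a'', b'', h1', ih h2' h2, ih h3' h3⟩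

theorem mono {j : ℕ} (hjk : j ≤ k) (h : WordSim l k u v) : WordSim l j u v := by
  induction k with
  | zero => rwa [Nat.le_zero.1 hjk]
  | succ k ih =>
    rcases Nat.le_succ_iff.1 hjk with hj | rfl
    · exact ih hj h.1
    · exact h

theorem mono_length {l' : ℕ} (hl : l' ≤ l) (h : WordSim l k u v) : WordSim l' k u v := by
  induction k generalizing u v with
  | zero => exact h.imp id fun h => ⟨hl.trans_lt h.1, hl.trans_lt h.2⟩
  | succ k ih =>
    refine ⟨ih h.1, fun a b hab => ?_, fun a b hab => ?_⟩
    · obtain ⟨a', b', h1, h2, h3⟩ := h.2.1 a b hab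
      exact ⟨a', b', h1, ih h2, ih h3⟩
    · obtain ⟨a', b', h1, h2, h3⟩ := h.2.2 a b hab
      exact ⟨a', b', h1, ih h2, ih h3⟩

/-- A cut of `u ++ v` falls into one of the two factors. It is answered there, and the other factor
is carried along whole at the lower level. -/
theorem exists_split_append (hu : WordSim l (k + 1) u u') (hv : WordSim l (k + 1) v v')
    (happ : ∀ {u v u' v' : List ℕ}, WordSim l k u u' → WordSim l k v v' →
      WordSim l k (u ++ v) (u' ++ v')) (a b : List ℕ) (hab : u ++ v = a ++ b) :
    ∃ a' b', u' ++ v' = a' ++ b' ∧ WordSim l k a a' ∧ WordSim l k b b' := by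
  rcases List.append_eq_append_iff.1 hab with ⟨c, rfl, rfl⟩ | ⟨c, rfl, rfl⟩
  · obtain ⟨c', b', rfl, h1, h2⟩ := hv.2.1 c b rfl
    exact ⟨u' ++ c', b', by simp, happ hu.1 h1, h2⟩
  · obtain ⟨a', c', rfl, h1, h2⟩ := hu.2.1 a c rfl
    exact ⟨a', c' ++ v', by simp, h1, happ h2 hv.1⟩

theorem append (hu : WordSim l k u u') (hv : WordSim l k v v') :
    WordSim l k (u ++ v) (u' ++ v') := by
  induction k generalizing u v u' v' with
  | zero =>
    rcases hu with rfl | hu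
    · rcases hv with rfl | hv
      · exact Or.inl rfl
      · right
        simp only [List.length_append]
        omega
    · right
      simp only [List.length_append]
      omega
  | succ k ih =>
    refine ⟨ih hu.1 hv.1, exists_split_append hu hv ih, fun a b hab => ?_⟩
    obtain ⟨a', b', h1, h2, h3⟩ := exists_split_append hu.symm hv.symm ih a b hab
    exact ⟨a', b', h1, h2.symm, h3.symm⟩

end WordSim

/-- The `n`-fold concatenation of a word. -/
def wordPow (v : List ℕ) (n : ℕ) : List ℕ := (List.replicate n v).flatten

theorem wordPow_succ (v : List ℕ) (n : ℕ) : wordPow v (n + 1) = v ++ wordPow v n := by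
  simp [wordPow, List.replicate_succ]

theorem wordPow_add (v : List ℕ) (m n : ℕ) : wordPow v (m + n) = wordPow v m ++ wordPow v n := by
  simp [wordPow, ← List.replicate_append_replicate]

theorem length_wordPow (v : List ℕ) (n : ℕ) : (wordPow v n).length = n * v.length := by
  simp [wordPow]

theorem wordPow_eq_append {v a b : List ℕ} {n : ℕ} (h : wordPow v (n + 1) = a ++ b) :
    ∃ i j a' b', i + j = n ∧ v = a' ++ b' ∧ a = wordPow v i ++ a' ∧ b = b' ++ wordPow v j := by
  induction n generalizing a with
  | zero =>
    refine ⟨0, 0, a, b, rfl, ?_, by simp [wordPow], by simp [wordPow]⟩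
    simpa [wordPow] using h
  | succ n ih =>
    rw [wordPow_succ] at h
    rcases List.append_eq_append_iff.1 h with ⟨c, rfl, hc⟩ | ⟨c, rfl, rfl⟩
    · obtain ⟨i, j, a', b', hij, hv, rfl, rfl⟩ := ih hc
      exact ⟨i + 1, j, a', b', by omega, hv, by simp [wordPow_succ], rfl⟩
    · exact ⟨0, n + 1, a, c, by omega, rfl, by simp [wordPow], rfl⟩

/-- Powers of a word from this exponent on cannot be told apart. -/
def powBound (l : ℕ) : ℕ → ℕ
  | 0 => l + 1
  | k + 1 => 2 * powBound l k + 1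

theorem primrec_powBound : Primrec₂ powBound := by
  refine Primrec₂.of_eq (Primrec.nat_rec (f := Nat.succ)
    (g := fun _ (x : ℕ × ℕ) => 2 * x.2 + 1) Primrec.succ ?_) fun l k => ?_
  · exact Primrec.nat_double_succ.comp (Primrec.snd.comp Primrec.snd)
  · induction k with
    | zero => rfl
    | succ k ih => simp only [powBound, ← ih]

namespace WordSim

variable {l k : ℕ} {v : List ℕ}

/-- The cut meets a single copy of `v` and leaves `i` and `j` full copies on its sides. A side with
fewer than `powBound l k` copies is reproduced exactly and the other side absorbs the difference;
the recursion `2 * powBound l k + 1` leaves enough copies for it. -/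
theorem wordPow_split {n n' : ℕ} (hn : powBound l (k + 1) ≤ n) (hn' : powBound l (k + 1) ≤ n')
    (ih : ∀ {n n'}, powBound l k ≤ n → powBound l k ≤ n' →
      WordSim l k (wordPow v n) (wordPow v n')) (a b : List ℕ) (hab : wordPow v n = a ++ b) :
    ∃ a' b', wordPow v n' = a' ++ b' ∧ WordSim l k a a' ∧ WordSim l k b b' := by
  simp only [powBound] at hn hn'
  obtain ⟨n, rfl⟩ : ∃ m, n = m + 1 := ⟨n - 1, by omega⟩
  obtain ⟨n', rfl⟩ : ∃ m, n' = m + 1 := ⟨n' - 1, by omega⟩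
  obtain ⟨i, j, a', b', hij, hv, rfl, rfl⟩ := wordPow_eq_append hab
  obtain ⟨i', j', hij', hi, hj⟩ : ∃ i' j', i' + j' = n' ∧
      WordSim l k (wordPow v i) (wordPow v i') ∧ WordSim l k (wordPow v j) (wordPow v j') := by
    by_cases hi : i < powBound l k
    · exact ⟨i, n' - i, by omega, refl _, ih (by omega) (by omega)⟩
    by_cases hj : j < powBound l k
    · exact ⟨n' - j, j, by omega, ih (by omega) (by omega), refl _⟩
    · exact ⟨powBound l k, n' - powBound l k, by omega, ih (by omega) le_rfl,
        ih (by omega) (by omega)⟩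
  refine ⟨wordPow v i' ++ a', b' ++ wordPow v j', ?_, hi.append (refl _), (refl _).append hj⟩
  rw [← hij', add_right_comm, wordPow_add, wordPow_add]
  simp [wordPow, hv]

/-- At level zero, `v ≠ []` makes both powers longer than `l`. At higher levels every cut is
answered by `wordPow_split`. -/
theorem pow_pow (hv : v ≠ []) {n n' : ℕ} (hn : powBound l k ≤ n) (hn' : powBound l k ≤ n') :
    WordSim l k (wordPow v n) (wordPow v n') := by
  induction k generalizing n n' with
  | zero =>
    have := List.length_pos_iff.2 hv
    simp only [powBound] at hn hn'
    right
    simp only [length_wordPow]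
    constructor <;> nlinarith
  | succ k ih =>
    refine ⟨?_, wordPow_split hn hn' ih, fun a b hab => ?_⟩
    · simp only [powBound] at hn hn'
      exact ih (by omega) (by omega)
    · obtain ⟨a', b', h1, h2, h3⟩ := wordPow_split hn' hn ih a b hab
      exact ⟨a', b', h1, h2.symm, h3.symm⟩

/-- Each concatenation spends one level of similarity on its cut. Complementation costs nothing
because similarity is symmetric. -/
theorem mem_lang_of_mem {m : ℕ} {e : StarfreeExpr} (hd : e.depth ≤ k) (hl : e.LengthsLE l)
    {u v : List ℕ} (hu : u ∈ StarfreeExpr.wordsOver m) (hv : v ∈ StarfreeExpr.wordsOver m)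
    (h : WordSim l k u v) (hmem : u ∈ e.lang m) : v ∈ e.lang m := by
  induction e generalizing k u v with
  | finite F =>
    rcases h.mono (Nat.zero_le k) with rfl | h
    · exact hmem
    · exact absurd (hl u hmem.1) (by omega)
  | union a b iha ihb =>
    simp only [StarfreeExpr.depth, max_le_iff] at hd
    exact hmem.imp (iha hd.1 hl.1 hu hv h) (ihb hd.2 hl.2 hu hv h)
  | concat a b iha ihb =>
    simp only [StarfreeExpr.depth] at hd
    obtain ⟨k, rfl⟩ : ∃ j, k = j + 1 := ⟨k - 1, by omega⟩
    obtain ⟨c, hc, d, hd', rfl⟩ := hmem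
    obtain ⟨c', d', rfl, h1, h2⟩ := h.2.1 c d rfl
    simp only [StarfreeExpr.wordsOver, Set.mem_ofPred_eq, List.mem_append] at hu hv
    exact ⟨c', iha (by omega) hl.1 (fun x hx => hu x (Or.inl hx)) (fun x hx => hv x (Or.inl hx))
      h1 hc, d', ihb (by omega) hl.2 (fun x hx => hu x (Or.inr hx))
      (fun x hx => hv x (Or.inr hx)) h2 hd', rfl⟩
  | compl a iha =>
    exact ⟨hv, fun hva => hmem.2 (iha hd hl hv hu h.symm hva)⟩

/-- Isolating a factor takes two cuts, hence two levels. -/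
theorem exists_infix {u v a w b : List ℕ} (h : WordSim l (k + 2) u v) (hu : u = a ++ (w ++ b)) :
    ∃ a' w' b', v = a' ++ (w' ++ b') ∧ WordSim l k w w' := by
  obtain ⟨a', c', rfl, -, h2⟩ := h.2.1 _ _ hu
  obtain ⟨w', b', rfl, h3, -⟩ := h2.2.1 _ _ rfl
  exact ⟨a', w', b', rfl, h3⟩

end WordSim

/-! ### Local agreement, orbit closures and isolated points -/

/-- The seqShift of a bi-infinite sequence by `k`. -/
def seqShift (k : ℤ) (x : ℤ → ℕ) : ℤ → ℕ := fun i => x (i + k)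

/-- `s` looks around coordinate `i` like `y` around `0`, up to distance `n`. -/
def Agree (n : ℕ) (s : ℤ → ℕ) (i : ℤ) (y : ℤ → ℕ) : Prop :=
  ∀ j : ℤ, -n ≤ j → j ≤ n → s (i + j) = y j

/-- `s` looks around coordinate `i` like a point of `Y`, up to distance `n`. -/
def Near (Y : Set (ℤ → ℕ)) (n : ℕ) (s : ℤ → ℕ) (i : ℤ) : Prop := ∃ y ∈ Y, Agree n s i y

/-- The closure of the orbit of `x`. -/
def orbitClosure (x : ℤ → ℕ) : Set (ℤ → ℕ) := {y | ∀ n : ℕ, ∃ i : ℤ, Agree n x i y}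

/-- `r` is isolated in its orbit closure, by its central word of radius `c`. -/
def IsolatedBy (c : ℕ) (r : ℤ → ℕ) : Prop := ∀ y ∈ orbitClosure r, Agree c y 0 r → y = r

section Agree

variable {n m c : ℕ} {s y r a : ℤ → ℕ} {i k : ℤ} {Y Z : Set (ℤ → ℕ)}

theorem seqShift_zero (x : ℤ → ℕ) : seqShift 0 x = x := by
  funext i
  simp [seqShift]

theorem seqShift_seqShift (j k : ℤ) (x : ℤ → ℕ) :
    seqShift j (seqShift k x) = seqShift (j + k) x := by
  funext i
  simp [seqShift, add_assoc]

theorem Agree.refl (n : ℕ) (s : ℤ → ℕ) (i : ℤ) : Agree n s i (seqShift i s) :=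
  fun j _ _ => congrArg s (add_comm i j)

theorem Agree.mono (h : Agree n s i y) (hmn : m ≤ n) : Agree m s i y :=
  fun j h1 h2 => h j (by omega) (by omega)

theorem Near.mono (h : Near Y n s i) (hmn : m ≤ n) : Near Y m s i :=
  let ⟨y, hy, hs⟩ := h
  ⟨y, hy, hs.mono hmn⟩

theorem Near.subset (h : Near Y n s i) (hYZ : Y ⊆ Z) : Near Z n s i :=
  let ⟨y, hy, hs⟩ := h
  ⟨y, hYZ hy, hs⟩

theorem Agree.trans (h : Agree n s i y) (hy : Agree m y k a) (h1 : m + k ≤ n) (h2 : m - k ≤ n) :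
    Agree m s (i + k) a := fun j hj1 hj2 => by
  rw [add_assoc, h (k + j) (by omega) (by omega), hy j hj1 hj2]

theorem Agree.trans_near (h : Agree n s i y) (hy : Near Y m y k) (h1 : m + k ≤ n)
    (h2 : m - k ≤ n) : Near Y m s (i + k) :=
  let ⟨z, hz, hyz⟩ := hy
  ⟨z, hz, h.trans hyz h1 h2⟩

theorem Agree.symm_trans (h : Agree n s i y) (hs : Agree m s k a) (h1 : m + (k - i) ≤ n)
    (h2 : m - (k - i) ≤ n) : Agree m y (k - i) a := fun j hj1 hj2 => by
  rw [← h (k - i + j) (by omega) (by omega), ← hs j hj1 hj2]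
  congr 1
  ring

theorem mem_orbitClosure_self (x : ℤ → ℕ) : x ∈ orbitClosure x :=
  fun n => ⟨0, by simpa [seqShift_zero] using Agree.refl n x 0⟩

theorem seqShift_mem_orbitClosure (k : ℤ) (hy : y ∈ orbitClosure r) :
    seqShift k y ∈ orbitClosure r := fun n => by
  obtain ⟨i, hi⟩ := hy (n + k.natAbs)
  exact ⟨i + k, hi.trans (Agree.refl n y k) (by omega) (by omega)⟩

/-- The approximating point of the orbit closure shows the central word of `r`, hence is `r`.
Agreement of radius `c` thereby improves to radius `n`. -/
theorem IsolatedBy.agree_of_near (hr : IsolatedBy c r) (h : Near (orbitClosure r) n s i)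
    (hc : c ≤ n) (hs : Agree c s i r) : Agree n s i r := by
  obtain ⟨y, hy, hsy⟩ := h
  rwa [← hr y hy fun j h1 h2 => by
    rw [zero_add, ← hsy j (by omega) (by omega), hs j h1 h2]]

/-- A second occurrence of the central word in `r` would make a nontrivial shift of `r` equal to
`r`. -/
theorem IsolatedBy.not_agree (hr : IsolatedBy c r) (hper : ∀ k, seqShift k r = r → k = 0)
    (hk : k ≠ 0) : ¬ Agree c r k r := fun h =>
  hk <| hper k <| hr _ (seqShift_mem_orbitClosure k (mem_orbitClosure_self r)) fun j h1 h2 => by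
    rw [zero_add, seqShift, add_comm, h j h1 h2]

/-- Between two occurrences of the central word of `r`, a sequence that locally looks like a point
of the orbit closure of `r` looks like a point of `Z`, if the orbit closure consists of `Z` and the
orbit of `r`, and `r` is close to `Z` far from `0`. -/
theorem Near.of_between (hdec : ∀ y ∈ orbitClosure r, y ∈ Z ∨ ∃ k, y = seqShift k r) {N : ℕ}
    (hm : ∀ i : ℤ, i ≤ -m ∨ m ≤ i → Near Z n r i) (hnN : n ≤ N) (hmN : m + c ≤ N) {u v : ℤ}
    (hs : Near (orbitClosure r) N s i) (hu : u + m ≤ i) (hv : i ≤ v - m)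
    (hno : ∀ j, u < j → j < v → ¬ Agree c s j r) : Near Z n s i := by
  obtain ⟨y, hy, hsy⟩ := hs
  rcases hdec y hy with hyZ | ⟨k, rfl⟩
  · exact ⟨y, hyZ, hsy.mono hnN⟩
  · by_cases hk : k ≤ -m ∨ m ≤ k
    · obtain ⟨z, hz, hrz⟩ := hm k hk
      refine ⟨z, hz, fun j h1 h2 => ?_⟩
      rw [hsy j (by omega) (by omega), ← hrz j h1 h2, seqShift, add_comm]
    -- The nearby point is a shift of `r` by less than `m`, so the central word of `r` occurs in `s`
    -- at `i - k`, strictly between `u` and `v`.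
    · exfalso
      refine hno (i - k) (by omega) (by omega) fun j h1 h2 => ?_
      have := hsy (j - k) (by omega) (by omega)
      rw [seqShift, sub_add_cancel] at this
      rw [← this]
      congr 1
      ring

end Agree

/-! ### Local codes and words between returns -/

/-- `f x` only depends on the coordinates of `x` up to distance `t` from `0`. -/
def IsLocal (t : ℕ) (f : (ℤ → ℕ) → ℕ) : Prop :=
  ∀ x y, (∀ j : ℤ, -t ≤ j → j ≤ t → x j = y j) → f x = f y

/-- The word that the code `f` produces from `s` on the interval `[a, b)`. -/
def codedWord (f : (ℤ → ℕ) → ℕ) (s : ℤ → ℕ) (a b : ℤ) : List ℕ :=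
  (List.range (b - a).toNat).map fun i : ℕ => f (seqShift (a + i) s)

section CodedWord

variable {f : (ℤ → ℕ) → ℕ} {t n : ℕ} {s y : ℤ → ℕ} {a b c : ℤ}

theorem length_codedWord : (codedWord f s a b).length = (b - a).toNat := by simp [codedWord]

theorem codedWord_append (hab : a ≤ b) (hbc : b ≤ c) :
    codedWord f s a b ++ codedWord f s b c = codedWord f s a c := by
  have h : (c - a).toNat = (b - a).toNat + (c - b).toNat := by omega
  simp only [codedWord]
  rw [h, List.range_add, List.map_append, List.map_map]
  congr 1
  refine List.map_congr_left fun i _ => ?_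
  simp only [Function.comp]
  congr 2
  push_cast
  omega

theorem codedWord_eq_of_agree (hf : IsLocal t f) {i : ℤ} (h : Agree n s i y) (ha : t - n ≤ a)
    (hb : b + t ≤ n) : codedWord f s (i + a) (i + b) = codedWord f y a b := by
  simp only [codedWord, add_sub_add_left_eq_sub]
  refine List.map_congr_left fun k hk => hf _ _ fun j h1 h2 => ?_
  rw [List.mem_range] at hk
  simp only [seqShift]
  rw [← h (j + (a + k)) (by omega) (by omega)]
  congr 1
  ring

end CodedWord

/-- All words coded between consecutive occurrences of the central word of `r` of radius `c`, in
sequences that are close to the orbit closure of `r`, are similar to `C`. -/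
def ReturnClass (t : ℕ) (f : (ℤ → ℕ) → ℕ) (r : ℤ → ℕ) (c n : ℕ) (C : List ℕ) : Prop :=
  ∀ (s : ℤ → ℕ) (i i' : ℤ), i < i' → Agree c s i r → Agree c s i' r →
    (∀ j, i < j → j < i' → ¬ Agree c s j r) →
    (∀ j, i ≤ j → j ≤ i' → Near (orbitClosure r) n s j) → WordSim t t (codedWord f s i i') C

/-- Uniformly in the code, returns to `r` can be made indistinguishable. -/
def HasUniformReturns (r : ℤ → ℕ) (c : ℕ) : Prop :=
  ∃ g : ℕ → ℕ, Computable g ∧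
    ∀ t f, IsLocal t f → ∃ C, ReturnClass t f r c (g t) C

/-- The central word of `r` occurs at least `N` times in `s` at coordinates in `[a, b)`. -/
def OccursMany (N : ℕ) (r : ℤ → ℕ) (c : ℕ) (s : ℤ → ℕ) (a b : ℤ) : Prop :=
  ∃ F : Finset ℤ, N ≤ F.card ∧ ∀ i ∈ F, a ≤ i ∧ i < b ∧ Agree c s i r

section Chains

variable {t : ℕ} {f : (ℤ → ℕ) → ℕ} {r s : ℤ → ℕ} {c n N : ℕ} {C : List ℕ}

/-- Induction on the length of the interval: the stretch up to the first return `e` after `a`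
contributes one factor `C`. -/
theorem ReturnClass.exists_wordPow (hC : ReturnClass t f r c n C) {a b : ℤ} (hab : a ≤ b)
    (ha : Agree c s a r) (hb : Agree c s b r)
    (hs : ∀ j, a ≤ j → j ≤ b → Near (orbitClosure r) n s j) (hN : OccursMany N r c s a b) :
    ∃ k, N ≤ k ∧ WordSim t t (codedWord f s a b) (wordPow C k) := by
  classical
  induction hd : (b - a).toNat using Nat.strong_induction_on generalizing a N with
  | _ d ih =>
    obtain ⟨F, hF, hFm⟩ := hN
    rcases hab.eq_or_lt with rfl | hlt
    · refine ⟨0, ?_, WordSim.of_eq (by simp [codedWord, wordPow])⟩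
      have : F = ∅ := Finset.eq_empty_of_forall_notMem fun i hi => by
        have := hFm i hi
        omega
      simpa [this] using hF
    · have hne : ((Finset.Ioc a b).filter fun i => Agree c s i r).Nonempty :=
        ⟨b, by simp [hlt, hb]⟩
      set e := ((Finset.Ioc a b).filter fun i => Agree c s i r).min' hne with he
      have hemem := Finset.min'_mem _ hne
      rw [← he, Finset.mem_filter, Finset.mem_Ioc] at hemem
      have hmin (j : ℤ) (h1 : a < j) (h2 : j < e) : ¬ Agree c s j r := fun h3 => by
        have hj : j ∈ (Finset.Ioc a b).filter fun i => Agree c s i r :=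
          Finset.mem_filter.2 ⟨Finset.mem_Ioc.2 ⟨h1, h2.le.trans hemem.1.2⟩, h3⟩
        exact absurd (Finset.min'_le _ j hj) (not_le.2 h2)
      -- Before `e` the central word occurs only at `a`, so at most one of the counted occurrences
      -- is lost.
      obtain ⟨k, hk, hsim⟩ := ih (b - e).toNat (by omega) (a := e) (N := N - 1) hemem.1.2 hemem.2
        (fun j h1 h2 => hs j (by omega) h2)
        ⟨F.erase a, by have := Finset.pred_card_le_card_erase (s := F) (a := a); omega,
          fun i hi => by
            have hi' := hFm i (Finset.mem_of_mem_erase hi)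
            refine ⟨?_, hi'.2⟩
            by_contra hlt
            exact hmin i (lt_of_le_of_ne hi'.1 (Finset.ne_of_mem_erase hi).symm) (by omega)
              hi'.2.2⟩ rfl
      refine ⟨k + 1, by omega, ?_⟩
      rw [← codedWord_append hemem.1.1.le hemem.1.2, wordPow_succ]
      exact (hC s a e hemem.1.1 ha hemem.2 hmin fun j h1 h2 => hs j h1 (by omega)).append hsim

theorem ReturnClass.sim_of_occursMany (hC : ReturnClass t f r c n C) {a b : ℤ} (hab : a < b)
    (ha : Agree c s a r) (hb : Agree c s b r)
    (hs : ∀ j, a ≤ j → j ≤ b → Near (orbitClosure r) n s j)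
    (hN : OccursMany (powBound t t) r c s a b) :
    WordSim t t (codedWord f s a b) (wordPow C (powBound t t)) := by
  obtain ⟨k, hk, hsim⟩ := hC.exists_wordPow hab.le ha hb hs hN
  refine hsim.trans (WordSim.pow_pow ?_ hk le_rfl)
  -- If `C` were empty, the nonempty coded word would be similar to `[]`, which is impossible
  -- already at level zero.
  rintro rfl
  have hw : codedWord f s a b ≠ [] := by
    rw [← List.length_pos_iff, length_codedWord]
    omega
  have hk0 : wordPow [] k = [] := List.length_eq_zero_iff.1 (by simp [length_wordPow])
  rw [hk0] at hsim
  rcases hsim.mono (Nat.zero_le _) with h | h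
  · exact hw h
  · simp at h

theorem ReturnClass.glue (hC : ReturnClass t f r c n C) {d e e' d' : ℤ} {C₁ C₂ : List ℕ}
    (hde : d ≤ e) (hee : e < e') (hed : e' ≤ d') (h1 : WordSim t t (codedWord f s d e) C₁)
    (he : Agree c s e r) (he' : Agree c s e' r)
    (hs : ∀ j, e ≤ j → j ≤ e' → Near (orbitClosure r) n s j)
    (hN : OccursMany (powBound t t) r c s e e') (h2 : WordSim t t (codedWord f s e' d') C₂) :
    WordSim t t (codedWord f s d d') (C₁ ++ (wordPow C (powBound t t) ++ C₂)) := by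
  rw [← codedWord_append hde (hee.le.trans hed), ← codedWord_append hee.le hed]
  exact h1.append ((hC.sim_of_occursMany hee he he' hs hN).append h2)

end Chains

/-! ### Computable rates of approach and recurrence -/

/-- In the direction `ε`, the sequence `r` approaches `Y`, at a computable rate. -/
def TendsTo (ε : ℤ) (r : ℤ → ℕ) (Y : Set (ℤ → ℕ)) : Prop :=
  ∃ h : ℕ → ℕ, Computable h ∧ ∀ n i : ℕ, h n ≤ i → Near Y n r (ε * i)

/-- The central word of `a` of radius `c` recurs in the direction `ε` of `r`, with computable
gaps. -/
def Recurs (ε : ℤ) (c : ℕ) (r a : ℤ → ℕ) : Prop :=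
  ∃ h : ℕ → ℕ, Computable h ∧ ∀ m : ℕ, ∃ d : ℕ, m ≤ d ∧ d < h m ∧ Agree c r (ε * d) a

section Computable

variable {α : Type*} [Primcodable α] {f g : α → ℕ}

theorem Computable.nat_add (hf : Computable f) (hg : Computable g) :
    Computable fun a => f a + g a :=
  Primrec.nat_add.to_comp.comp hf hg

theorem Computable.nat_max (hf : Computable f) (hg : Computable g) :
    Computable fun a => max (f a) (g a) :=
  Primrec.nat_max.to_comp.comp hf hg

theorem computable_powBound_self : Computable fun t => powBound t t :=
  (primrec_powBound.comp Primrec.id Primrec.id).to_comp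

end Computable

theorem Recurs.exists_many {ε : ℤ} {c : ℕ} {r a : ℤ → ℕ} (h : Recurs ε c r a) :
    ∃ H : ℕ → ℕ → ℕ, Computable₂ H ∧ ∀ m N, ∃ (d d' : ℕ) (F : Finset ℕ), m ≤ d ∧ d < d' ∧
      d' < H m N ∧ Agree c r (ε * d) a ∧ Agree c r (ε * d') a ∧ N ≤ F.card ∧
      ∀ x ∈ F, d < x ∧ x < d' ∧ Agree c r (ε * x) a := by
  obtain ⟨h, hh, hd⟩ := h
  -- `H m N` is the `(N + 2)`-fold iterate of `h` at `m`: two applications for the end points `d`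
  -- and `d'`, one more for each interior occurrence.
  obtain ⟨H, hH, hH0, hHs⟩ : ∃ H : ℕ → ℕ → ℕ, Computable₂ H ∧ (∀ m, H m 0 = h (h m)) ∧
      ∀ m N, H m (N + 1) = h (H m N) :=
    ⟨fun m N => Nat.rec (motive := fun _ => ℕ) (h (h m)) (fun _ x => h x) N,
      (Computable.nat_rec (f := fun x : ℕ × ℕ => x.2) (g := fun x : ℕ × ℕ => h (h x.1))
        (h := fun _ x => h x.2) Computable.snd (hh.comp (hh.comp Computable.fst))
        (hh.comp (Computable.snd.comp Computable.snd)) : Computable fun x : ℕ × ℕ =>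
          Nat.rec (motive := fun _ => ℕ) (h (h x.1)) (fun _ y => h y) x.2),
      fun _ => rfl, fun _ _ => rfl⟩
  refine ⟨H, hH, fun m N => ?_⟩
  induction N with
  | zero =>
    obtain ⟨d, h1, h2, h3⟩ := hd m
    obtain ⟨d', h4, h5, h6⟩ := hd (h m)
    exact ⟨d, d', ∅, h1, by omega, hH0 m ▸ h5, h3, h6, by simp, by simp⟩
  | succ N ih =>
    obtain ⟨d, d', F, h1, h2, h3, h4, h5, h6, h7⟩ := ih
    obtain ⟨e, h8, h9, h10⟩ := hd (H m N)
    refine ⟨d, e, insert d' F, h1, by omega, hHs m N ▸ h9, h4, h10, ?_, fun x hx => ?_⟩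
    · rw [Finset.card_insert_of_notMem fun hF => (h7 _ hF).2.1.ne rfl]
      omega
    · rcases Finset.mem_insert.1 hx with rfl | hx
      · exact ⟨h2, by omega, h5⟩
      · exact ⟨(h7 x hx).1, by have := (h7 x hx).2.1; omega, (h7 x hx).2.2⟩

theorem OccursMany.mono {N c : ℕ} {r s : ℤ → ℕ} {a b a' b' : ℤ} (h : OccursMany N r c s a b)
    (ha : a' ≤ a) (hb : b ≤ b') : OccursMany N r c s a' b' :=
  let ⟨F, hF, h⟩ := h
  ⟨F, hF, fun i hi => ⟨by have := h i hi; omega, by have := h i hi; omega, (h i hi).2.2⟩⟩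

theorem OccursMany.of_agree {N c n : ℕ} {r s y : ℤ → ℕ} {a b i : ℤ} (h : OccursMany N r c y a b)
    (hs : Agree n s i y) (ha : c - n ≤ a) (hb : b + c ≤ n) :
    OccursMany N r c s (i + a) (i + b) := by
  obtain ⟨F, hF, h⟩ := h
  refine ⟨F.map (addLeftEmbedding i), by simpa using hF, fun j hj => ?_⟩
  obtain ⟨k, hk, rfl⟩ := Finset.mem_map.1 hj
  have := h k hk
  exact ⟨by simp only [addLeftEmbedding_apply]; omega,
    by simp only [addLeftEmbedding_apply]; omega, hs.trans this.2.2 (by omega) (by omega)⟩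

theorem Recurs.exists_occursMany_right {c : ℕ} {r a : ℤ → ℕ} (h : Recurs 1 c r a) :
    ∃ H : ℕ → ℕ → ℕ, Computable₂ H ∧ ∀ m N : ℕ, ∃ d d' : ℤ, m ≤ d ∧ d < d' ∧ d' ≤ H m N ∧
      Agree c r d a ∧ Agree c r d' a ∧ OccursMany N a c r d d' := by
  obtain ⟨H, hH, hd⟩ := h.exists_many
  refine ⟨H, hH, fun m N => ?_⟩
  obtain ⟨d, d', F, h1, h2, h3, h4, h5, h6, h7⟩ := hd m N
  simp only [one_mul] at h4 h5 h7
  refine ⟨d, d', by omega, by omega, by omega, h4, h5, F.map Nat.castEmbedding, by simpa,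
    fun i hi => ?_⟩
  obtain ⟨x, hx, rfl⟩ := Finset.mem_map.1 hi
  have := h7 x hx
  exact ⟨by simpa using this.1.le, by simpa using this.2.1, this.2.2⟩

theorem Recurs.exists_occursMany_left {c : ℕ} {r a : ℤ → ℕ} (h : Recurs (-1) c r a) :
    ∃ H : ℕ → ℕ → ℕ, Computable₂ H ∧ ∀ m N : ℕ, ∃ d d' : ℤ, m ≤ d ∧ d < d' ∧ d' ≤ H m N ∧
      Agree c r (-d) a ∧ Agree c r (-d') a ∧ OccursMany N a c r (-d') (-d) := by
  obtain ⟨H, hH, hd⟩ := h.exists_many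
  refine ⟨H, hH, fun m N => ?_⟩
  obtain ⟨d, d', F, h1, h2, h3, h4, h5, h6, h7⟩ := hd m N
  simp only [neg_one_mul] at h4 h5 h7
  refine ⟨d, d', by omega, by omega, by omega, h4, h5,
    (F.map Nat.castEmbedding).map (Equiv.neg ℤ).toEmbedding, by simpa, fun i hi => ?_⟩
  obtain ⟨y, hy, rfl⟩ := Finset.mem_map.1 hi
  obtain ⟨x, hx, rfl⟩ := Finset.mem_map.1 hy
  have := h7 x hx
  exact ⟨by simpa using this.2.1.le, by simpa using this.1, this.2.2⟩

/-! ### Uniform returns to periodic points and to points above them -/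

theorem HasUniformReturns.of_periodic {r : ℤ → ℕ} {c q : ℕ} (hq : 0 < q)
    (hper : seqShift q r = r) (hr : IsolatedBy c r) : HasUniformReturns r c := by
  classical
  have hqr : Agree c r q r := fun j _ _ => by
    conv_rhs => rw [← hper]
    rw [seqShift, add_comm]
  have hex : ∃ k : ℕ, 0 < k ∧ Agree c r k r := ⟨q, hq, hqr⟩
  set k := Nat.find hex with hk
  obtain ⟨hk0, hkr⟩ : 0 < k ∧ Agree c r k r := Nat.find_spec hex
  have hkq : k ≤ q := Nat.find_min' hex ⟨hq, hqr⟩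
  obtain ⟨n, hn, hnt⟩ : ∃ n : ℕ → ℕ, Computable n ∧ ∀ t, n t = c + q + t :=
    ⟨_, (Computable.const (c + q)).nat_add Computable.id, fun _ => rfl⟩
  -- Agreement with `r` around `i` puts the next occurrence exactly at the first self-occurrence
  -- distance `k` of `r`, and determines the coded word up to it.
  refine ⟨n, hn, fun t f hf => ⟨codedWord f r 0 k, fun s i i' hii' hi hi' hno hs => ?_⟩⟩
  have hnt := hnt t
  have hsi := hr.agree_of_near (hs i le_rfl hii'.le) (by omega) hi
  have h1 : i' ≤ i + k := by
    by_contra hlt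
    exact hno (i + k) (by omega) (by omega)
      (hsi.trans hkr (by omega) (by omega))
  have h2 : i' = i + k := by
    have h3 := hsi.symm_trans hi' (by omega) (by omega)
    have h4 : k ≤ (i' - i).toNat :=
      Nat.find_min' hex ⟨by omega, by rwa [Int.toNat_of_nonneg (by omega)]⟩
    omega
  have h5 := codedWord_eq_of_agree hf hsi (a := 0) (b := k) (by omega)
    (by omega)
  rw [add_zero] at h5
  rw [h2, h5]
  exact WordSim.refl _

section Connections

variable {t na ca n : ℕ} {f : (ℤ → ℕ) → ℕ} {a x y s : ℤ → ℕ} {C : List ℕ}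

/-- An excursion that leaves `d` as `x` does and arrives at `d'` as `y` does, with returns to `a` in
between. Enough returns occur already in the visible part of `x`, so the length of the gap does not
matter. -/
theorem ReturnClass.connect (hC : ReturnClass t f a ca na C) (hf : IsLocal t f)
    {d d' δ δ₂ δ' : ℤ} (hx : Agree n s d x) (hy : Agree n s d' y) (h0 : 0 ≤ δ) (h0' : 0 ≤ δ')
    (hxa : Agree ca x δ a) (hxm : OccursMany (powBound t t) a ca x δ δ₂)
    (hya : Agree ca y (-δ') a) (h1 : δ < δ₂) (h2 : δ₂ + ca + t ≤ n) (h3 : δ' + ca + t ≤ n)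
    (h4 : d + δ₂ ≤ d' - δ')
    (hs : ∀ j, d + δ ≤ j → j ≤ d' - δ' → Near (orbitClosure a) na s j) :
    WordSim t t (codedWord f s d d')
      (codedWord f x 0 δ ++ (wordPow C (powBound t t) ++ codedWord f y (-δ') 0)) := by
  have hl := codedWord_eq_of_agree hf hx (a := 0) (b := δ) (by omega) (by omega)
  have hr := codedWord_eq_of_agree hf hy (a := -δ') (b := 0) (by omega) (by omega)
  rw [add_zero] at hl hr
  refine hC.glue (e := d + δ) (e' := d' + -δ') (by omega) (by omega) (by omega)
    (WordSim.of_eq hl) (hx.trans hxa (by omega) (by omega)) (hy.trans hya (by omega) (by omega))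
    (fun j hj hj' => hs j hj (by omega)) ?_ (WordSim.of_eq hr)
  exact (hxm.of_agree hx (by omega) (by omega)).mono le_rfl (by omega)

end Connections

section Returns

variable {r a p : ℤ → ℕ} {c ca cp : ℕ}

/-- The central word of `r` does not recur in `r`, so it cannot recur in `s` while `s` still follows
`r`. -/
theorem IsolatedBy.lt_of_agree (hr : IsolatedBy c r) (hper : ∀ k, seqShift k r = r → k = 0)
    {n : ℕ} {s : ℤ → ℕ} {b b' : ℤ} (hb : Agree n s b r) (hb' : Agree c s b' r) (hbb : b < b') : n - c < b' - b := by
  by_contra hlt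
  exact hr.not_agree hper (k := b' - b) (by omega) (hb.symm_trans hb' (by omega) (by omega))

/-- Around two consecutive occurrences, `s` follows `r`. In between, no shift of `r` is seen, so `s`
looks like a point of the orbit closure of `a` and the coded word is a saturated power of the return
class of `a`, with fixed ends coming from `r`. -/
theorem HasUniformReturns.of_tendsTo_both (hr : IsolatedBy c r)
    (hper : ∀ k, seqShift k r = r → k = 0)
    (hdec : ∀ y ∈ orbitClosure r, y ∈ orbitClosure a ∨ ∃ k, y = seqShift k r)
    (hright : TendsTo 1 r (orbitClosure a)) (hleft : TendsTo (-1) r (orbitClosure a))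
    (hrec : Recurs 1 ca r a) (hrec' : Recurs (-1) ca r a) (ha : HasUniformReturns a ca) :
    HasUniformReturns r c := by
  obtain ⟨g, hg, hgC⟩ := ha
  obtain ⟨h₁, hh₁, hr₁⟩ := hright
  obtain ⟨h₂, hh₂, hr₂⟩ := hleft
  obtain ⟨H₁, hH₁, hm₁⟩ := hrec.exists_occursMany_right
  obtain ⟨H₂, hH₂, hm₂⟩ := hrec'.exists_occursMany_left
  obtain ⟨m, hm, hmt⟩ : ∃ m : ℕ → ℕ, Computable m ∧ ∀ t, m t = max (h₁ (g t)) (h₂ (g t)) :=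
    ⟨_, (hh₁.comp hg).nat_max (hh₂.comp hg), fun _ => rfl⟩
  -- The radius covers the occurrences of `a` used on both sides of `r`, the central words, the
  -- window of the code and the closeness needed for returns to `a`.
  obtain ⟨n, hn, hnt⟩ : ∃ n : ℕ → ℕ, Computable n ∧ ∀ t, n t =
      g t + m t + c + ca + t + H₁ (m t) (powBound t t) + H₂ (m t) 0 :=
    ⟨_, (((((hg.nat_add hm).nat_add (.const c)).nat_add (.const ca)).nat_add .id).nat_add
      (hH₁.comp hm computable_powBound_self)).nat_add (hH₂.comp hm (.const 0)), fun _ => rfl⟩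
  refine ⟨n, hn, fun t f hf => ?_⟩
  have hmt := hmt t
  have hnt := hnt t
  obtain ⟨C, hC⟩ := hgC t f hf
  obtain ⟨d, d', hmd, hdd, hdH, hda, -, hocc⟩ := hm₁ (m t) (powBound t t)
  obtain ⟨e, e', hme, hee, heH, hea, -, -⟩ := hm₂ (m t) 0
  have hnear : ∀ i : ℤ, i ≤ -(m t : ℕ) ∨ (m t : ℕ) ≤ i →
      Near (orbitClosure a) (g t) r i := by
    rintro i (hi | hi)
    · have := hr₂ (g t) (-i).toNat (by omega)
      rwa [Int.toNat_of_nonneg (by omega), neg_one_mul, neg_neg] at this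
    · have := hr₁ (g t) i.toNat (by omega)
      rwa [Int.toNat_of_nonneg (by omega), one_mul] at this
  refine ⟨codedWord f r 0 d ++ (wordPow C (powBound t t) ++ codedWord f r (-e) 0),
    fun s b b' hbb hb hb' hno hs => ?_⟩
  have hbn := hr.agree_of_near (hs b le_rfl hbb.le) (by omega) hb
  have hbn' := hr.agree_of_near (hs b' hbb.le le_rfl) (by omega) hb'
  have hfar := hr.lt_of_agree hper hbn hb' hbb
  refine hC.connect hf hbn hbn' (δ := d) (δ' := e) (by omega) (by omega) hda hocc hea hdd
    (by omega) (by omega) (by omega) fun j hj hj' => ?_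
  exact Near.of_between hdec hnear (by omega) (by omega) (hs j (by omega) (by omega))
    (by omega) (by omega) hno

end Returns

section TwoStepReturns

variable {r a p : ℤ → ℕ} {c ca cp : ℕ}

theorem IsolatedBy.not_agree_of_near (ha : IsolatedBy ca a)
    (hsub : orbitClosure p ⊆ orbitClosure a) (hap : a ∉ orbitClosure p) {n : ℕ} {s : ℤ → ℕ} {i : ℤ}
    (h : Near (orbitClosure p) n s i) (hn : ca ≤ n) : ¬ Agree ca s i a := fun hs => by
  obtain ⟨y, hy, hsy⟩ := h
  refine hap (ha y (hsub hy) (fun j h1 h2 => ?_) ▸ hy)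
  rw [zero_add, ← hsy j (by omega) (by omega), hs j h1 h2]

theorem near_far_of_tendsTo {Y : Set (ℤ → ℕ)} {n m : ℕ} {h₁ h₂ : ℕ → ℕ}
    (hr₁ : ∀ n i : ℕ, h₁ n ≤ i → Near Y n r (1 * i))
    (hr₂ : ∀ n i : ℕ, h₂ n ≤ i → Near Y n r (-1 * i)) (hm : m = max (h₁ n) (h₂ n)) (i : ℤ)
    (hi : i ≤ -m ∨ m ≤ i) : Near Y n r i := by
  rcases hi with hi | hi
  · have := hr₂ n (-i).toNat (by omega)
    rwa [Int.toNat_of_nonneg (by omega), neg_one_mul, neg_neg] at this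
  · have := hr₁ n i.toNat (by omega)
    rwa [Int.toNat_of_nonneg (by omega), one_mul] at this

/-- A return leaves along `r` with many occurrences of `a`. After the last of these it follows the
right half of `a` into returns to `p`, and comes back along the left half of `r`, near the orbit
closure of `p`. The coded word thus has two saturated powers, one for `a` and one for `p`. -/
theorem HasUniformReturns.of_tendsTo_right (hr : IsolatedBy c r)
    (hper : ∀ k, seqShift k r = r → k = 0)
    (hdec : ∀ y ∈ orbitClosure r, y ∈ orbitClosure a ∨ ∃ k, y = seqShift k r)
    (ha : IsolatedBy ca a) (hap : a ∉ orbitClosure p) (hsub : orbitClosure p ⊆ orbitClosure a)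
    (hdeca : ∀ y ∈ orbitClosure a, y ∈ orbitClosure p ∨ ∃ k, y = seqShift k a)
    (hright : TendsTo 1 r (orbitClosure a)) (hleft : TendsTo (-1) r (orbitClosure p))
    (haright : TendsTo 1 a (orbitClosure p)) (haleft : TendsTo (-1) a (orbitClosure p))
    (hrec : Recurs 1 ca r a) (hrec' : Recurs (-1) cp r p) (harec : Recurs 1 cp a p)
    (hra : HasUniformReturns a ca) (hrp : HasUniformReturns p cp) : HasUniformReturns r c := by
  obtain ⟨ga, hga, hgaC⟩ := hra
  obtain ⟨gp, hgp, hgpC⟩ := hrp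
  obtain ⟨h, hh, hr₁⟩ := hright
  obtain ⟨v, hv, hr₂⟩ := hleft
  obtain ⟨u₁, hu₁, hau₁⟩ := haright
  obtain ⟨u₂, hu₂, hau₂⟩ := haleft
  obtain ⟨H, hH, hmH⟩ := hrec.exists_occursMany_right
  obtain ⟨Hβ, hHβ, hmβ⟩ := hrec'.exists_occursMany_left
  obtain ⟨Hα, hHα, hmα⟩ := harec.exists_occursMany_right
  obtain ⟨ma, hma, hmat⟩ : ∃ ma : ℕ → ℕ, Computable ma ∧
      ∀ t, ma t = max (u₁ (gp t)) (u₂ (gp t)) :=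
    ⟨_, (hu₁.comp hgp).nat_max (hu₂.comp hgp), fun _ => rfl⟩
  obtain ⟨w, hw, hwt⟩ : ∃ w : ℕ → ℕ, Computable w ∧
      ∀ t, w t = Hα (ma t) (powBound t t) + Hβ (v (gp t)) 0 + cp + t :=
    ⟨_, ((((hHα.comp hma computable_powBound_self).nat_add
      (hHβ.comp (hv.comp hgp) (.const 0))).nat_add (.const cp)).nat_add .id), fun _ => rfl⟩
  obtain ⟨na, hna, hnat⟩ : ∃ na : ℕ → ℕ, Computable na ∧
      ∀ t, na t = ga t + ma t + ca + gp t + w t :=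
    ⟨_, (((hga.nat_add hma).nat_add (.const ca)).nat_add hgp).nat_add hw, fun _ => rfl⟩
  obtain ⟨m, hm, hmt⟩ : ∃ m : ℕ → ℕ, Computable m ∧ ∀ t, m t = max (h (na t)) (v (na t)) :=
    ⟨_, (hh.comp hna).nat_max (hv.comp hna), fun _ => rfl⟩
  obtain ⟨n, hn, hnt⟩ : ∃ n : ℕ → ℕ, Computable n ∧
      ∀ t, n t = na t + m t + ma t + c + ca + H (m t) (powBound t t) + w t :=
    ⟨_, (((((hna.nat_add hm).nat_add hma).nat_add (.const c)).nat_add (.const ca)).nat_add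
      (hH.comp hm computable_powBound_self)).nat_add hw, fun _ => rfl⟩
  refine ⟨n, hn, fun t f hf => ?_⟩
  have hmat := hmat t
  have hwt := hwt t
  have hnat := hnat t
  have hmt := hmt t
  have hnt := hnt t
  obtain ⟨Ca, hCa⟩ := hgaC t f hf
  obtain ⟨Cp, hCp⟩ := hgpC t f hf
  obtain ⟨d, d', hmd, hdd, hdH, hda, hda', hocc⟩ := hmH (m t) (powBound t t)
  obtain ⟨δ', δ'', hδm', hδδ', hδH', hδa', -, -⟩ := hmβ (v (gp t)) 0
  obtain ⟨δ, δ₂, hδm, hδδ, hδH, hδa, -, hδocc⟩ := hmα (ma t) (powBound t t)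
  have hneara := near_far_of_tendsTo hau₁ hau₂ hmat
  have hnearr := near_far_of_tendsTo hr₁ (fun n i hi => (hr₂ n i hi).subset hsub) hmt
  have hleft (N : ℕ) (i : ℤ) (hi : i ≤ -(v N : ℤ)) : Near (orbitClosure p) N r i := by
    have := hr₂ N (-i).toNat (by omega)
    rwa [Int.toNat_of_nonneg (by omega), neg_one_mul, neg_neg] at this
  refine ⟨codedWord f r 0 d ++ (wordPow Ca (powBound t t) ++ (codedWord f a 0 δ ++
    (wordPow Cp (powBound t t) ++ codedWord f r (-δ') 0))), fun s b b' hbb hb hb' hno hs => ?_⟩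
  have hbn := hr.agree_of_near (hs b le_rfl hbb.le) (by omega) hb
  have hbn' := hr.agree_of_near (hs b' hbb.le le_rfl) (by omega) hb'
  have hfar := hr.lt_of_agree hper hbn hb' hbb
  have hmid (j : ℤ) (h1 : b + m t ≤ j) (h2 : j ≤ b' - m t) :
      Near (orbitClosure a) (na t) s j :=
    Near.of_between hdec hnearr (by omega) (by omega) (hs j (by omega) (by omega)) h1 h2 hno
  -- The last occurrence of the central word of `a` before the left half of `r` takes over; `b + d'`
  -- shows that there is one.
  obtain ⟨e, hbe, heb, hea, hemax⟩ : ∃ e, b + d' ≤ e ∧ e ≤ b' - m t ∧ Agree ca s e a ∧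
      ∀ j, e < j → j ≤ b' - m t → ¬ Agree ca s j a := by
    classical
    have hne : ((Finset.Icc (b + d') (b' - m t)).filter fun i => Agree ca s i a).Nonempty :=
      ⟨b + d', Finset.mem_filter.2 ⟨Finset.mem_Icc.2 ⟨le_rfl, by omega⟩,
        hbn.trans hda' (by omega) (by omega)⟩⟩
    obtain ⟨e, he, hmax⟩ := Finset.exists_max_image _ id hne
    simp only [Finset.mem_filter, Finset.mem_Icc, id] at he hmax
    exact ⟨e, he.1.1, he.1.2, he.2, fun j h1 h2 h3 =>
      absurd (hmax j ⟨⟨by omega, h2⟩, h3⟩) (not_le.2 h1)⟩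
  -- To the left of `b'` the sequence follows `r`, which is near the orbit closure of `p` there; the
  -- central word of `a` does not occur in that range.
  have hefar : e < b' - (n t - ca) := by
    by_contra hlt
    exact ha.not_agree_of_near hsub hap (hleft (na t) (e - b') (by omega)) (by omega)
      (hbn'.symm_trans hea (by omega) (by omega))
  have hean := ha.agree_of_near (hmid e (by omega) heb) (by omega) hea
  refine hCa.glue (e := b + d) (e' := e) (by omega) (by omega) (by omega) (WordSim.of_eq ?_)
    (hbn.trans hda (by omega) (by omega)) hea
    (fun j h1 h2 => (hmid j (by omega) (by omega)).mono (by omega))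
    ((hocc.of_agree hbn (by omega) (by omega)).mono le_rfl hbe)
    (hCp.connect hf hean (hbn'.mono (by omega)) (by omega) (by omega) hδa hδocc hδa' hδδ
      (by omega) (by omega) (by omega) fun j h1 h2 => ?_)
  · have := codedWord_eq_of_agree hf hbn (a := 0) (b := d) (by omega) (by omega)
    rwa [add_zero] at this
  -- Nearness to `p` comes from the absence of `a` after `e`, and close to `b'` from the left half
  -- of `r`. The right end is `b' - m t + 1` because `Near.of_between` excludes its end points.
  · by_cases hj : j ≤ b' - m t - ma t
    · exact Near.of_between hdeca hneara (by omega) (by omega) (hmid j (by omega) (by omega))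
        (u := e) (v := b' - m t + 1) (by omega) (by omega)
        fun i h3 h4 => hemax i h3 (by omega)
    · have := hbn'.trans_near (hleft (gp t) (j - b') (by omega)) (by omega) (by omega)
      rwa [add_sub_cancel] at this

/-- The mirror image of `of_tendsTo_right`: returns to `p` come first, and the first occurrence of
`a` takes the place of the last one. -/
theorem HasUniformReturns.of_tendsTo_left (hr : IsolatedBy c r)
    (hper : ∀ k, seqShift k r = r → k = 0)
    (hdec : ∀ y ∈ orbitClosure r, y ∈ orbitClosure a ∨ ∃ k, y = seqShift k r)
    (ha : IsolatedBy ca a) (hap : a ∉ orbitClosure p) (hsub : orbitClosure p ⊆ orbitClosure a)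
    (hdeca : ∀ y ∈ orbitClosure a, y ∈ orbitClosure p ∨ ∃ k, y = seqShift k a)
    (hright : TendsTo 1 r (orbitClosure p)) (hleft : TendsTo (-1) r (orbitClosure a))
    (haright : TendsTo 1 a (orbitClosure p)) (haleft : TendsTo (-1) a (orbitClosure p))
    (hrec : Recurs (-1) ca r a) (hrec' : Recurs 1 cp r p) (harec : Recurs (-1) cp a p)
    (hra : HasUniformReturns a ca) (hrp : HasUniformReturns p cp) : HasUniformReturns r c := by
  obtain ⟨ga, hga, hgaC⟩ := hra
  obtain ⟨gp, hgp, hgpC⟩ := hrp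
  obtain ⟨v, hv, hr₁⟩ := hright
  obtain ⟨h, hh, hr₂⟩ := hleft
  obtain ⟨u₁, hu₁, hau₁⟩ := haright
  obtain ⟨u₂, hu₂, hau₂⟩ := haleft
  obtain ⟨H, hH, hmH⟩ := hrec.exists_occursMany_left
  obtain ⟨Hα, hHα, hmα⟩ := hrec'.exists_occursMany_right
  obtain ⟨Hβ, hHβ, hmβ⟩ := harec.exists_occursMany_left
  obtain ⟨ma, hma, hmat⟩ : ∃ ma : ℕ → ℕ, Computable ma ∧
      ∀ t, ma t = max (u₁ (gp t)) (u₂ (gp t)) :=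
    ⟨_, (hu₁.comp hgp).nat_max (hu₂.comp hgp), fun _ => rfl⟩
  obtain ⟨w, hw, hwt⟩ : ∃ w : ℕ → ℕ, Computable w ∧
      ∀ t, w t = Hα (v (gp t)) (powBound t t) + Hβ (ma t) 0 + cp + t :=
    ⟨_, ((((hHα.comp (hv.comp hgp) computable_powBound_self).nat_add
      (hHβ.comp hma (.const 0))).nat_add (.const cp)).nat_add .id), fun _ => rfl⟩
  obtain ⟨na, hna, hnat⟩ : ∃ na : ℕ → ℕ, Computable na ∧
      ∀ t, na t = ga t + ma t + ca + gp t + w t :=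
    ⟨_, (((hga.nat_add hma).nat_add (.const ca)).nat_add hgp).nat_add hw, fun _ => rfl⟩
  obtain ⟨m, hm, hmt⟩ : ∃ m : ℕ → ℕ, Computable m ∧ ∀ t, m t = max (v (na t)) (h (na t)) :=
    ⟨_, (hv.comp hna).nat_max (hh.comp hna), fun _ => rfl⟩
  obtain ⟨n, hn, hnt⟩ : ∃ n : ℕ → ℕ, Computable n ∧
      ∀ t, n t = na t + m t + ma t + c + ca + H (m t) (powBound t t) + w t :=
    ⟨_, (((((hna.nat_add hm).nat_add hma).nat_add (.const c)).nat_add (.const ca)).nat_add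
      (hH.comp hm computable_powBound_self)).nat_add hw, fun _ => rfl⟩
  refine ⟨n, hn, fun t f hf => ?_⟩
  have hmat := hmat t
  have hwt := hwt t
  have hnat := hnat t
  have hmt := hmt t
  have hnt := hnt t
  obtain ⟨Ca, hCa⟩ := hgaC t f hf
  obtain ⟨Cp, hCp⟩ := hgpC t f hf
  obtain ⟨d, d', hmd, hdd, hdH, hda, hda', hocc⟩ := hmH (m t) (powBound t t)
  obtain ⟨δ', δ'', hδm', hδδ', hδH', hδa', -, -⟩ := hmβ (ma t) 0
  obtain ⟨δ, δ₂, hδm, hδδ, hδH, hδa, -, hδocc⟩ := hmα (v (gp t)) (powBound t t)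
  have hneara := near_far_of_tendsTo hau₁ hau₂ hmat
  have hnearr := near_far_of_tendsTo (fun n i hi => (hr₁ n i hi).subset hsub) hr₂ hmt
  have hright (N : ℕ) (i : ℤ) (hi : v N ≤ i) : Near (orbitClosure p) N r i := by
    have := hr₁ N i.toNat (by omega)
    rwa [Int.toNat_of_nonneg (by omega), one_mul] at this
  refine ⟨(codedWord f r 0 δ ++ (wordPow Cp (powBound t t) ++ codedWord f a (-δ') 0)) ++
    (wordPow Ca (powBound t t) ++ codedWord f r (-d) 0), fun s b b' hbb hb hb' hno hs => ?_⟩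
  have hbn := hr.agree_of_near (hs b le_rfl hbb.le) (by omega) hb
  have hbn' := hr.agree_of_near (hs b' hbb.le le_rfl) (by omega) hb'
  have hfar := hr.lt_of_agree hper hbn hb' hbb
  have hmid (j : ℤ) (h1 : b + m t ≤ j) (h2 : j ≤ b' - m t) :
      Near (orbitClosure a) (na t) s j :=
    Near.of_between hdec hnearr (by omega) (by omega) (hs j (by omega) (by omega)) h1 h2 hno
  obtain ⟨e, hbe, heb, hea, hemin⟩ : ∃ e, b + m t ≤ e ∧ e ≤ b' + -d' ∧ Agree ca s e a ∧
      ∀ j, b + m t ≤ j → j < e → ¬ Agree ca s j a := by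
    classical
    have hne : ((Finset.Icc (b + m t) (b' + -d')).filter fun i => Agree ca s i a).Nonempty :=
      ⟨b' + -d', Finset.mem_filter.2 ⟨Finset.mem_Icc.2 ⟨by omega, le_rfl⟩,
        hbn'.trans hda' (by omega) (by omega)⟩⟩
    obtain ⟨e, he, hmin⟩ := Finset.exists_min_image _ id hne
    simp only [Finset.mem_filter, Finset.mem_Icc, id] at he hmin
    exact ⟨e, he.1.1, he.1.2, he.2, fun j h1 h2 h3 =>
      absurd (hmin j ⟨⟨h1, by omega⟩, h3⟩) (not_le.2 h2)⟩
  have hefar : b + (n t - ca) < e := by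
    by_contra hlt
    exact ha.not_agree_of_near hsub hap (hright (na t) (e - b) (by omega)) (by omega)
      (hbn.symm_trans hea (by omega) (by omega))
  have hean := ha.agree_of_near (hmid e hbe (by omega)) (by omega) hea
  refine hCa.glue (e := e) (e' := b' + -d) (by omega) (by omega) (by omega)
    (hCp.connect hf (hbn.mono (by omega)) hean (by omega) (by omega) hδa hδocc hδa' hδδ
      (by omega) (by omega) (by omega) fun j h1 h2 => ?_)
    hea (hbn'.trans hda (by omega) (by omega))
    (fun j h1 h2 => (hmid j (by omega) (by omega)).mono (by omega))
    ((hocc.of_agree hbn' (by omega) (by omega)).mono heb le_rfl) (WordSim.of_eq ?_)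
  · by_cases hj : b + m t + ma t ≤ j
    · exact Near.of_between hdeca hneara (by omega) (by omega) (hmid j (by omega) (by omega))
        (u := b + m t - 1) (v := e) (by omega) (by omega)
        fun i h3 h4 => hemin i (by omega) h4
    · have := hbn.trans_near (hright (gp t) (j - b) (by omega)) (by omega) (by omega)
      rwa [add_sub_cancel] at this
  · have := codedWord_eq_of_agree hf hbn' (a := -d) (b := 0) (by omega) (by omega)
    rwa [add_zero] at this

end TwoStepReturns

/-! ### Bounding coded words up to similarity -/

section Bound

variable {x r l : ℤ → ℕ} {c cl : ℕ}

/-- Once enough returns to `r` have been passed, all prefixes of the right half of `x` that end at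
an occurrence of `r` are similar. The first such end point is computably bounded, and others lie
arbitrarily far out. -/
theorem exists_sim_codedWord_right (hx : TendsTo 1 x (orbitClosure r)) (hrec : Recurs 1 c x r)
    (hr : HasUniformReturns r c) :
    ∃ M : ℕ → ℕ, Computable M ∧ ∀ t f, IsLocal t f → ∃ B : ℤ, 0 ≤ B ∧ B ≤ M t ∧
      ∀ B₀ : ℤ, ∃ B' : ℤ, B₀ ≤ B' ∧ 0 ≤ B' ∧
        WordSim t t (codedWord f x 0 B') (codedWord f x 0 B) := by
  obtain ⟨g, hg, hgC⟩ := hr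
  obtain ⟨h, hh, hnear⟩ := hx
  obtain ⟨H, hH, hmany⟩ := hrec.exists_occursMany_right
  obtain ⟨k, -, hk⟩ := hrec
  refine ⟨_, hH.comp (hh.comp hg) computable_powBound_self, fun t f hf => ?_⟩
  obtain ⟨C, hC⟩ := hgC t f hf
  obtain ⟨d, d', h1, h2, h3, h4, h5, h6⟩ := hmany (h (g t)) (powBound t t)
  have key (B : ℤ) (hB : d' ≤ B) (hBr : Agree c x B r) :
      WordSim t t (codedWord f x 0 B) (codedWord f x 0 d ++ wordPow C (powBound t t)) := by
    rw [← codedWord_append (a := 0) (b := d) (by omega) (by omega)]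
    refine (WordSim.refl _).append (hC.sim_of_occursMany (by omega) h4 hBr (fun j hj _ => ?_)
      (h6.mono le_rfl hB))
    have := hnear (g t) j.toNat (by omega)
    rwa [one_mul, Int.toNat_of_nonneg (by omega)] at this
  refine ⟨d', by omega, h3, fun B₀ => ?_⟩
  obtain ⟨B', h7, -, h8⟩ := hk (max B₀.toNat d'.toNat)
  rw [one_mul] at h8
  exact ⟨B', by omega, by omega, (key B' (by omega) h8).trans (key d' le_rfl h5).symm⟩

theorem exists_sim_codedWord_left (hx : TendsTo (-1) x (orbitClosure r))
    (hrec : Recurs (-1) c x r) (hr : HasUniformReturns r c) :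
    ∃ M : ℕ → ℕ, Computable M ∧ ∀ t f, IsLocal t f → ∃ B : ℤ, 0 ≤ B ∧ B ≤ M t ∧
      ∀ B₀ : ℤ, ∃ B' : ℤ, B₀ ≤ B' ∧ 0 ≤ B' ∧
        WordSim t t (codedWord f x (-B') 0) (codedWord f x (-B) 0) := by
  obtain ⟨g, hg, hgC⟩ := hr
  obtain ⟨h, hh, hnear⟩ := hx
  obtain ⟨H, hH, hmany⟩ := hrec.exists_occursMany_left
  obtain ⟨k, -, hk⟩ := hrec
  refine ⟨_, hH.comp (hh.comp hg) computable_powBound_self, fun t f hf => ?_⟩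
  obtain ⟨C, hC⟩ := hgC t f hf
  obtain ⟨d, d', h1, h2, h3, h4, h5, h6⟩ := hmany (h (g t)) (powBound t t)
  have key (B : ℤ) (hB : d' ≤ B) (hBr : Agree c x (-B) r) :
      WordSim t t (codedWord f x (-B) 0) (wordPow C (powBound t t) ++ codedWord f x (-d) 0) := by
    rw [← codedWord_append (a := -B) (b := -d) (by omega) (by omega)]
    refine (hC.sim_of_occursMany (by omega) hBr h4 (fun j _ hj => ?_)
      (h6.mono (by omega) le_rfl)).append (WordSim.refl _)
    have := hnear (g t) (-j).toNat (by omega)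
    rwa [neg_one_mul, Int.toNat_of_nonneg (by omega), neg_neg] at this
  refine ⟨d', by omega, h3, fun B₀ => ?_⟩
  obtain ⟨B', h7, -, h8⟩ := hk (max B₀.toNat d'.toNat)
  rw [neg_one_mul] at h8
  exact ⟨B', by omega, by omega, (key B' (by omega) h8).trans (key d' le_rfl h5).symm⟩

/-- The bound on `b'` is stated only for `a' < b'` because an empty interval `[a, b)` may have `b <
a`. -/
theorem codedWord_eq_append {f : (ℤ → ℕ) → ℕ} {a b : ℤ} {u w v : List ℕ}
    (h : codedWord f x a b = u ++ (w ++ v)) :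
    ∃ a' b', a' ≤ b' ∧ w = codedWord f x a' b' ∧ a ≤ a' ∧ (a' < b' → b' ≤ b) := by
  have hlen := congrArg List.length h
  simp only [length_codedWord, List.length_append] at hlen
  refine ⟨a + u.length, a + u.length + w.length, by omega, ?_, by omega, fun _ => by omega⟩
  by_cases hw : w.length = 0
  · rw [List.length_eq_zero_iff.1 hw]
    simp [codedWord]
  rw [← codedWord_append (a := a) (b := a + u.length) (c := b) (by omega) (by omega),
    ← codedWord_append (a := a + u.length) (b := a + u.length + w.length) (c := b) (by omega)
      (by omega)] at h
  have h1 := (List.append_inj h (by rw [length_codedWord]; omega)).2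
  exact ((List.append_inj h1 (by rw [length_codedWord]; omega)).1).symm

/-- Every coded word of `x` is similar to a coded word of `x` of computably bounded length. -/
theorem exists_computable_bound (hx : TendsTo 1 x (orbitClosure r)) (hrec : Recurs 1 c x r)
    (hr : HasUniformReturns r c) (hx' : TendsTo (-1) x (orbitClosure l))
    (hrec' : Recurs (-1) cl x l) (hl : HasUniformReturns l cl) :
    ∃ M : ℕ → ℕ, Computable M ∧ ∀ t f, IsLocal t f → ∀ a b : ℤ, ∃ a' b' : ℤ, a' ≤ b' ∧
      b' - a' ≤ M t ∧ WordSim t t (codedWord f x a b) (codedWord f x a' b') := by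
  obtain ⟨M₁, hM₁, h₁⟩ := exists_sim_codedWord_right hx hrec hr
  obtain ⟨M₂, hM₂, h₂⟩ := exists_sim_codedWord_left hx' hrec' hl
  -- Two extra levels pay for cutting the word out of a longer one by `WordSim.exists_infix`.
  have hs : Computable fun t => t + 2 := Computable.succ.comp Computable.succ
  refine ⟨_, (hM₁.comp hs).nat_add (hM₂.comp hs), fun t f hf a b => ?_⟩
  have hf' : IsLocal (t + 2) f := fun x y h => hf x y fun j h1 h2 => h j (by omega) (by omega)
  by_cases hab : b ≤ a
  · refine ⟨0, 0, le_rfl, by omega, WordSim.of_eq ?_⟩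
    simp [codedWord, hab]
  obtain ⟨B, hB0, hBM, hB⟩ := h₁ (t + 2) f hf'
  obtain ⟨A, hA0, hAM, hA⟩ := h₂ (t + 2) f hf'
  obtain ⟨B', hbB, hB', hsB⟩ := hB b
  obtain ⟨A', haA, hA', hsA⟩ := hA (-a)
  -- The interval `[-A', B')` contains `[a, b)` and its coded word is similar to that of `[-A, B)`,
  -- whose length is computably bounded.
  have hsim := hsA.append hsB
  rw [codedWord_append (by omega) hB', codedWord_append (by omega) hB0] at hsim
  obtain ⟨u, w, v, huwv, hw⟩ := hsim.exists_infix (w := codedWord f x a b)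
    (a := codedWord f x (-A') a) (b := codedWord f x b B') (by
      rw [codedWord_append (by omega) hbB, codedWord_append (by omega) (by omega)])
  obtain ⟨a', b', hab', rfl, h1, h2⟩ := codedWord_eq_append huwv
  refine ⟨a', b', hab', ?_, hw.mono_length (by omega)⟩
  by_cases hlt : a' < b'
  · have := h2 hlt
    push_cast
    omega
  · omega

end Bound

/-! ### Compactness, limit sets and isolated points of subshifts -/

open Filter Topology in
theorem IsSubshift.exists_cluster {X : Set (ℤ → ℕ)} (hX : IsSubshift X) (x : ℕ → ℤ → ℕ)
    (hx : ∀ n, x n ∈ X) : ∃ z ∈ X, ∀ m N : ℕ, ∃ n, N ≤ n ∧ Agree m (x n) 0 z := by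
  obtain ⟨z, hz, φ, hφ, hlim⟩ := hX.1.isSeqCompact hx
  refine ⟨z, hz, fun m N => ?_⟩
  have h : ∀ᶠ n in atTop, ∀ j ∈ Finset.Icc (-m : ℤ) m, x (φ n) j = z j := by
    rw [Filter.eventually_all_finset]
    intro j _
    have := (tendsto_pi_nhds.1 hlim) j
    rw [nhds_discrete, tendsto_pure] at this
    exact this
  obtain ⟨n, hn, hnN⟩ := (h.and (eventually_ge_atTop N)).exists
  refine ⟨φ n, hnN.trans (hφ.id_le n), fun j h1 h2 => ?_⟩
  rw [zero_add]
  exact hn j (Finset.mem_Icc.2 ⟨h1, h2⟩)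

theorem isClosed_of_agree {Y : Set (ℤ → ℕ)}
    (h : ∀ z, (∀ n, ∃ y ∈ Y, Agree n z 0 y) → z ∈ Y) : IsClosed Y := by
  refine isClosed_of_closure_subset fun z hz => h z fun n => ?_
  have ho : IsOpen (Set.pi (Finset.Icc (-n : ℤ) n : Set ℤ) fun j => ({z j} : Set ℕ)) :=
    isOpen_set_pi (Finset.finite_toSet _) fun _ _ => isOpen_discrete _
  obtain ⟨y, hy, hyY⟩ := mem_closure_iff.1 hz _ ho (by simp [Set.mem_pi])
  refine ⟨y, hyY, fun j h1 h2 => ?_⟩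
  have := hy j (by simpa using ⟨h1, h2⟩)
  simpa using this.symm

section Subshift

variable {X Y Z : Set (ℤ → ℕ)} {x y z : ℤ → ℕ}

theorem IsSubshift.mem_of_agree (hX : IsSubshift X) (h : ∀ n, ∃ y ∈ X, Agree n z 0 y) :
    z ∈ X := by
  choose y hy hzy using h
  obtain ⟨w, hw, hwy⟩ := hX.exists_cluster y hy
  suffices z = w by rwa [this]
  funext j
  obtain ⟨n, hn, h⟩ := hwy j.natAbs j.natAbs
  have h1 := h j (by omega) (by omega)
  have h2 := hzy n j (by omega) (by omega)
  rw [zero_add] at h1 h2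
  rw [h2, h1]

theorem shiftMap_eq (x : ℤ → ℕ) : shiftMap x = seqShift 1 x := rfl

theorem seqShift_add (j k : ℤ) (x : ℤ → ℕ) : seqShift (j + k) x = seqShift j (seqShift k x) :=
  (seqShift_seqShift j k x).symm

theorem IsSubshift.seqShift_mem (hX : IsSubshift X) (k : ℤ) (hx : x ∈ X) : seqShift k x ∈ X := by
  have h1 {y : ℤ → ℕ} (hy : y ∈ X) : seqShift 1 y ∈ X := by
    rw [← hX.2]
    exact ⟨y, hy, rfl⟩
  have h2 {y : ℤ → ℕ} (hy : y ∈ X) : seqShift (-1) y ∈ X := by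
    rw [← hX.2] at hy
    obtain ⟨w, hw, rfl⟩ := hy
    rwa [shiftMap_eq, ← seqShift_add, neg_add_cancel, seqShift_zero]
  induction k with
  | zero => rwa [seqShift_zero]
  | succ k ih =>
    rw [add_comm, seqShift_add]
    exact h1 ih
  | pred k ih =>
    rw [sub_eq_neg_add, seqShift_add]
    exact h2 ih

theorem IsSubshift.of_subset (hX : IsSubshift X) (hYX : Y ⊆ X)
    (hcl : ∀ z ∈ X, (∀ n, ∃ y ∈ Y, Agree n z 0 y) → z ∈ Y)
    (hsh : ∀ k, ∀ y ∈ Y, seqShift k y ∈ Y) : IsSubshift Y := by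
  refine ⟨hX.1.of_isClosed_subset (isClosed_of_agree fun z hz => ?_) hYX, ?_⟩
  · exact hcl z (hX.mem_of_agree fun n =>
      let ⟨y, hy, h⟩ := hz n
      ⟨y, hYX hy, h⟩) hz
  · ext y
    constructor
    · rintro ⟨w, hw, rfl⟩
      exact hsh 1 w hw
    · intro hy
      refine ⟨seqShift (-1) y, hsh _ y hy, ?_⟩
      rw [shiftMap_eq, ← seqShift_add, add_neg_cancel, seqShift_zero]

theorem IsSubshift.union (hY : IsSubshift Y) (hZ : IsSubshift Z) : IsSubshift (Y ∪ Z) :=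
  ⟨hY.1.union hZ.1, by rw [Set.image_union, hY.2, hZ.2]⟩

theorem IsSubshift.inter (hY : IsSubshift Y) (hZ : IsSubshift Z) : IsSubshift (Y ∩ Z) :=
  hY.of_subset Set.inter_subset_left
    (fun _ hz h => ⟨hz, hZ.mem_of_agree fun n =>
      let ⟨y, hy, h⟩ := h n
      ⟨y, hy.2, h⟩⟩)
    fun k _ hy => ⟨hY.seqShift_mem k hy.1, hZ.seqShift_mem k hy.2⟩

theorem isSubshift_empty : IsSubshift ∅ := ⟨isCompact_empty, Set.image_empty _⟩

theorem IsSubshift.orbitClosure_subset (hX : IsSubshift X) (hx : x ∈ X) : orbitClosure x ⊆ X :=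
  fun _ hy => hX.mem_of_agree fun n => by
    obtain ⟨i, hi⟩ := hy n
    refine ⟨seqShift i x, hX.seqShift_mem i hx, fun j h1 h2 => ?_⟩
    rw [zero_add, seqShift, add_comm j, hi j h1 h2]

theorem mem_orbitClosure_of_agree (h : ∀ n, ∃ y ∈ orbitClosure x, Agree n z 0 y) :
    z ∈ orbitClosure x := fun n => by
  obtain ⟨y, hy, hzy⟩ := h n
  obtain ⟨i, hi⟩ := hy n
  refine ⟨i, fun j h1 h2 => ?_⟩
  rw [hi j h1 h2, ← hzy j h1 h2, zero_add]

theorem IsSubshift.orbitClosure (hX : IsSubshift X) (hx : x ∈ X) : IsSubshift (orbitClosure x) :=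
  hX.of_subset (hX.orbitClosure_subset hx) (fun _ _ => mem_orbitClosure_of_agree)
    fun k _ => seqShift_mem_orbitClosure k

theorem orbitClosure_subset_of_mem (hy : y ∈ orbitClosure x) : orbitClosure y ⊆ orbitClosure x :=
  fun _ hz => mem_orbitClosure_of_agree fun n => by
    obtain ⟨i, hi⟩ := hz n
    refine ⟨seqShift i y, seqShift_mem_orbitClosure i hy, fun j h1 h2 => ?_⟩
    rw [zero_add, seqShift, add_comm j, hi j h1 h2]

/-- The limit points of `x` in the direction `ε`. -/
def limitSet (ε : ℤ) (x : ℤ → ℕ) : Set (ℤ → ℕ) :=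
  {y | ∀ n m : ℕ, ∃ i : ℕ, m ≤ i ∧ Agree n x (ε * i) y}

variable {ε : ℤ}

theorem limitSet_subset_orbitClosure : limitSet ε x ⊆ orbitClosure x := fun _ hy n =>
  let ⟨i, _, hi⟩ := hy n 0
  ⟨ε * i, hi⟩

theorem seqShift_mem_limitSet (hε : ε = 1 ∨ ε = -1) (k : ℤ) (hy : y ∈ limitSet ε x) :
    seqShift k y ∈ limitSet ε x := fun n m => by
  obtain ⟨i, him, hi⟩ := hy (n + k.natAbs) (m + k.natAbs)
  have h := hi.trans (Agree.refl n y k) (by omega) (by omega)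
  rcases hε with rfl | rfl
  · refine ⟨(i + k).toNat, by omega, ?_⟩
    rwa [Int.toNat_of_nonneg (by omega), one_mul, ← one_mul (i : ℤ)]
  · refine ⟨(i - k).toNat, by omega, ?_⟩
    rw [Int.toNat_of_nonneg (by omega)]
    rwa [show (-1 : ℤ) * (i - k) = -1 * i + k by ring]

theorem IsSubshift.limitSet (hX : IsSubshift X) (hx : x ∈ X) (hε : ε = 1 ∨ ε = -1) :
    IsSubshift (limitSet ε x) := by
  refine hX.of_subset (limitSet_subset_orbitClosure.trans (hX.orbitClosure_subset hx))
    (fun z _ hz n m => ?_) fun k _ => seqShift_mem_limitSet hε k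
  obtain ⟨y, hy, hzy⟩ := hz n
  obtain ⟨i, him, hi⟩ := hy n m
  refine ⟨i, him, fun j h1 h2 => ?_⟩
  rw [hi j h1 h2, ← hzy j h1 h2, zero_add]

/-- Otherwise bad windows occur arbitrarily far out, and a cluster point of the corresponding shifts
of `x` is a limit point near one of them. -/
theorem IsSubshift.exists_near_limitSet (hX : IsSubshift X) (hx : x ∈ X) (ε : ℤ) (n : ℕ) :
    ∃ m : ℕ, ∀ i : ℕ, m ≤ i → Near (_root_.limitSet ε x) n x (ε * i) := by
  by_contra! h
  choose i hmi hi using h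
  obtain ⟨z, -, hz⟩ := hX.exists_cluster (fun m => seqShift (ε * i m) x)
    fun m => hX.seqShift_mem _ hx
  have hagree {k m : ℕ} (h : Agree k (seqShift (ε * i m) x) 0 z) : Agree k x (ε * i m) z :=
    fun j h1 h2 => by
      rw [← h j h1 h2, zero_add, seqShift, add_comm]
  obtain ⟨m, -, hm⟩ := hz n 0
  refine hi m ⟨z, fun k N => ?_, hagree hm⟩
  obtain ⟨m', hm', h⟩ := hz k N
  exact ⟨i m', hm'.trans (hmi m'), hagree h⟩

theorem IsSubshift.limitSet_nonempty (hX : IsSubshift X) (hx : x ∈ X) (ε : ℤ) :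
    (_root_.limitSet ε x).Nonempty := by
  obtain ⟨m, hm⟩ := hX.exists_near_limitSet hx ε 0
  obtain ⟨y, hy, -⟩ := hm m le_rfl
  exact ⟨y, hy⟩

/-- The coordinates where `x` looks like `y` escape to the right, escape to the left, or stay in a
finite range; in the last case one coordinate serves all radii. -/
theorem mem_orbit_or_limitSet (hy : y ∈ orbitClosure x) :
    (∃ k, y = seqShift k x) ∨ y ∈ limitSet 1 x ∨ y ∈ limitSet (-1) x := by
  by_contra! h
  obtain ⟨h0, h1, h2⟩ := h
  simp only [limitSet, Set.mem_ofPred_eq, not_forall, not_exists, not_and, one_mul,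
    neg_one_mul] at h1 h2
  obtain ⟨n₁, m₁, h1⟩ := h1
  obtain ⟨n₂, m₂, h2⟩ := h2
  have h3 (k : ℤ) : ∃ N : ℕ, ¬ Agree N x k y := by
    by_contra! hk
    refine h0 k (funext fun j => ?_)
    rw [← hk j.natAbs j (by omega) (by omega), seqShift, add_comm]
  choose N hN using h3
  obtain ⟨i, hi⟩ := hy (n₁ + n₂ + (Finset.Icc (-m₂ : ℤ) m₁).sup N)
  by_cases hi1 : m₁ ≤ i
  · refine h1 i.toNat (by omega) ?_
    rw [Int.toNat_of_nonneg (by omega)]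
    exact hi.mono (by omega)
  by_cases hi2 : i ≤ -m₂
  · refine h2 (-i).toNat (by omega) ?_
    rw [Int.toNat_of_nonneg (by omega), neg_neg]
    exact hi.mono (by omega)
  refine hN i (hi.mono ?_)
  have : N i ≤ (Finset.Icc (-m₂ : ℤ) m₁).sup N :=
    Finset.le_sup (Finset.mem_Icc.2 ⟨by omega, by omega⟩)
  omega

/-- By Baire's theorem the countable compact orbit closure has an isolated point `z`. The orbit of
`x` is dense in it, so `z` is a shift of `x`, and isolation moves back to `x`. -/
theorem IsSubshift.exists_isolatedBy (hX : IsSubshift X) (hc : X.Countable) (hx : x ∈ X) :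
    ∃ c, IsolatedBy c x := by
  obtain ⟨z, hz, n, hn⟩ : ∃ z ∈ _root_.orbitClosure x, ∃ n : ℕ,
      ∀ y ∈ _root_.orbitClosure x, Agree n y 0 z → y = z := by
    have hO := hX.orbitClosure hx
    have : CompactSpace (_root_.orbitClosure x) := isCompact_iff_compactSpace.1 hO.1
    have : Countable (_root_.orbitClosure x) := (hc.mono (hX.orbitClosure_subset hx)).to_subtype
    have : Nonempty (_root_.orbitClosure x) := ⟨⟨x, mem_orbitClosure_self x⟩⟩
    obtain ⟨⟨z, hz⟩, hzi⟩ := nonempty_interior_of_iUnion_of_closed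
      (f := fun y : _root_.orbitClosure x => ({y} : Set (_root_.orbitClosure x)))
      (fun _ => isClosed_singleton) (by ext; simp)
    obtain ⟨w, hw⟩ := hzi
    have hwz : w ∈ ({⟨z, hz⟩} : Set (_root_.orbitClosure x)) := interior_subset hw
    rw [Set.mem_singleton_iff] at hwz
    subst hwz
    rw [mem_interior] at hw
    obtain ⟨U, hU, hUo, hzU⟩ := hw
    obtain ⟨V, hV, rfl⟩ := isOpen_induced_iff.1 hUo
    refine ⟨z, hz, ?_⟩
    by_contra! h
    choose y hy hyz hne using h
    have hcl : ∀ n, y n ∉ V := fun n hn => hne n <| by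
      have : (⟨y n, hy n⟩ : _root_.orbitClosure x) = ⟨z, hz⟩ := hU hn
      exact congrArg Subtype.val this
    have : z ∈ closure Vᶜ := by
      refine mem_closure_of_tendsto (f := y) (b := Filter.atTop) ?_ (.of_forall hcl)
      rw [tendsto_pi_nhds]
      intro j
      rw [nhds_discrete, Filter.tendsto_pure]
      filter_upwards [Filter.eventually_ge_atTop j.natAbs] with n hn
      have := hyz n j (by omega) (by omega)
      rwa [zero_add] at this
    rw [hV.isClosed_compl.closure_eq] at this
    exact this hzU
  obtain ⟨i, hi⟩ := hz n
  have hzi : seqShift i x = z := hn _ (seqShift_mem_orbitClosure i (mem_orbitClosure_self x))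
    fun j h1 h2 => by rw [zero_add, seqShift, add_comm, hi j h1 h2]
  refine ⟨n + i.natAbs, fun y hy hyx => ?_⟩
  have h : seqShift i y = z := hn _ (seqShift_mem_orbitClosure i hy) fun j h1 h2 => by
    rw [zero_add, ← hzi, seqShift, seqShift]
    simpa using hyx (j + i) (by omega) (by omega)
  rw [← hzi] at h
  have := congrArg (seqShift (-i)) h
  rwa [← seqShift_add, ← seqShift_add, neg_add_cancel, seqShift_zero, seqShift_zero] at this

theorem IsolatedBy.notMem_limitSet {c : ℕ} (hx : IsolatedBy c x)
    (hper : ∀ k, seqShift k x = x → k = 0) (hε : ε = 1 ∨ ε = -1) : x ∉ limitSet ε x := fun h => by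
  obtain ⟨i, h1, hi⟩ := h c 1
  refine hx.not_agree hper (k := ε * i) ?_ hi
  rcases hε with rfl | rfl <;> omega

theorem exists_period (h : ¬ ∀ k, seqShift k x = x → k = 0) : ∃ q : ℕ, 0 < q ∧ seqShift q x = x := by
  push Not at h
  obtain ⟨k, hk, hk0⟩ := h
  rcases lt_or_gt_of_ne hk0 with hlt | hlt
  · refine ⟨(-k).toNat, by omega, ?_⟩
    rw [Int.toNat_of_nonneg (by omega)]
    conv_lhs => rw [← hk]
    rw [← seqShift_add, neg_add_cancel, seqShift_zero]
  · exact ⟨k.toNat, by omega, by rwa [Int.toNat_of_nonneg hlt.le]⟩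

theorem seqShift_mul {q : ℤ} (h : seqShift q x = x) (k : ℤ) : seqShift (k * q) x = x := by
  have h' : seqShift (-q) x = x := by
    conv_lhs => rw [← h]
    rw [← seqShift_add, neg_add_cancel, seqShift_zero]
  induction k with
  | zero => rw [zero_mul, seqShift_zero]
  | succ k ih => rw [add_mul, one_mul, seqShift_add, h, ih]
  | pred k ih => rw [sub_mul, one_mul, sub_eq_add_neg, seqShift_add, h', ih]

theorem limitSet_eq_orbitClosure {q : ℕ} (hq : 0 < q) (h : seqShift q x = x)
    (hε : ε = 1 ∨ ε = -1) : limitSet ε x = orbitClosure x := by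
  refine Set.Subset.antisymm limitSet_subset_orbitClosure fun y hy n m => ?_
  obtain ⟨i, hi⟩ := hy n
  have hεε : ε * ε = 1 := by rcases hε with rfl | rfl <;> rfl
  have hεi : -(i.natAbs : ℤ) ≤ ε * i := by rcases hε with rfl | rfl <;> omega
  have hk : ((m + i.natAbs : ℕ) : ℤ) ≤ (m + i.natAbs : ℕ) * q := by
    exact_mod_cast Nat.le_mul_of_pos_right _ hq
  refine ⟨(ε * i + (m + i.natAbs : ℕ) * q).toNat, by omega, fun j h1 h2 => ?_⟩
  rw [Int.toNat_of_nonneg (by omega), ← hi j h1 h2, mul_add, ← mul_assoc, hεε, one_mul]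
  have := congrFun (seqShift_mul h (ε * (m + i.natAbs : ℕ))) (i + j)
  rw [seqShift] at this
  rw [← this]
  congr 1
  ring

/-- Minimality of a periodic orbit: the required shift can be chosen within one period. -/
theorem mem_orbitClosure_of_period {q : ℕ} (hq : 0 < q) (h : seqShift q x = x)
    (hy : y ∈ orbitClosure x) : x ∈ orbitClosure y := fun n => by
  obtain ⟨i, hi⟩ := hy (n + q)
  have h0 : (0 : ℤ) < q := by omega
  have h3 := Int.emod_add_mul_ediv (-i) q
  have h4 := Int.emod_nonneg (-i) h0.ne'
  have h5 := Int.emod_lt_of_pos (-i) h0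
  refine ⟨(-i) % q, fun j h1 h2 => ?_⟩
  rw [← hi _ (by push_cast; omega) (by push_cast; omega)]
  have := congrFun (seqShift_mul h (-(-i / q))) j
  rw [seqShift] at this
  rw [← this]
  congr 1
  linear_combination h3

end Subshift

/-! ### Limit sets when there are at most five subsystems -/

section FewSubsystems

variable {X A B R S : Set (ℤ → ℕ)} {x y r a b : ℤ → ℕ} {ε : ℤ}

theorem length_le_of_nodup {n : ℕ} (hQ : (subsystems X).encard ≤ n) {l : List (Set (ℤ → ℕ))}
    (hl : l.Nodup) (h : ∀ Y ∈ l, Y ∈ subsystems X) : l.length ≤ n := by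
  classical
  have h1 : ((l.toFinset : Set (Set (ℤ → ℕ)))).encard ≤ (subsystems X).encard :=
    Set.encard_le_encard fun Y hY => h Y (by simpa using hY)
  rw [Set.encard_coe_eq_coe_finsetCard, List.toFinset_card_of_nodup hl] at h1
  exact_mod_cast h1.trans hQ

/-- If `A` and `B` were incomparable, then `∅`, `A`, `B`, `A ∪ B`, `R` and `S` would be six
subsystems. -/
theorem subset_or_subset (hQ : (subsystems X).encard ≤ (5 : ℕ))
    (hA : A ∈ subsystems X) (hB : B ∈ subsystems X) (hR : R ∈ subsystems X)
    (hS : S ∈ subsystems X) (hABR : A ∪ B ⊂ R) (hRS : R ⊂ S) : A ⊆ B ∨ B ⊆ A := by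
  by_contra! h
  have h1 : A ≠ ∅ := fun h' => h.1 (h' ▸ Set.empty_subset _)
  have h2 : B ≠ ∅ := fun h' => h.2 (h' ▸ Set.empty_subset _)
  have h3 : A ≠ B := fun h' => h.1 h'.subset
  have h4 : A ⊂ A ∪ B := ⟨Set.subset_union_left, fun h' => h.2 (Set.subset_union_right.trans h')⟩
  have h5 : B ⊂ A ∪ B := ⟨Set.subset_union_right, fun h' => h.1 (Set.subset_union_left.trans h')⟩
  have h6 : A ∪ B ≠ ∅ := fun h' => h1 (Set.subset_empty_iff.1 (h' ▸ h4.1))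
  have hR0 : R ≠ ∅ := fun h' => h6 (Set.subset_empty_iff.1 (h' ▸ hABR.1))
  have hS0 : S ≠ ∅ := fun h' => hR0 (Set.subset_empty_iff.1 (h' ▸ hRS.1))
  have hlen := length_le_of_nodup hQ (l := [∅, A, B, A ∪ B, R, S]) (by
    simp only [List.nodup_cons, List.mem_cons, List.not_mem_nil, or_false, not_or,
      List.nodup_nil, and_true, not_false_eq_true]
    exact ⟨⟨h1.symm, h2.symm, h6.symm, hR0.symm, hS0.symm⟩,
      ⟨h3, h4.ne, (h4.trans hABR).ne, (h4.trans (hABR.trans hRS)).ne⟩,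
      ⟨h5.ne, (h5.trans hABR).ne, (h5.trans (hABR.trans hRS)).ne⟩,
      ⟨hABR.ne, (hABR.trans hRS).ne⟩, hRS.ne⟩) (by
    have : A ∪ B ∈ subsystems X := ⟨Set.union_subset hA.1 hB.1, hA.2.union hB.2⟩
    have : ∅ ∈ subsystems X := ⟨Set.empty_subset _, isSubshift_empty⟩
    simp [*])
  simp at hlen

theorem eq_of_chain {A₁ A₂ A₃ A₄ Q : Set (ℤ → ℕ)} (hQ5 : (subsystems X).encard ≤ (5 : ℕ))
    (hA₁ : A₁ ∈ subsystems X) (hA₂ : A₂ ∈ subsystems X) (hA₃ : A₃ ∈ subsystems X)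
    (hA₄ : A₄ ∈ subsystems X) (hQ : Q ∈ subsystems X) (h₁ : A₁.Nonempty) (h₂ : A₁ ⊂ A₂)
    (h₃ : A₂ ⊂ A₃) (h₄ : A₃ ⊂ A₄) : Q = ∅ ∨ Q = A₁ ∨ Q = A₂ ∨ Q = A₃ ∨ Q = A₄ := by
  by_contra! h
  have hn {B : Set (ℤ → ℕ)} (hB : A₁ ⊆ B) : ∅ ≠ B := (h₁.mono hB).ne_empty.symm
  have hlen := length_le_of_nodup hQ5 (l := [Q, ∅, A₁, A₂, A₃, A₄]) (by
    simp only [List.nodup_cons, List.mem_cons, List.not_mem_nil, or_false, not_or,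
      List.nodup_nil, and_true, not_false_eq_true]
    exact ⟨⟨h.1.ne_empty, h.2.1, h.2.2.1, h.2.2.2.1, h.2.2.2.2⟩,
      ⟨hn le_rfl, hn h₂.1, hn (h₂.trans h₃).1, hn (h₂.trans (h₃.trans h₄)).1⟩,
      ⟨h₂.ne, (h₂.trans h₃).ne, (h₂.trans (h₃.trans h₄)).ne⟩,
      ⟨h₃.ne, (h₃.trans h₄).ne⟩, h₄.ne⟩) (by
    have : ∅ ∈ subsystems X := ⟨Set.empty_subset _, isSubshift_empty⟩
    simp [*])
  simp at hlen

theorem orbitClosure_mem_subsystems (hX : IsSubshift X) (hx : x ∈ X) :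
    orbitClosure x ∈ subsystems X :=
  ⟨hX.orbitClosure_subset hx, hX.orbitClosure hx⟩

theorem limitSet_mem_subsystems (hX : IsSubshift X) (hx : x ∈ X) (hε : ε = 1 ∨ ε = -1) :
    limitSet ε x ∈ subsystems X :=
  ⟨limitSet_subset_orbitClosure.trans (hX.orbitClosure_subset hx), hX.limitSet hx hε⟩

theorem IsSubshift.exists_separation (hA : IsSubshift A) (hB : IsSubshift B)
    (hAB : Disjoint A B) : ∃ n, ∀ s i, Near A n s i → ¬ Near B n s i := by
  by_contra! h
  choose s i hAs hBs using h
  choose y hy hsy using hAs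
  choose z hz hsz using hBs
  obtain ⟨w, hw, hyw⟩ := hA.exists_cluster y hy
  refine Set.disjoint_left.1 hAB hw (hB.mem_of_agree fun n => ?_)
  obtain ⟨m, hm, h⟩ := hyw n n
  refine ⟨z m, hz m, fun j h1 h2 => ?_⟩
  rw [zero_add, ← h j h1 h2, zero_add, ← hsy m j (by omega) (by omega),
    hsz m j (by omega) (by omega)]

/-- Disjoint subshifts are told apart at some radius `n`. A window of radius `n + 1` still controls
radius `n` one step further, so far out `x` cannot pass from `A` to `B`. -/
theorem limitSet_ne_union (hX : IsSubshift X) (hx : x ∈ X) (hε : ε = 1 ∨ ε = -1)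
    (hA : IsSubshift A) (hB : IsSubshift B) (hAB : Disjoint A B) (hA0 : A.Nonempty)
    (hB0 : B.Nonempty) : limitSet ε x ≠ A ∪ B := fun heq => by
  obtain ⟨n, hn⟩ := hA.exists_separation hB hAB
  obtain ⟨m, hm⟩ := hX.exists_near_limitSet hx ε (n + 1)
  rw [heq] at hm
  have hstep (i : ℕ) (hi : m ≤ i) (h : Near A (n + 1) x (ε * i)) :
      Near A (n + 1) x (ε * (i + 1 : ℕ)) := by
    obtain ⟨y, hy | hy, hxy⟩ := hm (i + 1) (by omega)
    · exact ⟨y, hy, hxy⟩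
    · exfalso
      obtain ⟨z, hz, hxz⟩ := h
      refine hn x (ε * (i + 1 : ℕ)) ⟨seqShift ε z, hA.seqShift_mem ε hz, ?_⟩
        ⟨y, hy, hxy.mono (Nat.le_succ n)⟩
      have h1 := hxz.trans (Agree.refl n z ε) (by rcases hε with rfl | rfl <;> omega)
        (by rcases hε with rfl | rfl <;> omega)
      rwa [show ε * (i + 1 : ℕ) = ε * i + ε by push_cast; ring]
  obtain ⟨y, hy⟩ := hA0
  obtain ⟨i, hi, hxy⟩ := (heq ▸ Or.inl hy : y ∈ limitSet ε x) (n + 1) m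
  have hall (j : ℕ) (hj : i ≤ j) : Near A (n + 1) x (ε * j) := by
    induction j, hj using Nat.le_induction with
    | base => exact ⟨y, hy, hxy⟩
    | succ j hj ih => exact hstep j (by omega) ih
  obtain ⟨z, hz⟩ := hB0
  obtain ⟨j, hj, hxz⟩ := (heq ▸ Or.inr hz : z ∈ limitSet ε x) n i
  exact hn x _ ((hall j hj).mono (Nat.le_succ n)) ⟨z, hz, hxz⟩

/-- Otherwise the limit set contains incomparable orbit closures of some `y` and `z`, the first
chosen maximal. If they do not fill it, `subset_or_subset` applies. If they fill it and are
disjoint, `limitSet_ne_union` applies. If they fill it and meet, the chain from `∅` through the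
intersection, the closure of `y` and the limit set up to the closure of `x` already has five
members, and the closure of `z` is a sixth. -/
theorem exists_limitSet_eq (hX : IsSubshift X) (hc : X.Countable)
    (hQ : (subsystems X).encard ≤ (5 : ℕ)) (hx : x ∈ X)
    (hper : ∀ k, seqShift k x = x → k = 0) (hε : ε = 1 ∨ ε = -1) :
    ∃ r ∈ X, limitSet ε x = orbitClosure r := by
  by_contra! hne
  have hL := limitSet_mem_subsystems hX hx hε
  have hLx : limitSet ε x ⊂ orbitClosure x := by
    obtain ⟨c, hcx⟩ := hX.exists_isolatedBy hc hx
    exact ⟨limitSet_subset_orbitClosure,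
      fun h => hcx.notMem_limitSet hper hε (h (mem_orbitClosure_self x))⟩
  have hfin : (subsystems X).Finite :=
    Set.finite_of_encard_le_coe hQ
  have hsub {y : ℤ → ℕ} (hy : y ∈ limitSet ε x) : orbitClosure y ⊆ limitSet ε x :=
    hL.2.orbitClosure_subset hy
  obtain ⟨w, hw⟩ := hX.limitSet_nonempty hx ε
  have hfin' : (orbitClosure '' limitSet ε x).Finite := hfin.subset (by
    rintro _ ⟨y, hy, rfl⟩
    exact orbitClosure_mem_subsystems hX (hL.1 hy))
  obtain ⟨A, ⟨y, hy, rfl⟩, hmax⟩ := hfin'.exists_maximal ⟨_, Set.mem_image_of_mem _ hw⟩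
  obtain ⟨z, hz, hzy⟩ : ∃ z ∈ limitSet ε x, z ∉ orbitClosure y := by
    by_contra! h
    exact hne y (hL.1 hy) (Set.Subset.antisymm h (hsub hy))
  have h1 : ¬ orbitClosure z ⊆ orbitClosure y := fun h => hzy (h (mem_orbitClosure_self z))
  have h2 : ¬ orbitClosure y ⊆ orbitClosure z := fun h => h1 (hmax ⟨z, hz, rfl⟩ h)
  have hA := orbitClosure_mem_subsystems hX (hL.1 hy)
  have hB := orbitClosure_mem_subsystems hX (hL.1 hz)
  have hU : orbitClosure y ∪ orbitClosure z ⊆ limitSet ε x := Set.union_subset (hsub hy) (hsub hz)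
  rcases hU.eq_or_ssubset with heq | hss
  · by_cases hd : Disjoint (orbitClosure y) (orbitClosure z)
    · exact limitSet_ne_union hX hx hε hA.2 hB.2 hd ⟨y, mem_orbitClosure_self y⟩
        ⟨z, mem_orbitClosure_self z⟩ heq.symm
    · have hI : orbitClosure y ∩ orbitClosure z ∈ subsystems X :=
        ⟨Set.inter_subset_left.trans hA.1, hA.2.inter hB.2⟩
      have hI1 : orbitClosure y ∩ orbitClosure z ⊂ orbitClosure y :=
        ⟨Set.inter_subset_left, fun h => h2 (h.trans Set.inter_subset_right)⟩
      have hI2 : orbitClosure y ⊂ limitSet ε x := ⟨hsub hy, fun h => h1 ((hsub hz).trans h)⟩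
      rcases eq_of_chain hQ hI hA hL (orbitClosure_mem_subsystems hX hx) hB
        (Set.not_disjoint_iff_nonempty_inter.1 hd) hI1 hI2 hLx with h | h | h | h | h
      · exact (h ▸ mem_orbitClosure_self z : z ∈ (∅ : Set (ℤ → ℕ)))
      · exact h1 (h.subset.trans Set.inter_subset_left)
      · exact h1 h.subset
      · exact hne z (hL.1 hz) h.symm
      · exact hLx.2 (h ▸ hsub hz)
  · rcases subset_or_subset hQ hA hB hL (orbitClosure_mem_subsystems hX hx) hss hLx with h | h
    · exact h2 h
    · exact h1 h

/-- In a countable subshift with at most five subsystems, every point approaches, in either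
direction, the orbit closure of a point with uniform returns. -/
theorem exists_hasUniformReturns (hX : IsSubshift X) (hc : X.Countable)
    (hQ : (subsystems X).encard ≤ (5 : ℕ))
    (hT : ∀ x ∈ X, ∀ r ∈ X, ∀ ε : ℤ, ε = 1 ∨ ε = -1 → limitSet ε x = orbitClosure r →
      TendsTo ε x (orbitClosure r))
    (hR : ∀ x ∈ X, ∀ r ∈ X, ∀ ε : ℤ, ε = 1 ∨ ε = -1 → limitSet ε x = orbitClosure r →
      ∀ c, Recurs ε c x r) (hx : x ∈ X) (hε : ε = 1 ∨ ε = -1) :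
    ∃ r ∈ X, limitSet ε x = orbitClosure r ∧ ∃ c, IsolatedBy c r ∧ HasUniformReturns r c := by
  have hpos : (1 : ℤ) = 1 ∨ (1 : ℤ) = -1 := Or.inl rfl
  have hneg : (-1 : ℤ) = 1 ∨ (-1 : ℤ) = -1 := Or.inr rfl
  have hiso {y : ℤ → ℕ} (hy : y ∈ X) := hX.exists_isolatedBy hc hy
  have hperiodic {y : ℤ → ℕ} (hy : y ∈ X) (hper : ¬ ∀ k, seqShift k y = y → k = 0) :
      ∃ c, IsolatedBy c y ∧ HasUniformReturns y c := by
    obtain ⟨q, hq, hqy⟩ := exists_period hper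
    obtain ⟨c, hcy⟩ := hiso hy
    exact ⟨c, hcy, .of_periodic hq hqy hcy⟩
  have hlt {y a : ℤ → ℕ} {ε : ℤ} (hy : y ∈ X) (hper : ∀ k, seqShift k y = y → k = 0)
      (hε : ε = 1 ∨ ε = -1) (h : limitSet ε y = orbitClosure a) :
      orbitClosure a ⊂ orbitClosure y := by
    obtain ⟨c, hcy⟩ := hiso hy
    rw [← h]
    exact ⟨limitSet_subset_orbitClosure,
      fun h => hcy.notMem_limitSet hper hε (h (mem_orbitClosure_self y))⟩
  have hnonper {y a : ℤ → ℕ} (h : orbitClosure a ⊂ orbitClosure y) :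
      ∀ k, seqShift k y = y → k = 0 := by
    by_contra hper
    obtain ⟨q, hq, hqy⟩ := exists_period hper
    exact h.2 (orbitClosure_subset_of_mem
      (mem_orbitClosure_of_period hq hqy (h.1 (mem_orbitClosure_self a))))
  have hboth {y a : ℤ → ℕ} (hy : y ∈ X) (ha : a ∈ X) (hper : ∀ k, seqShift k y = y → k = 0)
      (h1 : limitSet 1 y = orbitClosure a) (h2 : limitSet (-1) y = orbitClosure a)
      (hra : ∃ c, IsolatedBy c a ∧ HasUniformReturns a c) :
      ∃ c, IsolatedBy c y ∧ HasUniformReturns y c := by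
    obtain ⟨c, hcy⟩ := hiso hy
    obtain ⟨ca, -, hca⟩ := hra
    refine ⟨c, hcy, .of_tendsTo_both hcy hper (fun z hz => ?_) (hT y hy a ha 1 hpos h1)
      (hT y hy a ha (-1) hneg h2) (hR y hy a ha 1 hpos h1 ca) (hR y hy a ha (-1) hneg h2 ca) hca⟩
    rcases mem_orbit_or_limitSet hz with h | h | h
    · exact Or.inr h
    · exact Or.inl (h1 ▸ h)
    · exact Or.inl (h2 ▸ h)
  by_cases hper : ∀ k, seqShift k x = x → k = 0
  swap
  · obtain ⟨q, hq, hqx⟩ := exists_period hper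
    exact ⟨x, hx, limitSet_eq_orbitClosure hq hqx hε, hperiodic hx hper⟩
  obtain ⟨r, hr, hxr⟩ := exists_limitSet_eq hX hc hQ hx hper hε
  refine ⟨r, hr, hxr, ?_⟩
  by_cases hrper : ∀ k, seqShift k r = r → k = 0
  swap
  · exact hperiodic hr hrper
  have hrx := hlt hx hper hε hxr
  obtain ⟨a, ha, hra⟩ := exists_limitSet_eq hX hc hQ hr hrper hpos
  obtain ⟨b, hb, hrb⟩ := exists_limitSet_eq hX hc hQ hr hrper hneg
  have har := hlt hr hrper hpos hra
  have hbr := hlt hr hrper hneg hrb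
  have hmem {y : ℤ → ℕ} (hy : y ∈ X) := orbitClosure_mem_subsystems hX hy
  have hne {y : ℤ → ℕ} : (orbitClosure y).Nonempty := ⟨y, mem_orbitClosure_self y⟩
  -- A nonperiodic limit point of `r` has a single periodic orbit as its limit set, on both sides,
  -- and there are no other subsystems.
  have hmid {a : ℤ → ℕ} (ha : a ∈ X) (haper : ∀ k, seqShift k a = a → k = 0)
      (har : orbitClosure a ⊂ orbitClosure r) : ∃ p ∈ X, limitSet 1 a = orbitClosure p ∧
        limitSet (-1) a = orbitClosure p ∧ (∃ c, IsolatedBy c p ∧ HasUniformReturns p c) ∧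
        orbitClosure p ⊂ orbitClosure a ∧ ∀ b ∈ X, orbitClosure b ⊂ orbitClosure r →
          orbitClosure b = orbitClosure p ∨ orbitClosure b = orbitClosure a := by
    obtain ⟨p, hp, hap⟩ := exists_limitSet_eq hX hc hQ ha haper hpos
    obtain ⟨p', hp', hap'⟩ := exists_limitSet_eq hX hc hQ ha haper hneg
    have hpa := hlt ha haper hpos hap
    have hpa' := hlt ha haper hneg hap'
    have hall {b : ℤ → ℕ} (hb : b ∈ X) := eq_of_chain hQ (hmem hp) (hmem ha) (hmem hr) (hmem hx)
      (hmem hb) hne hpa har hrx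
    have hall' {b : ℤ → ℕ} (hb : b ∈ X) (hbr : orbitClosure b ⊂ orbitClosure r) :
        orbitClosure b = orbitClosure p ∨ orbitClosure b = orbitClosure a := by
      rcases hall hb with h | h | h | h | h
      · exact absurd h hne.ne_empty
      · exact Or.inl h
      · exact Or.inr h
      · exact absurd h hbr.ne
      · exact absurd h (hbr.trans hrx).ne
    have hpp' : orbitClosure p' = orbitClosure p := by
      rcases hall' hp' (hpa'.trans har) with h | h
      · exact h
      · exact absurd h hpa'.ne
    refine ⟨p, hp, hap, hpp' ▸ hap', hperiodic hp fun hpper => ?_, hpa, fun b hb => hall' hb⟩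
    obtain ⟨p₀, hp₀, hpp₀⟩ := exists_limitSet_eq hX hc hQ hp hpper hpos
    have h := hlt hp hpper hpos hpp₀
    rcases hall' hp₀ (h.trans (hpa.trans har)) with h' | h'
    · exact h.ne h'
    · exact (h.trans hpa).ne h'
  -- The union is proper since `r` lies in neither closure, and `x` provides the larger subsystem.
  have hcomp := subset_or_subset hQ (hmem ha) (hmem hb) (hmem hr) (hmem hx)
    (Set.ssubset_iff_subset_ne.2 ⟨Set.union_subset har.1 hbr.1, fun h => by
      rcases h.symm ▸ mem_orbitClosure_self r with h' | h'
      · exact har.2 (orbitClosure_subset_of_mem h')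
      · exact hbr.2 (orbitClosure_subset_of_mem h')⟩) hrx
  by_cases hab : orbitClosure a = orbitClosure b
  · refine hboth hr ha hrper hra (hab ▸ hrb) ?_
    by_cases haper : ∀ k, seqShift k a = a → k = 0
    · obtain ⟨p, hp, h1, h2, h3, -⟩ := hmid ha haper har
      exact hboth ha hp haper h1 h2 h3
    · exact hperiodic ha haper
  have hnotMem {a p : ℤ → ℕ} (h : orbitClosure p ⊂ orbitClosure a) : a ∉ orbitClosure p :=
    fun h' => h.2 (orbitClosure_subset_of_mem h')
  have hdec {y a : ℤ → ℕ} (h1 : limitSet 1 y ⊆ orbitClosure a)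
      (h2 : limitSet (-1) y ⊆ orbitClosure a) (z : ℤ → ℕ) (hz : z ∈ orbitClosure y) :
      z ∈ orbitClosure a ∨ ∃ k, z = seqShift k y := by
    rcases mem_orbit_or_limitSet hz with h | h | h
    · exact Or.inr h
    · exact Or.inl (h1 h)
    · exact Or.inl (h2 h)
  obtain ⟨cr, hcr⟩ := hiso hr
  rcases hcomp with hsub | hsub
  · have hba : orbitClosure a ⊂ orbitClosure b := Set.ssubset_iff_subset_ne.2 ⟨hsub, hab⟩
    have hbper := hnonper hba
    obtain ⟨p, hp, h1, h2, hpr, hpb, h3⟩ := hmid hb hbper hbr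
    obtain ⟨cb, hcb, hbu⟩ := hboth hb hp hbper h1 h2 hpr
    obtain ⟨cp, -, hpu⟩ := hpr
    -- Below `r` there are only the orbit closures of `p` and `b`, so the right limit set of `r` is
    -- that of `p`.
    rw [(h3 a ha har).resolve_right hab] at hra
    exact ⟨cr, hcr, .of_tendsTo_left hcr hrper (hdec (hra.subset.trans hpb.1) hrb.subset) hcb
      (hnotMem hpb) hpb.1 (hdec h1.subset h2.subset) (hT r hr p hp 1 hpos hra)
      (hT r hr b hb (-1) hneg hrb) (hT b hb p hp 1 hpos h1) (hT b hb p hp (-1) hneg h2)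
      (hR r hr b hb (-1) hneg hrb cb) (hR r hr p hp 1 hpos hra cp) (hR b hb p hp (-1) hneg h2 cp)
      hbu hpu⟩
  · have hba : orbitClosure b ⊂ orbitClosure a := Set.ssubset_iff_subset_ne.2 ⟨hsub, Ne.symm hab⟩
    have haper := hnonper hba
    obtain ⟨p, hp, h1, h2, hpr, hpa, h3⟩ := hmid ha haper har
    obtain ⟨ca, hca, hau⟩ := hboth ha hp haper h1 h2 hpr
    obtain ⟨cp, -, hpu⟩ := hpr
    rw [(h3 b hb hbr).resolve_right (Ne.symm hab)] at hrb
    exact ⟨cr, hcr, .of_tendsTo_right hcr hrper (hdec hra.subset (hrb.subset.trans hpa.1)) hca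
      (hnotMem hpa) hpa.1 (hdec h1.subset h2.subset) (hT r hr a ha 1 hpos hra)
      (hT r hr p hp (-1) hneg hrb) (hT a ha p hp 1 hpos h1) (hT a ha p hp (-1) hneg h2)
      (hR r hr a ha 1 hpos hra ca) (hR r hr p hp (-1) hneg hrb cp) (hR a ha p hp 1 hpos h1 cp)
      hau hpu⟩

end FewSubsystems

/-! ### Occurrences of words -/

/-- The word of length `n` that occurs in `x` at coordinate `i`. -/
def wordAt (x : ℤ → ℕ) (i : ℤ) (n : ℕ) : List ℕ := (List.range n).map fun k : ℕ => x (i + k)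

section Occurrences

variable {x y s : ℤ → ℕ} {i : ℤ} {n c : ℕ} {u v w : List ℕ} {X Y : Set (ℤ → ℕ)}

theorem length_wordAt : (wordAt x i n).length = n := by simp [wordAt]

theorem occursAt_iff : OccursAt x i u ↔ u = wordAt x i u.length := by
  constructor
  · intro h
    refine List.ext_getElem length_wordAt.symm fun k h1 h2 => ?_
    simp [wordAt, h k h1]
  · intro h k hk
    have : u[k]? = (wordAt x i u.length)[k]? := congrArg (fun l : List ℕ => l[k]?) h
    simpa [wordAt, hk, eq_comm] using this

theorem occursAt_wordAt : OccursAt x i (wordAt x i n) := by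
  rw [occursAt_iff, length_wordAt]

theorem occursAt_append : OccursAt x i (u ++ v) ↔ OccursAt x i u ∧ OccursAt x (i + u.length) v := by
  constructor
  · refine fun h => ⟨fun k hk => ?_, fun k hk => ?_⟩
    · have := h k (by rw [List.length_append]; omega)
      rwa [List.getElem_append_left hk] at this
    · have := h (u.length + k) (by rw [List.length_append]; omega)
      rw [List.getElem_append_right (by omega)] at this
      push_cast at this
      rw [add_assoc, this]
      simp
  · rintro ⟨h1, h2⟩ k hk
    by_cases hku : k < u.length
    · rw [List.getElem_append_left hku, h1 k hku]
    · rw [List.getElem_append_right (by omega), ← h2 (k - u.length) (by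
        rw [List.length_append] at hk; omega)]
      congr 1
      omega

theorem occursAt_seqShift {k : ℤ} : OccursAt (seqShift k x) i u ↔ OccursAt x (i + k) u := by
  simp only [OccursAt, seqShift, add_right_comm]

theorem OccursAt.of_agree (h : OccursAt y i u) (hs : Agree n s 0 y) (h1 : -n ≤ i)
    (h2 : i + u.length ≤ n + 1) : OccursAt s i u := fun k hk => by
  rw [← h k hk, ← hs (i + k) (by omega) (by omega), zero_add]

theorem OccursAt.unique (hu : OccursAt x i u) (hv : OccursAt x i v) (h : u.length = v.length) :
    u = v := by
  rw [occursAt_iff.1 hu, occursAt_iff.1 hv, h]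

theorem agree_iff_occursAt : Agree n s i y ↔ OccursAt s (i - n) (wordAt y (-n) (2 * n + 1)) := by
  constructor
  · intro h k hk
    rw [length_wordAt] at hk
    simp only [wordAt, List.getElem_map, List.getElem_range]
    rw [← h (-n + k) (by omega) (by omega)]
    congr 1
    ring
  · intro h j h1 h2
    have := h (j + n).toNat (by rw [length_wordAt]; omega)
    simp only [wordAt, List.getElem_map, List.getElem_range] at this
    rw [Int.toNat_of_nonneg (by omega)] at this
    convert this using 2 <;> ring

theorem mem_wordsOf_of_occursAt (hx : x ∈ X) (h : OccursAt x i u) : u ∈ wordsOf X := ⟨x, hx, i, h⟩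

theorem wordsOf_mono (h : X ⊆ Y) : wordsOf X ⊆ wordsOf Y := fun _ ⟨x, hx, i, hi⟩ =>
  ⟨x, h hx, i, hi⟩

theorem infix_mem_wordsOf (h : u ++ (v ++ w) ∈ wordsOf X) : v ∈ wordsOf X := by
  obtain ⟨x, hx, i, hi⟩ := h
  exact ⟨x, hx, _, (occursAt_append.1 (occursAt_append.1 hi).2).1⟩

theorem IsSubshift.exists_occursAt (hX : IsSubshift X) (h : u ∈ wordsOf X) (i : ℤ) :
    ∃ x ∈ X, OccursAt x i u := by
  obtain ⟨x, hx, k, hk⟩ := h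
  exact ⟨seqShift (k - i) x, hX.seqShift_mem _ hx, by
    rwa [occursAt_seqShift, add_sub_cancel]⟩

theorem IsSubshift.near_of_mem_wordsOf (hY : IsSubshift Y)
    (h : wordAt s (i - n) (2 * n + 1) ∈ wordsOf Y) : Near Y n s i := by
  obtain ⟨y, hy, h⟩ := hY.exists_occursAt h (-n)
  refine ⟨y, hy, agree_iff_occursAt.2 ?_⟩
  rw [occursAt_iff, length_wordAt] at h
  rw [← h]
  exact occursAt_wordAt

end Occurrences

/-! ### Computability of languages, approach and recurrence -/

section Languages

variable {X Y : Set (ℤ → ℕ)} {x r : ℤ → ℕ} {K c : ℕ}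

theorem IsSubshift.exists_alphabet (hX : IsSubshift X) : ∃ K, ∀ x ∈ X, ∀ i, x i < K := by
  have h := hX.1.image (continuous_apply (0 : ℤ))
  obtain ⟨K, hK⟩ := (isCompact_iff_finite.1 h).bddAbove
  refine ⟨K + 1, fun x hx i => Nat.lt_succ_of_le (hK ⟨seqShift i x, hX.seqShift_mem i hx, ?_⟩)⟩
  simp [seqShift]

theorem mem_wordList_of_occursAt (hK : ∀ x ∈ X, ∀ i, x i < K) (hx : x ∈ X) {i : ℤ} {u : List ℕ}
    (h : OccursAt x i u) : u ∈ wordList K u.length := by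
  refine mem_wordList.2 ⟨rfl, fun a ha => ?_⟩
  obtain ⟨k, hk, rfl⟩ := List.getElem_of_mem ha
  rw [← h k hk]
  exact hK x hx _

theorem wordAt_mem_wordList (hK : ∀ x ∈ X, ∀ i, x i < K) (hx : x ∈ X) (i : ℤ) (n : ℕ) :
    wordAt x i n ∈ wordList K n := by
  have := mem_wordList_of_occursAt hK hx (occursAt_wordAt (x := x) (i := i) (n := n))
  rwa [length_wordAt] at this

/-- `F` consists of words of length `n` that do not occur in `Y`, and `Y` is the set of points of
`X` in which no word of `F` occurs. -/
structure ForbiddenWords (X Y : Set (ℤ → ℕ)) (n : ℕ) (F : List (List ℕ)) : Prop where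
  length_eq : ∀ f ∈ F, f.length = n
  notMem : ∀ f ∈ F, f ∉ wordsOf Y
  mem : ∀ x ∈ X, (∀ f ∈ F, ∀ i, ¬ OccursAt x i f) → x ∈ Y

/-- The points of `X` that look like `Y` everywhere at radius `n` form a subsystem, decreasing with
`n` to `Y`. Since there are finitely many subsystems, some radius already gives `Y`. -/
theorem exists_forbiddenWords (hX : IsSubshift X) (hfin : (subsystems X).Finite)
    (hY : Y ∈ subsystems X) : ∃ n F, ForbiddenWords X Y n F := by
  classical
  obtain ⟨K, hK⟩ := hX.exists_alphabet
  let Z : ℕ → Set (ℤ → ℕ) := fun n => {x | x ∈ X ∧ ∀ i, Near Y n x i}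
  have hZ (n : ℕ) : Z n ∈ subsystems X := by
    refine ⟨fun x hx => hx.1, hX.of_subset (fun x hx => hx.1) (fun z hz h => ⟨hz, fun i => ?_⟩)
      fun k y hy => ⟨hX.seqShift_mem k hy.1, fun i => ?_⟩⟩
    · obtain ⟨y, hy, hzy⟩ := h (n + i.natAbs)
      have := hzy.trans_near (hy.2 i) (by omega) (by omega)
      rwa [zero_add] at this
    · obtain ⟨z, hz, hyz⟩ := hy.2 (i + k)
      refine ⟨z, hz, fun j h1 h2 => ?_⟩
      rw [← hyz j h1 h2, seqShift, add_right_comm]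
  have hYZ (n : ℕ) : Y ⊆ Z n := fun y hy =>
    ⟨hY.1 hy, fun i => ⟨seqShift i y, hY.2.seqShift_mem i hy, Agree.refl n y i⟩⟩
  have : Finite (subsystems X) := hfin
  -- Pigeonhole: one subsystem `W` arises for infinitely many radii, so its points look like `Y` at
  -- every radius.
  obtain ⟨⟨W, hW⟩, hinf⟩ :=
    Finite.exists_infinite_fiber fun n => (⟨Z n, hZ n⟩ : subsystems X)
  rw [Set.infinite_coe_iff] at hinf
  obtain ⟨n, hn⟩ := hinf.nonempty
  have hnW : Z n = W := congrArg Subtype.val hn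
  have hWY : W ⊆ Y := fun x hx => hY.2.mem_of_agree fun k => by
    obtain ⟨m, hm, hkm⟩ := hinf.exists_gt k
    have hmW : Z m = W := congrArg Subtype.val hm
    exact ((hmW ▸ hx : x ∈ Z m).2 0).mono hkm.le
  refine ⟨2 * n + 1, (wordList K (2 * n + 1)).filter fun f => f ∉ wordsOf Y, fun f hf => ?_,
    fun f hf => ?_, fun x hx h => hWY (hnW ▸ ⟨hx, fun i => ?_⟩)⟩
  · exact (mem_wordList.1 (List.mem_filter.1 hf).1).1
  · simpa using (List.mem_filter.1 hf).2
  · refine hY.2.near_of_mem_wordsOf ?_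
    by_contra hne
    exact h _ (List.mem_filter.2 ⟨wordAt_mem_wordList hK hx (i - n) _, by simpa using hne⟩) _
      occursAt_wordAt

/-- Some word of `F` occurs in `w`. -/
def HasInfix (F : List (List ℕ)) (w : List ℕ) : Prop :=
  ∃ q : List ℕ × List ℕ × List ℕ, q.1 ∈ F ∧ w = q.2.1 ++ (q.1 ++ q.2.2)

theorem primrecPred_eq_append {α : Type*} [Primcodable α] {f g h k : α → List ℕ}
    (hf : Primrec f) (hg : Primrec g) (hh : Primrec h) (hk : Primrec k) :
    PrimrecPred fun a => f a = g a ++ (h a ++ k a) :=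
  Primrec.eq.comp hf (Primrec.list_append.comp hg (Primrec.list_append.comp hh hk))

theorem rePred_hasInfix (F : List (List ℕ)) : REPred (HasInfix F) := by
  refine REPred.exists (p := fun w (q : List ℕ × List ℕ × List ℕ) =>
    q.1 ∈ F ∧ w = q.2.1 ++ (q.1 ++ q.2.2)) (PrimrecPred.to_re (PrimrecPred.and ?_ ?_))
  · exact StarfreeExpr.primrecRel_mem.comp (Primrec.fst.comp Primrec.snd) (Primrec.const F)
  · exact primrecPred_eq_append Primrec.fst (Primrec.fst.comp (Primrec.snd.comp Primrec.snd))
      (Primrec.fst.comp Primrec.snd) (Primrec.snd.comp (Primrec.snd.comp Primrec.snd))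

/-- Compactness: admissible extensions of `u` of unbounded length would cluster at a point of `X`
that contains `u` and avoids `F`, hence at a point of `Y`. -/
theorem ForbiddenWords.exists_radius {n : ℕ} {F : List (List ℕ)} (hF : ForbiddenWords X Y n F)
    (hX : IsSubshift X) (u : List ℕ) (hu : u ∉ wordsOf Y) : ∃ m : ℕ, ∀ k, m ≤ k →
      ∀ a b : List ℕ, a.length = k → b.length = k →
        a ++ (u ++ b) ∉ wordsOf X ∨ HasInfix F (a ++ (u ++ b)) := by
  by_contra! h
  choose k hk a b ha hb hmem hno using h
  choose s hs hsu using fun m => hX.exists_occursAt (hmem m) (-(k m : ℤ))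
  obtain ⟨z, hz, hsz⟩ := hX.exists_cluster s hs
  refine hu (mem_wordsOf_of_occursAt (hF.mem z hz fun f hf i hi => ?_) (i := 0) (x := z) ?_)
  · obtain ⟨m, hm, h⟩ := hsz (i.natAbs + f.length) (i.natAbs + f.length)
    have hkm := hk m
    have h1 := hi.of_agree h (by omega) (by omega)
    refine hno m ⟨(f, wordAt (s m) (-k m) (i + k m).toNat,
      wordAt (s m) (i + f.length) (k m + u.length - i - f.length).toNat), hf, ?_⟩
    refine (hsu m).unique (occursAt_append.2 ⟨occursAt_wordAt, ?_⟩) ?_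
    · rw [length_wordAt, show -(k m : ℤ) + (i + k m).toNat = i by omega]
      exact occursAt_append.2 ⟨h1, occursAt_wordAt⟩
    · simp only [List.length_append, length_wordAt, ha, hb]
      omega
  · obtain ⟨m, hm, h⟩ := hsz u.length u.length
    have h1 := (occursAt_append.1 (occursAt_append.1 (hsu m)).2).1
    rw [ha, neg_add_cancel] at h1
    refine h1.of_agree (n := u.length) (fun j h2 h3 => ?_) (by omega) (by omega)
    have := h j h2 h3
    rw [zero_add] at this ⊢
    exact this.symm

theorem ForbiddenWords.not_hasInfix {n : ℕ} {F : List (List ℕ)} (hF : ForbiddenWords X Y n F)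
    {w : List ℕ} (hw : w ∈ wordsOf Y) : ¬ HasInfix F w := by
  rintro ⟨⟨f, a, b⟩, hf, rfl⟩
  exact hF.notMem f hf (infix_mem_wordsOf hw)

theorem rePred_forall_extension {Q : List ℕ → Prop} (hQ : REPred Q) (K : ℕ) :
    REPred fun x : List ℕ × ℕ => ∀ a ∈ wordList K x.2, ∀ b ∈ wordList K x.2,
      Q (a ++ (x.1 ++ b)) := by
  have hl : Computable fun x : List ℕ × ℕ => wordList K x.2 :=
    (primrec_wordList.comp (Primrec.const K) Primrec.snd).to_comp
  refine REPred.forall_mem (p := fun (x : List ℕ × ℕ) a => ∀ b ∈ wordList K x.2,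
    Q (a ++ (x.1 ++ b))) ?_ hl
  refine REPred.forall_mem (p := fun (x : (List ℕ × ℕ) × List ℕ) b => Q (x.2 ++ (x.1.1 ++ b)))
    (hQ.comp ?_) (hl.comp Computable.fst)
  exact (Primrec.list_append.comp (Primrec.snd.comp Primrec.fst) (Primrec.list_append.comp
    (Primrec.fst.comp (Primrec.fst.comp Primrec.fst)) Primrec.snd)).to_comp

/-- A word is outside the language of `Y` exactly if, for some `m`, each extension by `m` letters on
both sides is visibly outside `X` or contains a forbidden word. -/
theorem rePred_notMem_wordsOf (hX : IsSubshift X) (hPi : IsPiOne X)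
    (hfin : (subsystems X).Finite) (hY : Y ∈ subsystems X) : REPred fun u => u ∉ wordsOf Y := by
  obtain ⟨K, hK⟩ := hX.exists_alphabet
  obtain ⟨n, F, hF⟩ := exists_forbiddenWords hX hfin hY
  refine REPred.of_eq (REPred.exists (p := fun u (m : ℕ) => ∀ a ∈ wordList K m,
    ∀ b ∈ wordList K m, a ++ (u ++ b) ∉ wordsOf X ∨ HasInfix F (a ++ (u ++ b)))
    (rePred_forall_extension (REPred.or hPi (rePred_hasInfix F)) K)) fun u => ?_
  constructor
  · rintro ⟨m, hm⟩ ⟨y, hy, i, hi⟩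
    have h1 : OccursAt y (i - m) (wordAt y (i - m) m ++ (u ++ wordAt y (i + u.length) m)) := by
      refine occursAt_append.2 ⟨occursAt_wordAt, ?_⟩
      rw [length_wordAt, sub_add_cancel]
      exact occursAt_append.2 ⟨hi, occursAt_wordAt⟩
    rcases hm _ (wordAt_mem_wordList hK (hY.1 hy) (i - m) m) _
      (wordAt_mem_wordList hK (hY.1 hy) (i + u.length) m) with h | h
    · exact h (mem_wordsOf_of_occursAt (hY.1 hy) h1)
    · exact hF.not_hasInfix (mem_wordsOf_of_occursAt hy h1) h
  · intro hu
    obtain ⟨m, hm⟩ := hF.exists_radius hX u hu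
    exact ⟨m, fun a ha b hb => hm m le_rfl a b (mem_wordList.1 ha).1 (mem_wordList.1 hb).1⟩

/-- The central words of an isolated point form a recursively enumerable set. -/
theorem rePred_eq_wordAt (hX : IsSubshift X) (hPi : IsPiOne X)
    (hfin : (subsystems X).Finite) (hx : x ∈ X) (hcx : IsolatedBy c x) :
    REPred fun p : ℕ × List ℕ => p.2 = wordAt x (-p.1) (2 * p.1 + 1) := by
  obtain ⟨K, hK⟩ := hX.exists_alphabet
  have hY := orbitClosure_mem_subsystems hX hx
  have hQ : REPred fun z : (ℕ × List ℕ) × List ℕ × List ℕ =>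
      z.2.1 ++ (wordAt x (-c) (2 * c + 1) ++ z.2.2) ∉ wordsOf (orbitClosure x) ∨
      ∃ q : List ℕ × List ℕ, z.2.1 ++ (wordAt x (-c) (2 * c + 1) ++ z.2.2) =
        q.1 ++ (z.1.2 ++ q.2) ∧ q.1.length = c := by
    have happ : Primrec fun z : (ℕ × List ℕ) × List ℕ × List ℕ =>
        z.2.1 ++ (wordAt x (-c) (2 * c + 1) ++ z.2.2) :=
      Primrec.list_append.comp (Primrec.fst.comp Primrec.snd) (Primrec.list_append.comp
        (Primrec.const _) (Primrec.snd.comp Primrec.snd))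
    refine ((rePred_notMem_wordsOf hX hPi hfin hY).comp happ.to_comp).or ?_
    refine REPred.exists (p := fun (z : (ℕ × List ℕ) × List ℕ × List ℕ) (q : List ℕ × List ℕ) =>
      z.2.1 ++ (wordAt x (-c) (2 * c + 1) ++ z.2.2) = q.1 ++ (z.1.2 ++ q.2) ∧ q.1.length = c)
      (PrimrecPred.to_re (PrimrecPred.and ?_ ?_))
    · exact primrecPred_eq_append (happ.comp Primrec.fst) (Primrec.fst.comp Primrec.snd)
        (Primrec.snd.comp (Primrec.fst.comp Primrec.fst)) (Primrec.snd.comp Primrec.snd)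
    · exact Primrec.eq.comp (Primrec.list_length.comp (Primrec.fst.comp Primrec.snd))
        (Primrec.const c)
  have hl : Computable fun p : ℕ × List ℕ => wordList K p.1 :=
    (primrec_wordList.comp (Primrec.const K) Primrec.fst).to_comp
  -- By isolation, an extension of the central word of radius `c` by `m` letters on both sides that
  -- occurs in the orbit closure must be the central word of radius `m + c`; the one of radius `m`
  -- sits in it at offset `c`. All competing extensions are eventually refuted.
  have hall : REPred fun p : ℕ × List ℕ => ∀ a ∈ wordList K p.1, ∀ b ∈ wordList K p.1,
      a ++ (wordAt x (-c) (2 * c + 1) ++ b) ∉ wordsOf (orbitClosure x) ∨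
      ∃ q : List ℕ × List ℕ, a ++ (wordAt x (-c) (2 * c + 1) ++ b) = q.1 ++ (p.2 ++ q.2) ∧
        q.1.length = c := by
    refine REPred.forall_mem (p := fun (p : ℕ × List ℕ) a => ∀ b ∈ wordList K p.1,
      a ++ (wordAt x (-c) (2 * c + 1) ++ b) ∉ wordsOf (orbitClosure x) ∨
      ∃ q : List ℕ × List ℕ, a ++ (wordAt x (-c) (2 * c + 1) ++ b) = q.1 ++ (p.2 ++ q.2) ∧
        q.1.length = c) ?_ hl
    refine REPred.forall_mem (p := fun (z : (ℕ × List ℕ) × List ℕ) b =>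
      z.2 ++ (wordAt x (-c) (2 * c + 1) ++ b) ∉ wordsOf (orbitClosure x) ∨
      ∃ q : List ℕ × List ℕ, z.2 ++ (wordAt x (-c) (2 * c + 1) ++ b) = q.1 ++ (z.1.2 ++ q.2) ∧
        q.1.length = c) ?_ (hl.comp Computable.fst)
    exact hQ.comp (f := fun z : ((ℕ × List ℕ) × List ℕ) × List ℕ => (z.1.1, z.1.2, z.2))
      (Computable.pair (Computable.fst.comp Computable.fst)
        (Computable.pair (Computable.snd.comp Computable.fst) Computable.snd))
  have hlen : REPred fun p : ℕ × List ℕ => p.2.length = 2 * p.1 + 1 :=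
    PrimrecPred.to_re (Primrec.eq.comp (Primrec.list_length.comp Primrec.snd)
      (Primrec.nat_double_succ.comp Primrec.fst))
  refine (hlen.and hall).of_eq fun ⟨m, v⟩ => ?_
  constructor
  · rintro ⟨hv, h⟩
    have h1 : OccursAt x (-(m + c : ℕ))
        (wordAt x (-(m + c : ℕ)) m ++ (wordAt x (-c) (2 * c + 1) ++ wordAt x (c + 1) m)) := by
      refine occursAt_append.2 ⟨occursAt_wordAt, ?_⟩
      rw [length_wordAt, show -((m + c : ℕ) : ℤ) + m = -c by push_cast; ring]
      refine occursAt_append.2 ⟨occursAt_wordAt, ?_⟩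
      rw [length_wordAt, show -(c : ℤ) + (2 * c + 1 : ℕ) = c + 1 by push_cast; ring]
      exact occursAt_wordAt
    rcases h _ (wordAt_mem_wordList hK hx _ m) _ (wordAt_mem_wordList hK hx _ m) with
      h | ⟨⟨a, b⟩, hab, ha⟩
    · exact absurd (mem_wordsOf_of_occursAt (mem_orbitClosure_self x) h1) h
    · rw [hab] at h1
      have h2 := (occursAt_append.1 (occursAt_append.1 h1).2).1
      dsimp only at ha h2 hv
      rw [ha, show -((m + c : ℕ) : ℤ) + c = -m by push_cast; ring, occursAt_iff, hv] at h2
      exact h2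
  · intro hv
    dsimp only at hv ⊢
    subst hv
    refine ⟨length_wordAt, fun a ha b hb => ?_⟩
    by_cases hmem : a ++ (wordAt x (-c) (2 * c + 1) ++ b) ∈ wordsOf (orbitClosure x)
    swap
    · exact Or.inl hmem
    right
    obtain ⟨y, hy, hyo⟩ := hY.2.exists_occursAt hmem (-(m + c : ℕ))
    have hm := (mem_wordList.1 ha).1
    have hm' := (mem_wordList.1 hb).1
    have h1 := (occursAt_append.1 (occursAt_append.1 hyo).2).1
    rw [hm, show -((m + c : ℕ) : ℤ) + m = 0 - c by push_cast; ring, ← agree_iff_occursAt] at h1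
    obtain rfl := hcx y hy h1
    refine ⟨(wordAt y (-(m + c : ℕ)) c, wordAt y (m + 1) c), ?_, length_wordAt⟩
    refine hyo.unique (occursAt_append.2 ⟨occursAt_wordAt, ?_⟩) ?_
    · rw [length_wordAt, show -((m + c : ℕ) : ℤ) + c = -m by push_cast; ring]
      refine occursAt_append.2 ⟨occursAt_wordAt, ?_⟩
      rw [length_wordAt, show -(m : ℤ) + (2 * m + 1 : ℕ) = m + 1 by push_cast; ring]
      exact occursAt_wordAt
    · simp only [List.length_append, length_wordAt, hm, hm']
      omega

/-- Every word of the orbit closure occurs in `x` itself, hence in some central word of `x`, and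
these can be enumerated. -/
theorem rePred_mem_wordsOf_orbitClosure (hX : IsSubshift X) (hPi : IsPiOne X)
    (hfin : (subsystems X).Finite) (hx : x ∈ X) (hcx : IsolatedBy c x) :
    REPred fun u => u ∈ wordsOf (orbitClosure x) := by
  have h : REPred fun u => ∃ q : ℕ × List ℕ × List ℕ,
      q.2.1 ++ (u ++ q.2.2) = wordAt x (-q.1) (2 * q.1 + 1) := by
    refine REPred.exists (p := fun u (q : ℕ × List ℕ × List ℕ) =>
      q.2.1 ++ (u ++ q.2.2) = wordAt x (-q.1) (2 * q.1 + 1)) ?_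
    refine (rePred_eq_wordAt hX hPi hfin hx hcx).comp
      (f := fun z : List ℕ × ℕ × List ℕ × List ℕ => (z.2.1, z.2.2.1 ++ (z.1 ++ z.2.2.2))) ?_
    exact (Primrec.pair (Primrec.fst.comp Primrec.snd) (Primrec.list_append.comp
      (Primrec.fst.comp (Primrec.snd.comp Primrec.snd)) (Primrec.list_append.comp Primrec.fst
        (Primrec.snd.comp (Primrec.snd.comp Primrec.snd))))).to_comp
  refine h.of_eq fun u => ?_
  constructor
  · rintro ⟨⟨m, a, b⟩, hab⟩
    refine infix_mem_wordsOf (u := a) (w := b) ?_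
    dsimp only at hab
    rw [hab]
    exact mem_wordsOf_of_occursAt (mem_orbitClosure_self x) occursAt_wordAt
  · rintro ⟨y, hy, i, hi⟩
    obtain ⟨k, hk⟩ := hy (i.natAbs + u.length)
    have hu : OccursAt x (k + i) u := fun j hj => by
      rw [← hi j hj, ← hk (i + j) (by omega) (by omega), add_assoc]
    obtain ⟨m, h1, h2⟩ : ∃ m : ℕ, -(m : ℤ) ≤ k + i ∧ k + i + u.length ≤ m + 1 :=
      ⟨(k + i).natAbs + u.length, by omega, by omega⟩
    refine ⟨(m, wordAt x (-m) (k + i + m).toNat,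
      wordAt x (k + i + u.length) (m + 1 - (k + i + u.length)).toNat), ?_⟩
    refine OccursAt.unique (x := x) (i := -m) (occursAt_append.2 ⟨occursAt_wordAt, ?_⟩)
      occursAt_wordAt ?_
    · rw [length_wordAt, Int.toNat_of_nonneg (by omega), show -(m : ℤ) + (k + i + m) = k + i by ring]
      exact occursAt_append.2 ⟨hu, occursAt_wordAt⟩
    · simp only [List.length_append, length_wordAt]
      omega

/-- `X` is the union of finitely many orbit closures, so finitely many enumerations suffice. -/
theorem rePred_mem_wordsOf (hX : IsSubshift X) (hPi : IsPiOne X) (hc : X.Countable)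
    (hfin : (subsystems X).Finite) : REPred fun u => u ∈ wordsOf X := by
  have hfin' : (orbitClosure '' X).Finite := hfin.subset (by
    rintro _ ⟨y, hy, rfl⟩
    exact orbitClosure_mem_subsystems hX hy)
  have h (S : Set (Set (ℤ → ℕ))) (hS : S.Finite) (hSX : S ⊆ orbitClosure '' X) :
      REPred fun u => ∃ Y ∈ S, u ∈ wordsOf Y := by
    induction S, hS using Set.Finite.induction_on with
    | empty => exact (REPred.const False).of_eq fun u => by simp
    | insert _ _ ih =>
      obtain ⟨x, hx, rfl⟩ := hSX (Set.mem_insert _ _)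
      obtain ⟨c, hcx⟩ := hX.exists_isolatedBy hc hx
      exact ((rePred_mem_wordsOf_orbitClosure hX hPi hfin hx hcx).or
        (ih ((Set.subset_insert _ _).trans hSX))).of_eq fun u => by simp
  refine (h _ hfin' subset_rfl).of_eq fun u => ?_
  constructor
  · rintro ⟨_, ⟨x, hx, rfl⟩, hu⟩
    exact wordsOf_mono (hX.orbitClosure_subset hx) hu
  · rintro ⟨x, hx, i, hi⟩
    exact ⟨_, ⟨x, hx, rfl⟩, x, mem_orbitClosure_self x, i, hi⟩

/-- Far out, `x` contains no forbidden word for the orbit closure of `r`. A search finds an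
extension length `k n` at which every word of length `2 * n + 1` either is confirmed in that
language or has only inadmissible extensions; windows of `x` with room for such extensions fall
under the first case. -/
theorem tendsTo_of_limitSet_eq (hX : IsSubshift X) (hPi : IsPiOne X) (hc : X.Countable)
    (hfin : (subsystems X).Finite) (hx : x ∈ X) (hr : r ∈ X) {ε : ℤ} (hε : ε = 1 ∨ ε = -1)
    (h : limitSet ε x = orbitClosure r) : TendsTo ε x (orbitClosure r) := by
  obtain ⟨K, hK⟩ := hX.exists_alphabet
  have hY := orbitClosure_mem_subsystems hX hr
  obtain ⟨n₀, F, hF⟩ := exists_forbiddenWords hX hfin hY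
  obtain ⟨c, hcr⟩ := hX.exists_isolatedBy hc hr
  obtain ⟨m₀, hm₀⟩ := hX.exists_near_limitSet hx ε n₀
  rw [h] at hm₀
  have hre : REPred fun z : ℕ × ℕ => ∀ v ∈ wordList K (2 * z.1 + 1),
      (∀ a ∈ wordList K z.2, ∀ b ∈ wordList K z.2, a ++ (v ++ b) ∉ wordsOf X ∨
        HasInfix F (a ++ (v ++ b))) ∨ v ∈ wordsOf (orbitClosure r) := by
    refine REPred.forall_mem (p := fun (z : ℕ × ℕ) v =>
      (∀ a ∈ wordList K z.2, ∀ b ∈ wordList K z.2, a ++ (v ++ b) ∉ wordsOf X ∨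
        HasInfix F (a ++ (v ++ b))) ∨ v ∈ wordsOf (orbitClosure r)) (REPred.or ?_ ?_)
      (primrec_wordList.comp (Primrec.const K)
        (Primrec.nat_double_succ.comp Primrec.fst)).to_comp
    · exact (rePred_forall_extension (REPred.or hPi (rePred_hasInfix F)) K).comp
        (f := fun z : (ℕ × ℕ) × List ℕ => (z.2, z.1.2))
        (Computable.pair Computable.snd (Computable.snd.comp Computable.fst))
    · exact (rePred_mem_wordsOf_orbitClosure hX hPi hfin hr hcr).comp Computable.snd
  obtain ⟨k, hk, hkv⟩ := REPred.exists_computable_choice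
    (p := fun n k => ∀ v ∈ wordList K (2 * n + 1),
      (∀ a ∈ wordList K k, ∀ b ∈ wordList K k, a ++ (v ++ b) ∉ wordsOf X ∨
        HasInfix F (a ++ (v ++ b))) ∨ v ∈ wordsOf (orbitClosure r)) hre fun n => by
    have h1 (L : List (List ℕ)) : ∃ m : ℕ, ∀ k, m ≤ k → ∀ v ∈ L, (∀ a ∈ wordList K k,
        ∀ b ∈ wordList K k, a ++ (v ++ b) ∉ wordsOf X ∨ HasInfix F (a ++ (v ++ b))) ∨
          v ∈ wordsOf (orbitClosure r) := by
      induction L with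
      | nil => exact ⟨0, by simp⟩
      | cons v L ih =>
        obtain ⟨m, hm⟩ := ih
        by_cases hv : v ∈ wordsOf (orbitClosure r)
        · exact ⟨m, fun k hk => List.forall_mem_cons.2 ⟨Or.inr hv, hm k hk⟩⟩
        · obtain ⟨m', hm'⟩ := hF.exists_radius hX v hv
          exact ⟨max m m', fun k hk => List.forall_mem_cons.2
            ⟨Or.inl fun a ha b hb => hm' k (by omega) a b (mem_wordList.1 ha).1
              (mem_wordList.1 hb).1, hm k (by omega)⟩⟩
    obtain ⟨m, hm⟩ := h1 (wordList K (2 * n + 1))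
    exact ⟨m, hm m le_rfl⟩
  -- From here on, each forbidden word found in the window of radius `n + k n` would start at
  -- distance at least `m₀`, where `x` is near the orbit closure of `r` at radius `n₀`.
  refine ⟨fun n => m₀ + n + k n + (n₀ + 1),
    (((Computable.const m₀).nat_add .id).nat_add hk).nat_add (.const (n₀ + 1)), fun n i hi => ?_⟩
  dsimp only at hi
  refine hY.2.near_of_mem_wordsOf ?_
  have hw : OccursAt x (ε * i - n - k n) (wordAt x (ε * i - n - k n) (k n) ++
      (wordAt x (ε * i - n) (2 * n + 1) ++ wordAt x (ε * i + n + 1) (k n))) := by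
    refine occursAt_append.2 ⟨occursAt_wordAt, ?_⟩
    rw [length_wordAt, sub_add_cancel]
    refine occursAt_append.2 ⟨occursAt_wordAt, ?_⟩
    rw [length_wordAt, show ε * i - n + (2 * n + 1 : ℕ) = ε * i + n + 1 by push_cast; ring]
    exact occursAt_wordAt
  refine (hkv n _ (wordAt_mem_wordList hK hx _ _)).resolve_left fun h1 => ?_
  rcases h1 _ (wordAt_mem_wordList hK hx (ε * i - n - k n) _) _
    (wordAt_mem_wordList hK hx (ε * i + n + 1) _) with h2 | ⟨⟨f, a, b⟩, hf, hab⟩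
  · exact h2 (mem_wordsOf_of_occursAt hx hw)
  · have hlen := congrArg List.length hab
    rw [hab] at hw
    simp only [List.length_append, length_wordAt] at hlen
    have hfo := (occursAt_append.1 (occursAt_append.1 hw).2).1
    refine hF.notMem f hf ?_
    have hn := hF.length_eq f hf
    obtain ⟨y, hy, hxy⟩ := hm₀ (ε * (ε * i - n - k n + a.length)).toNat (by
      rcases hε with rfl | rfl <;> omega)
    rw [Int.toNat_of_nonneg (by rcases hε with rfl | rfl <;> omega), ← mul_assoc,
      show ε * ε = 1 by rcases hε with rfl | rfl <;> rfl, one_mul] at hxy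
    refine mem_wordsOf_of_occursAt hy (i := 0) fun j hj => ?_
    rw [zero_add, ← hfo j hj, ← hxy j (by omega) (by omega)]

/-- Central words of `x` can be enumerated and `r` is a limit point, so a search for an occurrence
beyond `m` succeeds. -/
theorem recurs_of_limitSet_eq (hX : IsSubshift X) (hPi : IsPiOne X) (hc : X.Countable)
    (hfin : (subsystems X).Finite) (hx : x ∈ X) {ε : ℤ} (hε : ε = 1 ∨ ε = -1)
    (h : limitSet ε x = orbitClosure r) (c : ℕ) : Recurs ε c x r := by
  obtain ⟨cx, hcx⟩ := hX.exists_isolatedBy hc hx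
  -- The occurrence starts at `ε * d - c` and the central word of radius `d + c` starts at `-(d +
  -- c)`; the offset is `d + ε * d`.
  have hoff : Primrec fun d : ℕ => (d + ε * d).toNat := by
    rcases hε with rfl | rfl
    · exact Primrec.nat_double.of_eq fun d => by omega
    · exact (Primrec.const 0).of_eq fun d => by omega
  have hiff (d : ℕ) : Agree c x (ε * d) r ↔ ∃ q : List ℕ × List ℕ,
      q.1 ++ (wordAt r (-c) (2 * c + 1) ++ q.2) = wordAt x (-(d + c : ℕ)) (2 * (d + c) + 1) ∧
        q.1.length = (d + ε * d).toNat := by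
    have h0 : 0 ≤ d + ε * d ∧ d + ε * d ≤ 2 * d := by rcases hε with rfl | rfl <;> omega
    rw [agree_iff_occursAt]
    constructor
    · intro ho
      refine ⟨(wordAt x (-(d + c : ℕ)) (d + ε * d).toNat,
        wordAt x (ε * d + c + 1) (d - ε * d).toNat), OccursAt.unique (x := x)
          (i := -(d + c : ℕ)) (occursAt_append.2 ⟨occursAt_wordAt, occursAt_append.2 ⟨?_, ?_⟩⟩)
          occursAt_wordAt ?_, length_wordAt⟩
      · convert ho using 1
        rw [length_wordAt]
        omega
      · rw [length_wordAt, length_wordAt, show -((d + c : ℕ) : ℤ) + (d + ε * d).toNat +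
          (2 * c + 1 : ℕ) = ε * d + c + 1 by omega]
        exact occursAt_wordAt
      · simp only [List.length_append, length_wordAt]
        omega
    · rintro ⟨⟨a, b⟩, hab, ha⟩
      have ho : OccursAt x (-(d + c : ℕ)) (wordAt x (-(d + c : ℕ)) (2 * (d + c) + 1)) :=
        occursAt_wordAt
      rw [← hab] at ho
      convert (occursAt_append.1 (occursAt_append.1 ho).2).1 using 1
      dsimp only at ha ⊢
      omega
  have hre : REPred fun z : ℕ × ℕ => z.1 ≤ z.2 ∧ Agree c x (ε * z.2) r := by
    refine (PrimrecPred.to_re (Primrec.nat_le.comp Primrec.fst Primrec.snd)).and ?_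
    have : REPred fun d : ℕ => Agree c x (ε * d) r := by
      refine REPred.of_eq (REPred.exists (p := fun (d : ℕ) (q : List ℕ × List ℕ) =>
        q.1 ++ (wordAt r (-c) (2 * c + 1) ++ q.2) = wordAt x (-(d + c : ℕ)) (2 * (d + c) + 1) ∧
          q.1.length = (d + ε * d).toNat) (REPred.and ?_ ?_)) fun d => (hiff d).symm
      · refine (rePred_eq_wordAt hX hPi hfin hx hcx).comp (f := fun z : ℕ × List ℕ × List ℕ =>
          (z.1 + c, z.2.1 ++ (wordAt r (-c) (2 * c + 1) ++ z.2.2))) ?_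
        exact (Primrec.pair (Primrec.nat_add.comp Primrec.fst (Primrec.const c))
          (Primrec.list_append.comp (Primrec.fst.comp Primrec.snd) (Primrec.list_append.comp
            (Primrec.const _) (Primrec.snd.comp Primrec.snd)))).to_comp
      · exact PrimrecPred.to_re (Primrec.eq.comp
          (Primrec.list_length.comp (Primrec.fst.comp Primrec.snd)) (hoff.comp Primrec.fst))
    exact this.comp Computable.snd
  obtain ⟨d, hd, hdm⟩ := REPred.exists_computable_choice
    (p := fun m d : ℕ => m ≤ d ∧ Agree c x (ε * d) r) hre fun m =>
      (h ▸ mem_orbitClosure_self r : r ∈ limitSet ε x) c m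
  exact ⟨_, Computable.succ.comp hd, fun m => ⟨d m, (hdm m).1, Nat.lt_succ_self _, (hdm m).2⟩⟩

end Languages

/-! ### The decision procedure -/

section ModelChecking

open StarfreeExpr

variable {X : Set (ℤ → ℕ)} {P : List (List (List ℕ))} {C : List (List ℕ)} {x : ℤ → ℕ} {t : ℕ}
  {v w : List ℕ}

/-- Points with equal orbit closures have the same finite patterns, so one bound per orbit closure
suffices. There are finitely many of these, and their bounds are added. -/
theorem exists_computable_bound_of_encard_le (hX : IsSubshift X) (hPi : IsPiOne X)
    (hc : X.Countable) (hQ : (subsystems X).encard ≤ (5 : ℕ)) :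
    ∃ M : ℕ → ℕ, Computable M ∧ ∀ t f, IsLocal t f → ∀ x ∈ X, ∀ a b : ℤ, ∃ y ∈ X,
      ∃ a' b' : ℤ, a' ≤ b' ∧ b' - a' ≤ M t ∧
        WordSim t t (codedWord f x a b) (codedWord f y a' b') := by
  have hfin := Set.finite_of_encard_le_coe hQ
  have hfin' : (orbitClosure '' X).Finite := hfin.subset (by
    rintro _ ⟨y, hy, rfl⟩
    exact orbitClosure_mem_subsystems hX hy)
  have h1 (y) (hy : y ∈ X) : ∃ M : ℕ → ℕ, Computable M ∧ ∀ t f, IsLocal t f → ∀ a b : ℤ,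
      ∃ a' b' : ℤ, a' ≤ b' ∧ b' - a' ≤ M t ∧
        WordSim t t (codedWord f y a b) (codedWord f y a' b') := by
    have h2 {ε : ℤ} (hε : ε = 1 ∨ ε = -1) := exists_hasUniformReturns hX hc hQ
      (fun x hx r hr ε hε h => tendsTo_of_limitSet_eq hX hPi hc hfin hx hr hε h)
      (fun x hx r _ ε hε h c => recurs_of_limitSet_eq hX hPi hc hfin hx hε h c) hy hε
    obtain ⟨r, hr, hlim, c, -, hret⟩ := h2 (Or.inl rfl)
    obtain ⟨l, hl, hlim', c', -, hret'⟩ := h2 (Or.inr rfl)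
    exact exists_computable_bound (tendsTo_of_limitSet_eq hX hPi hc hfin hy hr (Or.inl rfl) hlim)
      (recurs_of_limitSet_eq hX hPi hc hfin hy (Or.inl rfl) hlim c) hret
      (tendsTo_of_limitSet_eq hX hPi hc hfin hy hl (Or.inr rfl) hlim')
      (recurs_of_limitSet_eq hX hPi hc hfin hy (Or.inr rfl) hlim' c') hret'
  have h (S : Set (Set (ℤ → ℕ))) (hS : S.Finite) (hSX : S ⊆ orbitClosure '' X) :
      ∃ M : ℕ → ℕ, Computable M ∧ ∀ t f, IsLocal t f → ∀ x ∈ X, orbitClosure x ∈ S →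
        ∀ a b : ℤ, ∃ y ∈ X, ∃ a' b' : ℤ, a' ≤ b' ∧ b' - a' ≤ M t ∧
          WordSim t t (codedWord f x a b) (codedWord f y a' b') := by
    induction S, hS using Set.Finite.induction_on with
    | empty => exact ⟨fun _ => 0, Computable.const 0, fun _ _ _ _ _ h => absurd h (by simp)⟩
    | insert _ _ ih =>
      obtain ⟨y, hy, rfl⟩ := hSX (Set.mem_insert _ _)
      obtain ⟨M, hM, hMt⟩ := ih ((Set.subset_insert _ _).trans hSX)
      obtain ⟨N, hN, hNt⟩ := h1 y hy
      refine ⟨_, hM.nat_add hN, fun t f hf x hx hxS a b => ?_⟩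
      rcases hxS with hxy | hxS
      · obtain ⟨i, hi⟩ := (hxy ▸ mem_orbitClosure_self x : x ∈ orbitClosure y)
          (t + a.natAbs + b.natAbs)
        obtain ⟨a', b', h0, h1, h2⟩ := hNt t f hf (i + a) (i + b)
        rw [codedWord_eq_of_agree hf hi (by omega) (by omega)] at h2
        exact ⟨y, hy, a', b', h0, by push_cast; omega, h2⟩
      · obtain ⟨z, hz, a', b', h0, h1, h2⟩ := hMt t f hf x hx hxS a b
        exact ⟨z, hz, a', b', h0, by push_cast; omega, h2⟩
  obtain ⟨M, hM, hMt⟩ := h _ hfin' subset_rfl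
  exact ⟨M, hM, fun t f hf x hx => hMt t f hf x hx ⟨x, hx, rfl⟩⟩

/-- Some word of `C` occurs in the word `v` at position `i`. -/
def MatchesAt (C : List (List ℕ)) (v : List ℕ) (i : ℕ) : Prop :=
  ∃ u ∈ C, (v.drop i).take u.length = u

theorem primrecPred_matchesAt {α : Type*} [Primcodable α] {f : α → List (List ℕ)}
    {g : α → List ℕ} {h : α → ℕ} (hf : Primrec f) (hg : Primrec g) (hh : Primrec h) :
    PrimrecPred fun a => MatchesAt (f a) (g a) (h a) := by
  have h1 : PrimrecRel fun (u : List ℕ) (z : List ℕ × ℕ) => (z.1.drop z.2).take u.length = u :=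
    Primrec.eq.comp (Primrec.list_take.comp (Primrec.list_length.comp Primrec.fst)
      (Primrec.list_drop.comp (Primrec.snd.comp Primrec.snd)
        (Primrec.fst.comp Primrec.snd))) Primrec.fst
  exact h1.exists_mem_list.comp hf (Primrec.pair hg hh)

theorem matchesAt_wordAt {a : ℤ} {n i : ℕ} (hC : ∀ u ∈ C, u.length ≤ t) (hi : i + t ≤ n) :
    MatchesAt C (wordAt x a n) i ↔ seqShift (a + i) x ∈ clopenOf C := by
  refine exists_congr fun u => and_congr_right fun hu => ?_
  have := hC u hu
  rw [occursAt_seqShift, occursAt_iff, zero_add, eq_comm]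
  suffices ((wordAt x a n).drop i).take u.length = wordAt x (a + i) u.length by rw [this]
  refine List.ext_getElem (by simp [length_wordAt]; omega) fun k h1 h2 => ?_
  simp [wordAt, add_assoc]

/-- In the word `v`, the parts of `P` are visited in the order given by the word `w`. -/
def Visits (P : List (List (List ℕ))) (w v : List ℕ) : Prop :=
  ∀ i ∈ List.range w.length, MatchesAt (P.getD (w.getD i 0) []) v i

theorem primrecPred_visits {α : Type*} [Primcodable α] {f : α → List (List (List ℕ))}
    {g h : α → List ℕ} (hf : Primrec f) (hg : Primrec g) (hh : Primrec h) :
    PrimrecPred fun a => Visits (f a) (g a) (h a) := by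
  have h1 : PrimrecRel fun (i : ℕ) (z : List (List (List ℕ)) × List ℕ × List ℕ) =>
      MatchesAt (z.1.getD (z.2.1.getD i 0) []) z.2.2 i :=
    primrecPred_matchesAt ((Primrec.list_getD []).comp (Primrec.fst.comp Primrec.snd)
      ((Primrec.list_getD 0).comp (Primrec.fst.comp (Primrec.snd.comp Primrec.snd)) Primrec.fst))
      (Primrec.snd.comp (Primrec.snd.comp Primrec.snd)) Primrec.fst
  exact h1.forall_mem_list.comp (Primrec.list_range.comp (Primrec.list_length.comp hg))
    (Primrec.pair hf (Primrec.pair hg hh))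

/-- The word `v` begins with a word of exactly one part of `P`. -/
def MatchesUnique (P : List (List (List ℕ))) (v : List ℕ) : Prop :=
  ∃ j ∈ List.range P.length, MatchesAt (P.getD j []) v 0 ∧
    ∀ k ∈ List.range P.length, ¬ MatchesAt (P.getD k []) v 0 ∨ k = j

theorem primrecPred_matchesUnique {α : Type*} [Primcodable α] {f : α → List (List (List ℕ))}
    {g : α → List ℕ} (hf : Primrec f) (hg : Primrec g) :
    PrimrecPred fun a => MatchesUnique (f a) (g a) := by
  have h1 {β : Type _} [Primcodable β] {i : β → ℕ} {p : β → List (List (List ℕ)) × List ℕ}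
      (hi : Primrec i) (hp : Primrec p) :
      PrimrecPred fun b => MatchesAt ((p b).1.getD (i b) []) (p b).2 0 :=
    primrecPred_matchesAt ((Primrec.list_getD []).comp (Primrec.fst.comp hp) hi)
      (Primrec.snd.comp hp) (Primrec.const 0)
  have h2 : PrimrecRel fun (k : ℕ) (z : ℕ × List (List (List ℕ)) × List ℕ) =>
      ¬ MatchesAt (z.2.1.getD k []) z.2.2 0 ∨ k = z.1 :=
    (h1 Primrec.fst (Primrec.snd.comp Primrec.snd)).not.or
      (Primrec.eq.comp Primrec.fst (Primrec.fst.comp Primrec.snd))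
  have h3 : PrimrecRel fun (j : ℕ) (z : List (List (List ℕ)) × List ℕ) =>
      MatchesAt (z.1.getD j []) z.2 0 ∧
        ∀ k ∈ List.range z.1.length, ¬ MatchesAt (z.1.getD k []) z.2 0 ∨ k = j :=
    (h1 Primrec.fst Primrec.snd).and (h2.forall_mem_list.comp (Primrec.list_range.comp
      (Primrec.list_length.comp (Primrec.fst.comp Primrec.snd))) Primrec.id)
  exact h3.exists_mem_list.comp (Primrec.list_range.comp (Primrec.list_length.comp hf))
    (Primrec.pair hf hg)

/-- The code of `P` serves as a computable bound for the window that decides membership in its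
parts. -/
theorem length_le_encode_of_mem {u : List ℕ} (hC : C ∈ P) (hu : u ∈ C) :
    u.length ≤ Encodable.encode P :=
  (Encodable.length_le_encode u).trans ((List.encode_le_encode_of_mem hu).trans
    (List.encode_le_encode_of_mem hC))

theorem length_le_encode_of_mem_getD {j : ℕ} {u : List ℕ} (hu : u ∈ P.getD j []) :
    u.length ≤ Encodable.encode P := by
  by_cases hj : j < P.length
  · rw [List.getD_eq_getElem _ _ hj] at hu
    exact length_le_encode_of_mem (List.getElem_mem hj) hu
  · rw [List.getD_eq_default _ _ (not_lt.1 hj)] at hu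
    simp at hu

theorem lt_length_of_mem_clopenOf {j : ℕ} (h : x ∈ clopenOf (P.getD j [])) : j < P.length := by
  by_contra hj
  rw [List.getD_eq_default _ _ (not_lt.1 hj)] at h
  obtain ⟨u, hu, -⟩ := h
  simp at hu

theorem visits_wordAt {a : ℤ} :
    Visits P w (wordAt x a (w.length + Encodable.encode P)) ↔
      ∀ i < w.length, seqShift (a + i) x ∈ clopenOf (P.getD (w.getD i 0) []) := by
  refine forall_congr' fun i => ?_
  rw [List.mem_range]
  exact forall_congr' fun hi => matchesAt_wordAt
    (fun u hu => length_le_encode_of_mem_getD hu) (by omega)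

theorem shiftMap_iterate (i : ℕ) (x : ℤ → ℕ) : shiftMap^[i] x = seqShift i x := by
  induction i generalizing x with
  | zero => exact (seqShift_zero x).symm
  | succ i ih =>
    rw [Function.iterate_succ_apply, ih, shiftMap_eq, seqShift_seqShift]
    push_cast
    ring_nf

theorem hasTrace_iff {L : Set (List ℕ)} : HasTrace X P L ↔ ∃ w ∈ L, ∃ x ∈ X, ∀ i < w.length,
    seqShift i x ∈ clopenOf (P.getD (w.getD i 0) []) := by
  refine exists_congr fun w => and_congr_right fun _ => exists_congr fun x =>
    and_congr_right fun _ => forall_congr' fun i => forall_congr' fun hi => ?_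
  rw [shiftMap_iterate, List.getD_eq_getElem _ _ hi]
  constructor
  · rintro ⟨hj, h⟩
    rwa [List.getD_eq_getElem _ _ hj]
  · intro h
    have hj := lt_length_of_mem_clopenOf h
    rw [List.getD_eq_getElem _ _ hj] at h
    exact ⟨hj, h⟩

theorem IsSubshift.hasTrace_iff_exists_visits (hX : IsSubshift X) {L : Set (List ℕ)} :
    HasTrace X P L ↔ ∃ w ∈ L, ∃ v ∈ wordsOf X, v.length = w.length + Encodable.encode P ∧
      Visits P w v := by
  rw [hasTrace_iff]
  refine exists_congr fun w => and_congr_right fun _ => ?_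
  constructor
  · rintro ⟨x, hx, h⟩
    exact ⟨wordAt x 0 (w.length + Encodable.encode P), mem_wordsOf_of_occursAt hx occursAt_wordAt,
      length_wordAt, visits_wordAt.2 (by simpa using h)⟩
  · rintro ⟨v, hv, hlen, h⟩
    obtain ⟨x, hx, hxv⟩ := hX.exists_occursAt hv 0
    rw [occursAt_iff.1 hxv, hlen, visits_wordAt] at h
    exact ⟨x, hx, by simpa using h⟩

theorem IsSubshift.isClopenPartition_iff (hX : IsSubshift X) : IsClopenPartition X P ↔
    ∀ v ∈ wordsOf X, v.length = Encodable.encode P → MatchesUnique P v := by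
  have h1 (x : ℤ → ℕ) : (∃! j : Fin P.length, x ∈ clopenOf (P.get j)) ↔
      MatchesUnique P (wordAt x 0 (Encodable.encode P)) := by
    have h2 (j : ℕ) : MatchesAt (P.getD j []) (wordAt x 0 (Encodable.encode P)) 0 ↔
        x ∈ clopenOf (P.getD j []) := by
      rw [matchesAt_wordAt (fun u hu => length_le_encode_of_mem_getD hu) (zero_add _).le,
        Nat.cast_zero, add_zero, seqShift_zero]
    simp only [MatchesUnique, h2, List.mem_range]
    constructor
    · rintro ⟨⟨j, hj⟩, hxj, huniq⟩
      refine ⟨j, hj, by simpa [hj] using hxj, fun k hk => not_or_of_imp fun hxk => ?_⟩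
      exact congrArg Fin.val (huniq ⟨k, hk⟩ (by simpa [hk] using hxk))
    · rintro ⟨j, hj, hxj, huniq⟩
      refine ⟨⟨j, hj⟩, by simpa [hj] using hxj, fun k hk => Fin.ext ?_⟩
      exact (huniq k k.2).resolve_left (not_not.2 (by simpa using hk))
  constructor
  · intro h v hv hlen
    obtain ⟨x, hx, hxv⟩ := hX.exists_occursAt hv 0
    rw [occursAt_iff.1 hxv, hlen, ← h1]
    exact h x hx
  · exact fun h x hx => (h1 x).2
      (h _ (mem_wordsOf_of_occursAt hx occursAt_wordAt) length_wordAt)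

/-- The first part of `P` that contains a given point. -/
noncomputable def partIndex (P : List (List (List ℕ))) (x : ℤ → ℕ) : ℕ :=
  sInf {j | x ∈ clopenOf (P.getD j [])}

theorem isLocal_partIndex (ht : Encodable.encode P ≤ t) : IsLocal t (partIndex P) := by
  intro x y h
  refine congrArg sInf (Set.ext fun j => exists_congr fun u => and_congr_right fun hu => ?_)
  have := length_le_encode_of_mem_getD hu
  refine forall_congr' fun k => forall_congr' fun hk => ?_
  rw [h (0 + k) (by omega) (by omega)]

theorem IsClopenPartition.mem_iff (hP : IsClopenPartition X P) (hx : x ∈ X) {j : ℕ} :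
    x ∈ clopenOf (P.getD j []) ↔ partIndex P x = j := by
  obtain ⟨k, hk, huniq⟩ := hP x hx
  have h1 (i : ℕ) (hi : x ∈ clopenOf (P.getD i [])) : i = k := by
    have hlt := lt_length_of_mem_clopenOf hi
    exact congrArg Fin.val (huniq ⟨i, hlt⟩ (by simpa [hlt] using hi))
  have h2 : x ∈ clopenOf (P.getD (partIndex P x) []) :=
    Nat.sInf_mem (s := {j | x ∈ clopenOf (P.getD j [])}) ⟨k, by simpa using hk⟩
  exact ⟨fun h => (h1 _ h2).trans (h1 _ h).symm, fun h => h ▸ h2⟩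

/-- For a partition, the only word of given length traced from a point is its itinerary, which is
the word produced by the local code `partIndex P`. -/
theorem IsClopenPartition.forall_mem_iff (hX : IsSubshift X) (hP : IsClopenPartition X P)
    (hx : x ∈ X) {a : ℤ} : (∀ i < w.length, seqShift (a + i) x ∈ clopenOf
      (P.getD (w.getD i 0) [])) ↔ w = codedWord (partIndex P) x a (a + w.length) := by
  have h1 : w = codedWord (partIndex P) x a (a + w.length) ↔
      ∀ i < w.length, partIndex P (seqShift (a + i) x) = w.getD i 0 := by
    constructor
    · intro h i hi
      have := congrArg (fun l : List ℕ => l.getD i 0) h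
      simpa [codedWord, hi, eq_comm] using this
    · intro h
      refine List.ext_getElem (by simp [codedWord]) fun i hi _ => ?_
      rw [← List.getD_eq_getElem _ 0 hi, ← h i hi]
      simp [codedWord]
  rw [h1]
  exact forall_congr' fun i => forall_congr' fun _ => hP.mem_iff (hX.seqShift_mem _ hx)

theorem IsClopenPartition.codedWord_mem_wordsOver (hX : IsSubshift X) (hP : IsClopenPartition X P)
    (hx : x ∈ X) (a b : ℤ) : codedWord (partIndex P) x a b ∈ wordsOver P.length := by
  intro j hj
  obtain ⟨i, -, rfl⟩ := List.mem_map.1 hj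
  exact lt_length_of_mem_clopenOf ((hP.mem_iff (hX.seqShift_mem _ hx)).2 rfl)

theorem computablePred_isClopenPartition (hX : IsSubshift X) (hPi : IsPiOne X)
    (hre : REPred fun u => u ∈ wordsOf X) : ComputablePred (IsClopenPartition X) := by
  obtain ⟨K, hK⟩ := hX.exists_alphabet
  have henc : Primrec fun P : List (List (List ℕ)) => Encodable.encode P := Primrec.encode
  have hmatch : PrimrecPred fun z : List (List (List ℕ)) × List ℕ => MatchesUnique z.1 z.2 :=
    primrecPred_matchesUnique Primrec.fst Primrec.snd
  refine ComputablePred.computable_iff_re_compl_re'.2 ⟨?_, ?_⟩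
  · refine REPred.of_eq (REPred.forall_mem (p := fun (P : List (List (List ℕ))) v =>
      v ∉ wordsOf X ∨ MatchesUnique P v) ((REPred.comp hPi Computable.snd).or hmatch.to_re)
        (primrec_wordList.comp (Primrec.const K) henc).to_comp) fun P => ?_
    rw [hX.isClopenPartition_iff]
    constructor
    · intro h v hv hl
      obtain ⟨x, hx, i, hi⟩ := hv
      exact (h v (hl ▸ mem_wordList_of_occursAt hK hx hi)).resolve_left
        (not_not.2 ⟨x, hx, i, hi⟩)
    · exact fun h v hv => not_or_of_imp fun hvX => h v hvX (mem_wordList.1 hv).1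
  · refine REPred.of_eq (REPred.exists (p := fun (P : List (List (List ℕ))) (v : List ℕ) =>
      (v ∈ wordsOf X ∧ v.length = Encodable.encode P) ∧ ¬ MatchesUnique P v)
      (((hre.comp Computable.snd).and (PrimrecPred.to_re (Primrec.eq.comp
        (Primrec.list_length.comp Primrec.snd) (henc.comp Primrec.fst)))).and
        hmatch.not.to_re)) fun P => ?_
    rw [hX.isClopenPartition_iff]
    push Not
    exact exists_congr fun v => and_assoc

theorem rePred_hasTrace (hX : IsSubshift X) (hre : REPred fun u => u ∈ wordsOf X) :
    REPred fun I : StarfreeExpr × List (List (List ℕ)) =>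
      HasTrace X I.2 (I.1.lang I.2.length) := by
  have hlang : REPred fun z : (StarfreeExpr × List (List (List ℕ))) × List ℕ × List ℕ =>
      z.2.1 ∈ z.1.1.lang z.1.2.length :=
    REPred.comp computablePred_mem_lang.to_re
      (f := fun z : (StarfreeExpr × List (List (List ℕ))) × List ℕ × List ℕ =>
        ((z.2.1, z.1.2.length), z.1.1))
      (Primrec.pair (Primrec.pair (Primrec.fst.comp Primrec.snd) (Primrec.list_length.comp
        (Primrec.snd.comp Primrec.fst))) (Primrec.fst.comp Primrec.fst)).to_comp
  have hvis : PrimrecPred fun z : (StarfreeExpr × List (List (List ℕ))) × List ℕ × List ℕ =>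
      Visits z.1.2 z.2.1 z.2.2 :=
    primrecPred_visits (Primrec.snd.comp Primrec.fst) (Primrec.fst.comp Primrec.snd)
      (Primrec.snd.comp Primrec.snd)
  have hlen : PrimrecPred fun z : (StarfreeExpr × List (List (List ℕ))) × List ℕ × List ℕ =>
      z.2.2.length = z.2.1.length + Encodable.encode z.1.2 :=
    Primrec.eq.comp (Primrec.list_length.comp (Primrec.snd.comp Primrec.snd))
      (Primrec.nat_add.comp (Primrec.list_length.comp (Primrec.fst.comp Primrec.snd))
        (Primrec.encode.comp (Primrec.snd.comp Primrec.fst)))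
  refine REPred.of_eq (REPred.exists (p := fun (I : StarfreeExpr × List (List (List ℕ)))
    (q : List ℕ × List ℕ) => (q.1 ∈ I.1.lang I.2.length ∧ q.2 ∈ wordsOf X) ∧
      q.2.length = q.1.length + Encodable.encode I.2 ∧ Visits I.2 q.1 q.2)
      ((hlang.and (hre.comp (Computable.snd.comp Computable.snd))).and
        (hlen.to_re.and hvis.to_re))) fun I => ?_
  rw [hX.hasTrace_iff_exists_visits]
  constructor
  · rintro ⟨⟨w, v⟩, ⟨hw, hv⟩, hl, h⟩
    exact ⟨w, hw, v, hv, hl, h⟩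
  · rintro ⟨w, hw, v, hv, hl, h⟩
    exact ⟨(w, v), ⟨hw, hv⟩, hl, h⟩

/-- A trace of any length is a coded word, hence similar to a coded word of length at most `N`. The
latter is in the same language because `t` bounds the Gödel number of `e`, so a short trace exists
as well. -/
theorem IsClopenPartition.not_hasTrace_iff (hX : IsSubshift X) (hP : IsClopenPartition X P)
    {K : ℕ} (hK : ∀ x ∈ X, ∀ i, x i < K) {e : StarfreeExpr} {N : ℕ} (he : e.toNat ≤ t)
    (ht : Encodable.encode P ≤ t) (hsim : ∀ f, IsLocal t f → ∀ x ∈ X, ∀ a b : ℤ, ∃ y ∈ X,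
      ∃ a' b' : ℤ, a' ≤ b' ∧ b' - a' ≤ N ∧
        WordSim t t (codedWord f x a b) (codedWord f y a' b')) :
    ¬ HasTrace X P (e.lang P.length) ↔ ∀ w ∈ wordsUpTo P.length N,
      ∀ v ∈ wordList K (w.length + Encodable.encode P),
        (w ∉ e.lang P.length ∨ v ∉ wordsOf X) ∨ ¬ Visits P w v := by
  constructor
  · intro h w _ v hv
    by_contra! hcon
    exact h (hX.hasTrace_iff_exists_visits.2
      ⟨w, hcon.1.1, v, hcon.1.2, (mem_wordList.1 hv).1, hcon.2⟩)
  · intro h htr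
    obtain ⟨w, hw, x, hx, hwx⟩ := hasTrace_iff.1 htr
    have hwx' := (hP.forall_mem_iff hX hx (a := 0)).1 (by simpa using hwx)
    obtain ⟨y, hy, a, b, hab, hba, hwy⟩ := hsim _ (isLocal_partIndex ht) x hx 0 (0 + w.length)
    have hyw := hP.codedWord_mem_wordsOver hX hy a b
    rw [← hwx'] at hwy
    have hylen : (codedWord (partIndex P) y a b).length = b - a := by
      rw [length_codedWord]
      omega
    have hyL : codedWord (partIndex P) y a b ∈ e.lang P.length :=
      hwy.mem_lang_of_mem ((depth_le_toNat e).trans he) (lengthsLE_toNat e _ he)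
        (lang_subset_wordsOver _ _ hw) hyw hw
    refine (h _ (mem_wordsUpTo.2 ⟨by omega, hyw⟩) (wordAt y a
      ((codedWord (partIndex P) y a b).length + Encodable.encode P))
      (wordAt_mem_wordList hK hy _ _)).elim (fun h => h.elim (absurd hyL) fun h => h
        (mem_wordsOf_of_occursAt hy occursAt_wordAt)) fun h => h (visits_wordAt.2 ?_)
    rw [hP.forall_mem_iff hX hy, hylen, add_sub_cancel]

theorem rePred_forall_wordsUpTo (hPi : IsPiOne X) (K : ℕ)
    {N : StarfreeExpr × List (List (List ℕ)) → ℕ} (hN : Computable N) :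
    REPred fun I : StarfreeExpr × List (List (List ℕ)) => ∀ w ∈ wordsUpTo I.2.length (N I),
      ∀ v ∈ wordList K (w.length + Encodable.encode I.2),
        (w ∉ I.1.lang I.2.length ∨ v ∉ wordsOf X) ∨ ¬ Visits I.2 w v := by
  have hlang : REPred fun z : ((StarfreeExpr × List (List (List ℕ))) × List ℕ) × List ℕ =>
      z.1.2 ∉ z.1.1.1.lang z.1.1.2.length :=
    REPred.comp computablePred_mem_lang.not.to_re
      (f := fun z : ((StarfreeExpr × List (List (List ℕ))) × List ℕ) × List ℕ =>
        ((z.1.2, z.1.1.2.length), z.1.1.1))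
      (Primrec.pair (Primrec.pair (Primrec.snd.comp Primrec.fst) (Primrec.list_length.comp
        (Primrec.snd.comp (Primrec.fst.comp Primrec.fst))))
        (Primrec.fst.comp (Primrec.fst.comp Primrec.fst))).to_comp
  have hX : REPred fun z : ((StarfreeExpr × List (List (List ℕ))) × List ℕ) × List ℕ =>
      z.2 ∉ wordsOf X := REPred.comp hPi Computable.snd
  have hvis : PrimrecPred fun z : ((StarfreeExpr × List (List (List ℕ))) × List ℕ) × List ℕ =>
      Visits z.1.1.2 z.1.2 z.2 :=
    primrecPred_visits (Primrec.snd.comp (Primrec.fst.comp Primrec.fst))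
      (Primrec.snd.comp Primrec.fst) Primrec.snd
  have hl : Computable fun z : (StarfreeExpr × List (List (List ℕ))) × List ℕ =>
      wordList K (z.2.length + Encodable.encode z.1.2) :=
    (primrec_wordList.comp (Primrec.const K) (Primrec.nat_add.comp
      (Primrec.list_length.comp Primrec.snd)
      (Primrec.encode.comp (Primrec.snd.comp Primrec.fst)))).to_comp
  have hl' : Computable fun I : StarfreeExpr × List (List (List ℕ)) =>
      wordsUpTo I.2.length (N I) :=
    primrec_wordsUpTo.to_comp.comp (Primrec.list_length.comp Primrec.snd).to_comp hN
  have h : REPred fun z : (StarfreeExpr × List (List (List ℕ))) × List ℕ =>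
      ∀ v ∈ wordList K (z.2.length + Encodable.encode z.1.2),
        (z.2 ∉ z.1.1.lang z.1.2.length ∨ v ∉ wordsOf X) ∨ ¬ Visits z.1.2 z.2 v :=
    REPred.forall_mem (p := fun (z : (StarfreeExpr × List (List (List ℕ))) × List ℕ) v =>
      (z.2 ∉ z.1.1.lang z.1.2.length ∨ v ∉ wordsOf X) ∨ ¬ Visits z.1.2 z.2 v)
      ((hlang.or hX).or hvis.not.to_re) hl
  exact REPred.forall_mem (p := fun (I : StarfreeExpr × List (List (List ℕ))) (w : List ℕ) =>
    ∀ v ∈ wordList K (w.length + Encodable.encode I.2),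
      (w ∉ I.1.lang I.2.length ∨ v ∉ wordsOf X) ∨ ¬ Visits I.2 w v) h hl'

/-- Post's theorem: instances with a trace are enumerable by search. For a negative answer, either
`P` is not a partition, which is decidable, or the finite list of candidates below the bound is
refuted. -/
theorem decidableStarfreeModelChecking_of_bound (hX : IsSubshift X) (hPi : IsPiOne X)
    (hre : REPred fun u => u ∈ wordsOf X) {M : ℕ → ℕ} (hM : Computable M)
    (hsim : ∀ t f, IsLocal t f → ∀ x ∈ X, ∀ a b : ℤ, ∃ y ∈ X, ∃ a' b' : ℤ, a' ≤ b' ∧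
      b' - a' ≤ M t ∧ WordSim t t (codedWord f x a b) (codedWord f y a' b')) :
    DecidableStarfreeModelChecking X := by
  obtain ⟨K, hK⟩ := hX.exists_alphabet
  have hpart := computablePred_isClopenPartition hX hPi hre
  have hN : Computable fun I : StarfreeExpr × List (List (List ℕ)) =>
      M (Encodable.encode I.1 + Encodable.encode I.2) :=
    hM.comp (Primrec.nat_add.comp (Primrec.encode.comp Primrec.fst)
      (Primrec.encode.comp Primrec.snd)).to_comp
  refine ComputablePred.computable_iff_re_compl_re'.2
    ⟨(hpart.to_re.comp Computable.snd).and (rePred_hasTrace hX hre), ?_⟩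
  refine ((hpart.not.to_re.comp Computable.snd).or
    (rePred_forall_wordsUpTo hPi K hN)).of_eq fun I => ?_
  by_cases hP : IsClopenPartition X I.2
  · simp only [hP, not_true, false_or, true_and]
    exact (hP.not_hasTrace_iff hX hK (Nat.le_add_right _ _) (Nat.le_add_left _ _)
      (hsim (Encodable.encode I.1 + Encodable.encode I.2))).symm
  · simp [hP]

end ModelChecking

theorem mainTheorem10 (X : Set (ℤ → ℕ)) (hX : IsSubshift X) (hPi : IsPiOne X)
    (hcount : X.Countable) (hQW : (subsystems X).encard ≤ 5) :
    DecidableStarfreeModelChecking X := by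
  have hQ : (subsystems X).encard ≤ (5 : ℕ) := by exact_mod_cast hQW
  obtain ⟨M, hM, hsim⟩ := exists_computable_bound_of_encard_le hX hPi hcount hQ
  exact decidableStarfreeModelChecking_of_bound hX hPi
    (rePred_mem_wordsOf hX hPi hcount (Set.finite_of_encard_le_coe hQ)) hM hsim
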